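/- **Model.** An algorithm is a fixed (deterministic) while-program working on a read-only array $P[0],\dots,P[n-1]$ of points of $\mathbb{R}^2$. Its work space consists of cells that each hold a word of $w$ bits (a natural number less than $2^w$), all initially $0$. It may do integer arithmetic ($+$, truncated $-$, $\times$, integer division) on constants, $n$ and cell contents, with indirect addressing; compare integers; and compare real numbers given by arithmetic expressions ($+,-,\times,\div$) in natural-number constants and the coordinates of input points whose indices it has computed. Real numbers themselves are not stored in the work space. Every constant, access to the array or to a work cell, arithmetic operation, comparison and logical connective, as well as every write to a work cell and every report of an edge to the write-only output stream, costs one unit of time. **Output.** A directed edge $(a,b)$ of the convex hull of a set $A$ consists of two distinct extreme points $a\ne b$ of $\operatorname{conv}(A)$ such that no point of $A$ lies strictly to the left of the directed line from $a$ to $b$. (A hull that is a line segment has two directed edges, and a hull that is a point has none.) The hull is *reported in order* if each directed edge is output exactly once and each output edge starts at the point where the previous one ends, so that the edges appear in clockwise order along the boundary. **Theorem.** There are an algorithm in this model and a constant $C$ such that for every $n$ and every array of $n$ points of the plane sorted by $x$-coordinate (in non-decreasing order, ties allowed), the algorithm halts and reports the edges of the convex hull of the $n$ points in order. Moreover, if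 $n\ge 2$, it uses at most $C\log_2 n$ work cells, each of at most $C\log_2 n$ bits, and its running time is at most $C\,n^{1+\varepsilon}$ for every real $\varepsilon$ with $$\sqrt{\frac{\log_2\log_2 n}{\log_2 n}}<\varepsilon<1 .$$ -/

import Mathlib

/-!
Algorithms on a read-only array of `n` points of the plane.

An algorithm is a fixed while-program.  The input array and its length can be read but not
written.  The work space consists of `s` cells, each of which holds a word of `w` bits (a natural
number below `2 ^ w`: an index, a counter, a flag).  The coordinates are real numbers; they enter
computations only through tests between arithmetic expressions in the coordinates of input points,
so that no unbounded amount of information can be packed into one cell (a real such as the slope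
of the line through two input points is kept as the two indices).  Results go to a write-only
output stream.  Every constant, array access, memory access, arithmetic operation, comparison and
connective takes one unit of time.
-/

namespace ReadOnly

/-- Points of the plane. -/
abbrev Pt : Type := ℝ × ℝ

/-- Contents of the work space; cells outside the available `s` cells keep the value `0`. -/
abbrev Mem : Type := ℕ → ℕ

/-- Integer expressions: constants, the length of the input array, the content of the work cell
with a computed address, and arithmetic (with truncated subtraction and rounded-down division). -/
inductive IExp : Type
  | const (k : ℕ)
  | len
  | load (a : IExp)
  | add (a b : IExp)
  | sub (a b : IExp)
  | mul (a b : IExp)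
  | div (a b : IExp)

/-- The value of an integer expression. -/
def IExp.eval (n : ℕ) (m : Mem) : IExp → ℕ
  | .const k => k
  | .len => n
  | .load a => m (a.eval n m)
  | .add a b => a.eval n m + b.eval n m
  | .sub a b => a.eval n m - b.eval n m
  | .mul a b => a.eval n m * b.eval n m
  | .div a b => a.eval n m / b.eval n m

/-- The number of operations in an integer expression. -/
def IExp.cost : IExp → ℕ
  | .const _ => 1
  | .len => 1
  | .load a => a.cost + 1
  | .add a b => a.cost + b.cost + 1
  | .sub a b => a.cost + b.cost + 1
  | .mul a b => a.cost + b.cost + 1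
  | .div a b => a.cost + b.cost + 1

/-- Read access to the input array; an index out of range reads the origin. -/
def fetch {n : ℕ} (P : Fin n → Pt) (i : ℕ) : Pt :=
  if h : i < n then P ⟨i, h⟩ else 0

/-- Real expressions: natural constants, the coordinates of the input point with a computed
index, and the four arithmetic operations. -/
inductive RExp : Type
  | const (k : ℕ)
  | xcoord (i : IExp)
  | ycoord (i : IExp)
  | add (a b : RExp)
  | sub (a b : RExp)
  | mul (a b : RExp)
  | div (a b : RExp)

/-- The value of a real expression. -/
noncomputable def RExp.eval {n : ℕ} (P : Fin n → Pt) (m : Mem) : RExp → ℝ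
  | .const k => (k : ℝ)
  | .xcoord i => (fetch P (i.eval n m)).1
  | .ycoord i => (fetch P (i.eval n m)).2
  | .add a b => a.eval P m + b.eval P m
  | .sub a b => a.eval P m - b.eval P m
  | .mul a b => a.eval P m * b.eval P m
  | .div a b => a.eval P m / b.eval P m

/-- The number of operations in a real expression. -/
def RExp.cost : RExp → ℕ
  | .const _ => 1
  | .xcoord i => i.cost + 1
  | .ycoord i => i.cost + 1
  | .add a b => a.cost + b.cost + 1
  | .sub a b => a.cost + b.cost + 1
  | .mul a b => a.cost + b.cost + 1
  | .div a b => a.cost + b.cost + 1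

/-- Tests: comparisons of integers, comparisons of reals, negation and conjunction. -/
inductive BExp : Type
  | ilt (a b : IExp)
  | ieq (a b : IExp)
  | rlt (a b : RExp)
  | req (a b : RExp)
  | not (b : BExp)
  | and (b c : BExp)

/-- The truth value of a test. -/
def BExp.eval {n : ℕ} (P : Fin n → Pt) (m : Mem) : BExp → Prop
  | .ilt a b => a.eval n m < b.eval n m
  | .ieq a b => a.eval n m = b.eval n m
  | .rlt a b => a.eval P m < b.eval P m
  | .req a b => a.eval P m = b.eval P m
  | .not b => ¬ b.eval P m
  | .and b c => b.eval P m ∧ c.eval P m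

/-- The number of operations in a test. -/
def BExp.cost : BExp → ℕ
  | .ilt a b => a.cost + b.cost + 1
  | .ieq a b => a.cost + b.cost + 1
  | .rlt a b => a.cost + b.cost + 1
  | .req a b => a.cost + b.cost + 1
  | .not b => b.cost + 1
  | .and b c => b.cost + c.cost + 1

/-- While-programs.  `store a e` writes the value of `e` into the work cell with address `a`;
`report i j` appends the directed edge from the `i`-th to the `j`-th input point to the output. -/
inductive Program : Type
  | skip
  | store (a e : IExp)
  | report (i j : IExp)
  | seq (p q : Program)
  | cond (b : BExp) (p q : Program)
  | loop (b : BExp) (p : Program)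

/-- `Exec P s w p m m' out t`: on input `P`, with `s` work cells of `w` bits each, the program `p`
started with work space `m` halts after exactly `t` units of time with work space `m'`, having
output the list `out`.  There is no execution that writes outside the `s` cells, writes a number
that does not fit into a word, or reports a point with an index out of range. -/
inductive Exec {n : ℕ} (P : Fin n → Pt) (s w : ℕ) :
    Program → Mem → Mem → List (Pt × Pt) → ℕ → Prop
  | skip (m : Mem) : Exec P s w .skip m m [] 1
  | store (a e : IExp) (m : Mem) (ha : a.eval n m < s) (he : e.eval n m < 2 ^ w) :
      Exec P s w (.store a e) m (Function.update m (a.eval n m) (e.eval n m)) []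
        (a.cost + e.cost + 1)
  | report (i j : IExp) (m : Mem) (hi : i.eval n m < n) (hj : j.eval n m < n) :
      Exec P s w (.report i j) m m [(P ⟨i.eval n m, hi⟩, P ⟨j.eval n m, hj⟩)]
        (i.cost + j.cost + 1)
  | seq {p q : Program} {m₀ m₁ m₂ : Mem} {o₁ o₂ : List (Pt × Pt)} {t₁ t₂ : ℕ}
      (hp : Exec P s w p m₀ m₁ o₁ t₁) (hq : Exec P s w q m₁ m₂ o₂ t₂) :
      Exec P s w (.seq p q) m₀ m₂ (o₁ ++ o₂) (t₁ + t₂)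
  | cond_true {b : BExp} {p q : Program} {m m' : Mem} {o : List (Pt × Pt)} {t : ℕ}
      (hb : b.eval P m) (hp : Exec P s w p m m' o t) :
      Exec P s w (.cond b p q) m m' o (b.cost + t)
  | cond_false {b : BExp} {p q : Program} {m m' : Mem} {o : List (Pt × Pt)} {t : ℕ}
      (hb : ¬ b.eval P m) (hq : Exec P s w q m m' o t) :
      Exec P s w (.cond b p q) m m' o (b.cost + t)
  | loop_done {b : BExp} {p : Program} {m : Mem} (hb : ¬ b.eval P m) :
      Exec P s w (.loop b p) m m [] b.cost
  | loop_step {b : BExp} {p : Program} {m₀ m₁ m₂ : Mem} {o₁ o₂ : List (Pt × Pt)} {t₁ t₂ : ℕ}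
      (hb : b.eval P m₀) (hp : Exec P s w p m₀ m₁ o₁ t₁)
      (hl : Exec P s w (.loop b p) m₁ m₂ o₂ t₂) :
      Exec P s w (.loop b p) m₀ m₂ (o₁ ++ o₂) (b.cost + t₁ + t₂)

/-- The program `p`, run on the input `P` with `s` work cells of `w` bits, all initially `0`, halts
after exactly `t` units of time with output `out`. -/
def Computes {n : ℕ} (p : Program) (P : Fin n → Pt) (s w t : ℕ) (out : List (Pt × Pt)) : Prop :=
  ∃ m : Mem, Exec P s w p (fun _ => 0) m out t

/-- `(a, b)` is an edge of the convex hull of `A`, directed clockwise: `a` and `b` are distinct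
vertices (extreme points) of the convex hull, and no point of `A` lies to the left of the directed
line from `a` to `b`.  If the hull is a line segment, it has two directed edges, the segment in
either direction (the upper and the lower hull); if it is a point, it has none. -/
def IsHullEdge (A : Set Pt) (a b : Pt) : Prop :=
  a ∈ (convexHull ℝ A).extremePoints ℝ ∧ b ∈ (convexHull ℝ A).extremePoints ℝ ∧ a ≠ b ∧
    ∀ p ∈ A, (b.1 - a.1) * (p.2 - a.2) - (b.2 - a.2) * (p.1 - a.1) ≤ 0

/-- `out` lists each edge of the convex hull of `A` exactly once, in clockwise order along the
boundary: each edge starts where the previous one ends. -/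
def ListsHullInOrder (A : Set Pt) (out : List (Pt × Pt)) : Prop :=
  (∀ e : Pt × Pt, e ∈ out ↔ IsHullEdge A e.1 e.2) ∧ out.Nodup ∧
    out.IsChain (fun e f => e.2 = f.1)

end ReadOnly

/-! The upper hull of a sorted range is found by divide and conquer. Cut the range in two, find the
bridge (the hull edge over the gap), walk the part up to its left end, report it, and walk the part
from its right end. The depth is logarithmic and a pending bridge costs two cells. The two parts are
disjoint, so a bridge time linear in the length of the range is multiplied only by the depth
(`hull_reach`). That a bridge of a range between two hull vertices is an edge of the whole hull is
`support_of_range`. The lower hull is the upper hull of the point set rotated by a half turn; with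
the vertical sides this gives the full hull (`listsHullInOrder`).

The bridge is found by prune and search without storing the survivors. An open interval of slopes
containing the slope of the bridge is kept. A block of consecutive points is resolved if one of its
points is highest for all slopes in the interval; one scan at the lower end of the interval finds it
again (`Resolved.amax`). Two neighbouring resolved blocks merge into a resolved one unless the slope
through their highest points lies in the interval; then the pair is undecided. If no pair is
undecided, the block length doubles (`Blocks.double`). Otherwise an undecided slope with at most
three quarters of the undecided slopes on either side is taken as pivot and compared with the bridge
by computing the two tangents of that slope, which narrows the interval. With only two blocks left
the pair is always undecided (`Blocks.cand_zero`), so the process can end only with the bridge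
(`search_reach`).

A pivot among `b ^ (e + 1)` pairs is selected in small space as follows (`select_rounds`). Split the
pairs into `b` parts, take the part with the most undecided pairs, and recursively select a pivot
from it. If that pivot is bad for the whole, it still becomes a new bound and removes at least a
fraction `1 / (8 b)` of the original count. The remaining count never falls below half, so `4 b + 1`
rounds suffice. The time per point grows by a factor of order `b` per level while the number of
pairs also grows by `b`, and the stack has one frame per level.

With `b = 2 ^ q` and `q` least such that `2 ^ (q * q) ≥ n`, the depth is at most `q` and everything
takes `O(512 ^ q * n)` steps. Since `q - 1 ≤ √(log n)`, this is `n` times `2 ^ (9 √(log n))` up to a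
constant, and `9 √(log n) ≤ ε log n` as soon as `log log n ≥ 81` (`pow_mul_le_rpow`). -/

namespace ReadOnly

/-! ### Counting steps, and rules for reasoning about programs and loops. -/

/-- A bound on the cost of every single store, report and test of a program. -/
def Program.unitCost : Program → ℕ
  | .skip => 1
  | .store a e => a.cost + e.cost + 1
  | .report i j => i.cost + j.cost + 1
  | .seq p q => p.unitCost + q.unitCost
  | .cond b p q => b.cost + p.unitCost + q.unitCost
  | .loop b p => b.cost + p.unitCost

/-- Execution of a program in which every store, report, test and skip counts as one step. -/
inductive Run {n : ℕ} (P : Fin n → Pt) (s w : ℕ) :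
    Program → Mem → Mem → List (Pt × Pt) → ℕ → Prop
  | skip (m : Mem) : Run P s w .skip m m [] 1
  | store (a e : IExp) (m : Mem) (ha : a.eval n m < s) (he : e.eval n m < 2 ^ w) :
      Run P s w (.store a e) m (Function.update m (a.eval n m) (e.eval n m)) [] 1
  | report (i j : IExp) (m : Mem) (hi : i.eval n m < n) (hj : j.eval n m < n) :
      Run P s w (.report i j) m m [(P ⟨i.eval n m, hi⟩, P ⟨j.eval n m, hj⟩)] 1
  | seq {p q : Program} {m₀ m₁ m₂ : Mem} {o₁ o₂ : List (Pt × Pt)} {t₁ t₂ : ℕ}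
      (hp : Run P s w p m₀ m₁ o₁ t₁) (hq : Run P s w q m₁ m₂ o₂ t₂) :
      Run P s w (.seq p q) m₀ m₂ (o₁ ++ o₂) (t₁ + t₂)
  | cond_true {b : BExp} {p q : Program} {m m' : Mem} {o : List (Pt × Pt)} {t : ℕ}
      (hb : b.eval P m) (hp : Run P s w p m m' o t) :
      Run P s w (.cond b p q) m m' o (1 + t)
  | cond_false {b : BExp} {p q : Program} {m m' : Mem} {o : List (Pt × Pt)} {t : ℕ}
      (hb : ¬ b.eval P m) (hq : Run P s w q m m' o t) :
      Run P s w (.cond b p q) m m' o (1 + t)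
  | loop_done {b : BExp} {p : Program} {m : Mem} (hb : ¬ b.eval P m) :
      Run P s w (.loop b p) m m [] 1
  | loop_step {b : BExp} {p : Program} {m₀ m₁ m₂ : Mem} {o₁ o₂ : List (Pt × Pt)} {t₁ t₂ : ℕ}
      (hb : b.eval P m₀) (hp : Run P s w p m₀ m₁ o₁ t₁)
      (hl : Run P s w (.loop b p) m₁ m₂ o₂ t₂) :
      Run P s w (.loop b p) m₀ m₂ (o₁ ++ o₂) (1 + t₁ + t₂)

variable {n : ℕ} {P : Fin n → Pt} {s w : ℕ}

/-- The program is fixed, so `unitCost` is a constant. It suffices to count steps and to pass to the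
actual time once, at the very end. -/
theorem Run.exists_exec {p : Program} {m m' : Mem} {o : List (Pt × Pt)} {k : ℕ}
    (h : Run P s w p m m' o k) : ∃ t, Exec P s w p m m' o t ∧ t ≤ p.unitCost * k := by
  induction h with
  | skip m => exact ⟨1, .skip m, by simp [Program.unitCost]⟩
  | store a e m ha he => exact ⟨_, .store a e m ha he, by simp [Program.unitCost]⟩
  | report i j m hi hj => exact ⟨_, .report i j m hi hj, by simp [Program.unitCost]⟩
  | seq _ _ ih₁ ih₂ =>
    obtain ⟨t₁, h₁, b₁⟩ := ih₁
    obtain ⟨t₂, h₂, b₂⟩ := ih₂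
    exact ⟨_, .seq h₁ h₂, by simp only [Program.unitCost]; nlinarith⟩
  | cond_true hb _ ih =>
    obtain ⟨t, h, b⟩ := ih
    exact ⟨_, .cond_true hb h, by simp only [Program.unitCost]; nlinarith⟩
  | cond_false hb _ ih =>
    obtain ⟨t, h, b⟩ := ih
    exact ⟨_, .cond_false hb h, by simp only [Program.unitCost]; nlinarith⟩
  | loop_done hb => exact ⟨_, .loop_done hb, by simp [Program.unitCost]⟩
  | loop_step hb _ _ ih₁ ih₂ =>
    obtain ⟨t₁, h₁, b₁⟩ := ih₁
    obtain ⟨t₂, h₂, b₂⟩ := ih₂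
    exact ⟨_, .loop_step hb h₁ h₂, by simp only [Program.unitCost] at *; nlinarith⟩

variable (P s w) in
/-- Started with work space `m`, the program `p` halts within `k` steps, without output, and its
final work space satisfies `Q`. -/
def Does (p : Program) (m : Mem) (k : ℕ) (Q : Mem → Prop) : Prop :=
  ∃ m' k', Run P s w p m m' [] k' ∧ k' ≤ k ∧ Q m'

theorem Does.mono {p : Program} {m : Mem} {k k' : ℕ} {Q Q' : Mem → Prop}
    (h : Does P s w p m k Q) (hk : k ≤ k') (hQ : ∀ m', Q m' → Q' m') :
    Does P s w p m k' Q' := by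
  obtain ⟨m', j, hr, hj, hq⟩ := h
  exact ⟨m', j, hr, hj.trans hk, hQ _ hq⟩

theorem Does.skip {m : Mem} {Q : Mem → Prop} (h : Q m) : Does P s w .skip m 1 Q :=
  ⟨m, 1, .skip m, le_rfl, h⟩

theorem Does.seq {p q : Program} {m : Mem} {k₁ k₂ : ℕ} {Q : Mem → Prop}
    (h : Does P s w p m k₁ fun m₁ => Does P s w q m₁ k₂ Q) :
    Does P s w (.seq p q) m (k₁ + k₂) Q := by
  obtain ⟨m₁, j₁, h₁, b₁, m₂, j₂, h₂, b₂, hq⟩ := h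
  exact ⟨m₂, _, by simpa using Run.seq h₁ h₂, by omega, hq⟩

theorem Does.store {a e : IExp} {m : Mem} {Q : Mem → Prop} (ha : a.eval n m < s)
    (he : e.eval n m < 2 ^ w) (h : Q (Function.update m (a.eval n m) (e.eval n m))) :
    Does P s w (.store a e) m 1 Q :=
  ⟨_, 1, .store a e m ha he, le_rfl, h⟩

theorem Does.store_seq {a e : IExp} {q : Program} {m : Mem} {k : ℕ} {Q : Mem → Prop}
    (ha : a.eval n m < s) (he : e.eval n m < 2 ^ w)
    (h : Does P s w q (Function.update m (a.eval n m) (e.eval n m)) k Q) :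
    Does P s w (.seq (.store a e) q) m (1 + k) Q :=
  Does.seq (Does.store ha he h)

theorem Does.cond {b : BExp} {p q : Program} {m : Mem} {k : ℕ} {Q : Mem → Prop}
    (h₁ : b.eval P m → Does P s w p m k Q) (h₂ : ¬ b.eval P m → Does P s w q m k Q) :
    Does P s w (.cond b p q) m (1 + k) Q := by
  by_cases hb : b.eval P m
  · obtain ⟨m', j, hr, hj, hq⟩ := h₁ hb
    exact ⟨m', _, .cond_true hb hr, by omega, hq⟩
  · obtain ⟨m', j, hr, hj, hq⟩ := h₂ hb
    exact ⟨m', _, .cond_false hb hr, by omega, hq⟩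

/-- A loop whose invariant counts the remaining iterations. -/
theorem Does.loop {b : BExp} {p : Program} {k : ℕ} (I : ℕ → Mem → Prop)
    (hstep : ∀ r m, I (r + 1) m → b.eval P m ∧ Does P s w p m k (I r))
    (hdone : ∀ m, I 0 m → ¬ b.eval P m) (r : ℕ) (m : Mem) (h : I r m) :
    Does P s w (.loop b p) m (r * (k + 1) + 1) (I 0) := by
  induction r generalizing m with
  | zero => exact ⟨m, 1, .loop_done (hdone m h), by omega, h⟩
  | succ r ih =>
    obtain ⟨hb, m₁, j₁, h₁, b₁, hI⟩ := hstep r m h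
    obtain ⟨m₂, j₂, h₂, b₂, hI₂⟩ := ih m₁ hI
    refine ⟨m₂, _, by simpa using Run.loop_step hb h₁ h₂, ?_, hI₂⟩
    have : (r + 1) * (k + 1) = r * (k + 1) + (k + 1) := by ring
    omega

variable (P s w) in
/-- The loop `while b do p` gets from work space `m` to work space `m'` at the beginning of an
iteration within `k` steps, with output `o`. -/
def Reach (b : BExp) (p : Program) (m m' : Mem) (o : List (Pt × Pt)) (k : ℕ) : Prop :=
  ∀ m₂ o₂ k₂, Run P s w (.loop b p) m' m₂ o₂ k₂ →
    ∃ k₃ ≤ k + k₂, Run P s w (.loop b p) m m₂ (o ++ o₂) k₃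

theorem Reach.refl {b : BExp} {p : Program} (m : Mem) : Reach P s w b p m m [] 0 :=
  fun _ _ k₂ h => ⟨k₂, by omega, by simpa using h⟩

/-- Since `Reach` quantifies over the continuation of the loop, segments compose by substitution. A
recursion simulated by a single loop can thus be analysed by induction on the recursion, without one
invariant for all iterations. -/
theorem Reach.trans {b : BExp} {p : Program} {m₁ m₂ m₃ : Mem} {o₁ o₂ : List (Pt × Pt)}
    {k₁ k₂ : ℕ} (h₁ : Reach P s w b p m₁ m₂ o₁ k₁) (h₂ : Reach P s w b p m₂ m₃ o₂ k₂) :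
    Reach P s w b p m₁ m₃ (o₁ ++ o₂) (k₁ + k₂) := by
  intro m o k h
  obtain ⟨k', hk', h'⟩ := h₂ _ _ _ h
  obtain ⟨k'', hk'', h''⟩ := h₁ _ _ _ h'
  exact ⟨k'', by omega, by simpa using h''⟩

theorem Reach.mono {b : BExp} {p : Program} {m m' : Mem} {o : List (Pt × Pt)} {k k' : ℕ}
    (h : Reach P s w b p m m' o k) (hk : k ≤ k') : Reach P s w b p m m' o k' := by
  intro m₂ o₂ k₂ h₂
  obtain ⟨k₃, hk₃, h₃⟩ := h _ _ _ h₂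
  exact ⟨k₃, by omega, h₃⟩

theorem Reach.step {b : BExp} {p : Program} {m m' : Mem} {o : List (Pt × Pt)} {k : ℕ}
    (hb : b.eval P m) (h : Run P s w p m m' o k) : Reach P s w b p m m' o (k + 1) :=
  fun _ _ _ h₂ => ⟨_, by omega, .loop_step hb h h₂⟩

theorem Reach.of_does {b : BExp} {p : Program} {m : Mem} {k : ℕ} {Q : Mem → Prop}
    (hb : b.eval P m) (h : Does P s w p m k Q) :
    ∃ m', Reach P s w b p m m' [] (k + 1) ∧ Q m' := by
  obtain ⟨m', j, hr, hj, hq⟩ := h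
  exact ⟨m', (Reach.step hb hr).mono (by omega), hq⟩

theorem Reach.run {b : BExp} {p : Program} {m m' : Mem} {o : List (Pt × Pt)} {k : ℕ}
    (h : Reach P s w b p m m' o k) (hb : ¬ b.eval P m') :
    ∃ k' ≤ k + 1, Run P s w (.loop b p) m m' o k' := by
  simpa using h _ _ _ (.loop_done hb)

end ReadOnly

/-! ### Scans for a maximum, slopes, and resolved blocks. -/

namespace ReadOnly

open Classical in
/-- The result of scanning `a, a + 1, …, a + k`, where `gt i b` decides whether `i` replaces the
current best `b`. -/
noncomputable def amax (gt : ℕ → ℕ → Prop) (a : ℕ) : ℕ → ℕ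
  | 0 => a
  | k + 1 => if gt (a + k + 1) (amax gt a k) then a + k + 1 else amax gt a k

theorem le_amax (gt : ℕ → ℕ → Prop) (a k : ℕ) : a ≤ amax gt a k ∧ amax gt a k ≤ a + k := by
  induction k with
  | zero => simp [amax]
  | succ k ih => rw [amax]; split_ifs <;> omega

/-- A strict test keeps the first maximum and a weak one (`amax_weak`) the last. In a sorted array
these are a leftmost and a rightmost maximum; both are needed for the ends of a bridge. -/
theorem amax_strict {α : Type*} [LinearOrder α] (key : ℕ → α) {gt : ℕ → ℕ → Prop}
    (hgt : ∀ i b, gt i b ↔ key b < key i) (a k : ℕ) :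
    (∀ t, a ≤ t → t ≤ a + k → key t ≤ key (amax gt a k)) ∧
      ∀ t, a ≤ t → t < amax gt a k → key t < key (amax gt a k) := by
  induction k with
  | zero =>
    refine ⟨fun t h₁ h₂ => ?_, fun t h₁ h₂ => ?_⟩
    · obtain rfl : t = a := by omega
      exact le_rfl
    · simp only [amax] at h₂; omega
  | succ k ih =>
    have hb := le_amax gt a k
    rw [amax]
    split_ifs with h
    · rw [hgt] at h
      have key_le : ∀ t, a ≤ t → t < a + k + 1 → key t < key (a + k + 1) :=
        fun t h₁ h₂ => (ih.1 t h₁ (by omega)).trans_lt h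
      refine ⟨fun t h₁ h₂ => ?_, key_le⟩
      rcases eq_or_lt_of_le h₂ with rfl | h₃
      · exact le_rfl
      · exact (key_le t h₁ h₃).le
    · rw [hgt, not_lt] at h
      refine ⟨fun t h₁ h₂ => ?_, ih.2⟩
      rcases eq_or_lt_of_le h₂ with rfl | h₃
      · exact h
      · exact ih.1 t h₁ (by omega)

theorem amax_weak {α : Type*} [LinearOrder α] (key : ℕ → α) {gt : ℕ → ℕ → Prop}
    (hgt : ∀ i b, gt i b ↔ key b ≤ key i) (a k : ℕ) :
    (∀ t, a ≤ t → t ≤ a + k → key t ≤ key (amax gt a k)) ∧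
      ∀ t, amax gt a k < t → t ≤ a + k → key t < key (amax gt a k) := by
  induction k with
  | zero =>
    refine ⟨fun t h₁ h₂ => ?_, fun t h₁ h₂ => ?_⟩
    · obtain rfl : t = a := by omega
      exact le_rfl
    · simp only [amax] at h₁; omega
  | succ k ih =>
    have hb := le_amax gt a k
    rw [amax]
    split_ifs with h
    · rw [hgt] at h
      refine ⟨fun t h₁ h₂ => ?_, fun t h₁ h₂ => by omega⟩
      rcases eq_or_lt_of_le h₂ with rfl | h₃
      · exact le_rfl
      · exact (ih.1 t h₁ (by omega)).trans h
    · rw [hgt, not_le] at h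
      refine ⟨fun t h₁ h₂ => ?_, fun t h₁ h₂ => ?_⟩
      · rcases eq_or_lt_of_le h₂ with rfl | h₃
        · exact h.le
        · exact ih.1 t h₁ (by omega)
      · rcases eq_or_lt_of_le h₂ with rfl | h₃
        · exact h
        · exact ih.2 t h₁ (by omega)

/-- The slope of the line through two points, given by their indices. -/
noncomputable def slope (Q : ℕ → Pt) (a : ℕ × ℕ) : ℝ :=
  ((Q a.2).2 - (Q a.1).2) / ((Q a.2).1 - (Q a.1).1)

/-- The intercept of the line of slope `σ` through the point with index `t`. -/
noncomputable def height (Q : ℕ → Pt) (σ : ℝ) (t : ℕ) : ℝ := (Q t).2 - σ * (Q t).1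

/-- `σ` exceeds the lower bound `l`; a pair of equal indices stands for `-∞`. -/
def Above (Q : ℕ → Pt) (l : ℕ × ℕ) (σ : ℝ) : Prop := l.1 = l.2 ∨ slope Q l < σ

/-- `σ` is less than the upper bound `r`; a pair of equal indices stands for `+∞`. -/
def Below (Q : ℕ → Pt) (r : ℕ × ℕ) (σ : ℝ) : Prop := r.1 = r.2 ∨ σ < slope Q r

/-- Comparison of two points with respect to slopes slightly greater than `l`. -/
def Higher (Q : ℕ → Pt) (l : ℕ × ℕ) (i b : ℕ) : Prop :=
  (l.1 = l.2 ∧ ((Q b).1 < (Q i).1 ∨ ((Q b).1 = (Q i).1 ∧ (Q b).2 < (Q i).2))) ∨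
    (l.1 ≠ l.2 ∧ height Q (slope Q l) b < height Q (slope Q l) i)

/-- On the block `[a, c)`, one point is highest for all slopes between `l` and `r`. -/
def Resolved (Q : ℕ → Pt) (l r : ℕ × ℕ) (a c : ℕ) : Prop :=
  ∃ p, a ≤ p ∧ p < c ∧ ∀ t, a ≤ t → t < c → ∀ σ, Above Q l σ → Below Q r σ →
    height Q σ t ≤ height Q σ p

/-- The interval of slopes between `l` and `r` is nonempty. -/
def Proper (Q : ℕ → Pt) (l r : ℕ × ℕ) : Prop := l.1 = l.2 ∨ r.1 = r.2 ∨ slope Q l < slope Q r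

/-- This is the passage to the limit `σ → l`. The predicate `P` stands for the bound at the other
end of the interval, which is satisfied near `l`. -/
theorem affine_le_of_forall_gt {α β l : ℝ} (P : ℝ → Prop) (hP : ∃ r > l, ∀ σ, l < σ → σ < r → P σ)
    (h : ∀ σ, l < σ → P σ → α ≤ β * σ) : α ≤ β * l := by
  obtain ⟨r, hr, hP⟩ := hP
  by_contra! hc
  by_cases hβ : β ≤ 0
  · have := h ((l + r) / 2) (by linarith) (hP _ (by linarith) (by linarith))
    nlinarith
  · push Not at hβ
    have hd : 0 < (α - β * l) / (2 * β) := by apply div_pos <;> linarith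
    -- The first term keeps `σ` where `P` holds; the second keeps `β * σ` at most halfway from `β *
    -- l` to `α`, hence below `α`.
    set σ := min ((l + r) / 2) (l + (α - β * l) / (2 * β)) with hσ
    have h₁ : l < σ := lt_min (by linarith) (by linarith)
    have h₂ : σ < r := (min_le_left _ _).trans_lt (by linarith)
    have h₃ := h σ h₁ (hP σ h₁ h₂)
    have h₄ : β * σ ≤ β * (l + (α - β * l) / (2 * β)) :=
      mul_le_mul_of_nonneg_left (min_le_right _ _) hβ.le
    have h₅ : β * (l + (α - β * l) / (2 * β)) = β * l + (α - β * l) / 2 := by field_simp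
    linarith

theorem affine_le_of_forall_lt {α β r : ℝ} (P : ℝ → Prop) (hP : ∃ l < r, ∀ σ, l < σ → σ < r → P σ)
    (h : ∀ σ, σ < r → P σ → α ≤ β * σ) : α ≤ β * r := by
  obtain ⟨l, hl, hP⟩ := hP
  have := @affine_le_of_forall_gt α (-β) (-r) (fun σ => P (-σ))
    ⟨-l, by linarith, fun σ h₁ h₂ => hP _ (by linarith) (by linarith)⟩
    (fun σ h₁ h₂ => by have := h (-σ) (by linarith) h₂; linarith)
  linarith

theorem nonneg_of_forall_large {α β l : ℝ} (h : ∀ σ, l < σ → α ≤ β * σ) : 0 ≤ β := by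
  by_contra! hβ
  -- For negative `β`, the value `(α - 1) / β` and everything beyond it gives `β * σ ≤ α - 1`.
  have h₁ := h (max (l + 1) ((α - 1) / β)) (lt_max_of_lt_left (by linarith))
  have h₂ : β * max (l + 1) ((α - 1) / β) ≤ β * ((α - 1) / β) :=
    mul_le_mul_of_nonpos_left (le_max_right _ _) hβ.le
  have h₃ : β * ((α - 1) / β) = α - 1 := mul_div_cancel₀ _ hβ.ne
  linarith

theorem nonpos_of_forall_small {α β r : ℝ} (h : ∀ σ, σ < r → α ≤ β * σ) : β ≤ 0 := by
  have := @nonneg_of_forall_large α (-β) (-r) fun σ hσ => by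
    have := h (-σ) (by linarith); linarith
  linarith

section

variable {Q : ℕ → Pt} {l r : ℕ × ℕ}

theorem Proper.above (h : Proper Q l r) (hl : l.1 ≠ l.2) :
    ∃ ρ > slope Q l, ∀ σ, slope Q l < σ → σ < ρ → Below Q r σ := by
  rcases h with h | h | h
  · exact absurd h hl
  · exact ⟨slope Q l + 1, by linarith, fun _ _ _ => Or.inl h⟩
  · exact ⟨slope Q r, h, fun _ _ h' => Or.inr h'⟩

theorem Proper.below (h : Proper Q l r) (hr : r.1 ≠ r.2) :
    ∃ ρ < slope Q r, ∀ σ, ρ < σ → σ < slope Q r → Above Q l σ := by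
  rcases h with h | h | h
  · exact ⟨slope Q r - 1, by linarith, fun _ _ _ => Or.inl h⟩
  · exact absurd h hr
  · exact ⟨slope Q l, h, fun _ h' _ => Or.inr h'⟩

/-- There are two different slopes between `l` and `r`. -/
theorem Proper.exists_two (h : Proper Q l r) :
    ∃ σ τ, σ < τ ∧ Above Q l σ ∧ Below Q r σ ∧ Above Q l τ ∧ Below Q r τ := by
  by_cases hl : l.1 = l.2
  · by_cases hr : r.1 = r.2
    · exact ⟨0, 1, by norm_num, .inl hl, .inl hr, .inl hl, .inl hr⟩
    · exact ⟨slope Q r - 2, slope Q r - 1, by linarith, .inl hl, .inr (by linarith), .inl hl,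
        .inr (by linarith)⟩
  · obtain ⟨ρ, h₁, h₂⟩ := h.above hl
    refine ⟨slope Q l + (ρ - slope Q l) / 3, slope Q l + (ρ - slope Q l) / 2, by linarith,
      .inr (by linarith), h₂ _ ?_ ?_, .inr (by linarith), h₂ _ ?_ ?_⟩ <;> linarith

/-- A bound on all slopes between `l` and `r` extends to the lower end. -/
theorem height_le_at_lower (h : Proper Q l r) (hl : l.1 ≠ l.2) {t p : ℕ}
    (hp : ∀ σ, Above Q l σ → Below Q r σ → height Q σ t ≤ height Q σ p) :
    height Q (slope Q l) t ≤ height Q (slope Q l) p := by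
  have := @affine_le_of_forall_gt ((Q t).2 - (Q p).2) ((Q t).1 - (Q p).1) (slope Q l) (Below Q r)
    (h.above hl) fun σ h₁ h₂ => by
      have := hp σ (.inr h₁) h₂
      simp only [height] at this; linarith
  simp only [height]; linarith

theorem height_le_at_upper (h : Proper Q l r) (hr : r.1 ≠ r.2) {t p : ℕ}
    (hp : ∀ σ, Above Q l σ → Below Q r σ → height Q σ t ≤ height Q σ p) :
    height Q (slope Q r) t ≤ height Q (slope Q r) p := by
  have := @affine_le_of_forall_lt ((Q t).2 - (Q p).2) ((Q t).1 - (Q p).1) (slope Q r) (Above Q l)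
    (h.below hr) fun σ h₁ h₂ => by
      have := hp σ h₂ (.inr h₁)
      simp only [height] at this; linarith
  simp only [height]; linarith

/-- Without a lower bound the slope can tend to `-∞`, where the abscissa dominates the height and
the point farther right wins. At `+∞` it is the point farther left. -/
theorem fst_le_of_no_lower (hl : l.1 = l.2) {t p : ℕ}
    (hp : ∀ σ, Above Q l σ → Below Q r σ → height Q σ t ≤ height Q σ p) :
    (Q t).1 ≤ (Q p).1 := by
  have key : ∃ ρ, ∀ σ, σ < ρ → Below Q r σ := by
    by_cases hr : r.1 = r.2
    · exact ⟨0, fun _ _ => .inl hr⟩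
    · exact ⟨slope Q r, fun _ h => .inr h⟩
  obtain ⟨ρ, hρ⟩ := key
  have := @nonpos_of_forall_small ((Q t).2 - (Q p).2) ((Q t).1 - (Q p).1) ρ fun σ h₁ => by
    have := hp σ (.inl hl) (hρ σ h₁)
    simp only [height] at this; linarith
  linarith

theorem fst_le_of_no_upper (hr : r.1 = r.2) {t p : ℕ}
    (hp : ∀ σ, Above Q l σ → Below Q r σ → height Q σ t ≤ height Q σ p) :
    (Q p).1 ≤ (Q t).1 := by
  have key : ∃ ρ, ∀ σ, ρ < σ → Above Q l σ := by
    by_cases hl : l.1 = l.2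
    · exact ⟨0, fun _ _ => .inl hl⟩
    · exact ⟨slope Q l, fun _ h => .inr h⟩
  obtain ⟨ρ, hρ⟩ := key
  have := @nonneg_of_forall_large ((Q t).2 - (Q p).2) ((Q t).1 - (Q p).1) ρ fun σ h₁ => by
    have := hp σ (hρ σ h₁) (.inl hr)
    simp only [height] at this; linarith
  linarith

/-- The scan with `Higher` finds the highest point of a resolved block. -/
theorem Resolved.amax {a k : ℕ} (h : Resolved Q l r a (a + k + 1)) (hpr : Proper Q l r)
    (hs : ∀ i j, a ≤ i → i ≤ j → j ≤ a + k → (Q i).1 ≤ (Q j).1) :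
    ∀ t, a ≤ t → t < a + k + 1 → ∀ σ, Above Q l σ → Below Q r σ →
      height Q σ t ≤ height Q σ (amax (Higher Q l) a k) := by
  obtain ⟨p, hp₁, hp₂, hp⟩ := h
  set u := ReadOnly.amax (Higher Q l) a k with hu
  have hur := le_amax (Higher Q l) a k
  suffices hpu : ∀ σ, Above Q l σ → Below Q r σ → height Q σ p ≤ height Q σ u from
    fun t h₁ h₂ σ h₃ h₄ => (hp t h₁ h₂ σ h₃ h₄).trans (hpu σ h₃ h₄)
  have hup := hp u hur.1 (by omega)
  by_cases hl : l.1 = l.2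
  -- The scan takes the lexicographic maximum, so `u` is not before `p`; with `hx` the abscissas
  -- agree and `u` is at least as high.
  · have hx : (Q u).1 ≤ (Q p).1 := fst_le_of_no_lower hl hup
    have hkey := amax_strict (fun t => toLex ((Q t).1, (Q t).2)) (gt := Higher Q l)
      (fun i b => by simp [Higher, hl, Prod.Lex.toLex_lt_toLex]) a k
    have := hkey.1 p hp₁ (by omega)
    rw [← hu, Prod.Lex.toLex_le_toLex] at this
    simp only at this
    intro σ _ _
    rcases this with h | ⟨h₁, h₂⟩
    · linarith
    · simp only [height, h₁]; linarith
  · have hv := height_le_at_lower hpr hl hup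
    have hkey := amax_strict (height Q (slope Q l)) (gt := Higher Q l)
      (fun i b => by simp [Higher, hl]) a k
    have h₁ := hkey.1 p hp₁ (by omega)
    rw [← hu] at h₁
    -- At the slope `l` itself `u` and `p` tie, and `u` is the first maximum. A point farther left
    -- gains relative to one farther right when the slope grows.
    have h₂ : u ≤ p := by
      by_contra! hc
      have := hkey.2 p hp₁ hc
      rw [← hu] at this
      linarith
    have h₃ := hs u p hur.1 h₂ (by omega)
    intro σ h₄ _
    have h₅ : slope Q l < σ := h₄.resolve_left hl
    simp only [height] at *
    nlinarith

/-- Two points that are both highest for all slopes of an interval coincide. -/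
theorem eq_of_height_eq (hpr : Proper Q l r) {p q : ℕ}
    (h : ∀ σ, Above Q l σ → Below Q r σ → height Q σ p = height Q σ q) : Q p = Q q := by
  obtain ⟨σ, τ, h₁, h₂, h₃, h₄, h₅⟩ := hpr.exists_two
  have e₁ := h σ h₂ h₃
  have e₂ := h τ h₄ h₅
  simp only [height] at e₁ e₂
  -- Equal heights for two different slopes force equal abscissas, and then equal ordinates.
  have : (σ - τ) * ((Q p).1 - (Q q).1) = 0 := by linarith
  have hx : (Q p).1 = (Q q).1 := by
    rcases mul_eq_zero.1 this with h | h <;> linarith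
  refine Prod.ext hx ?_
  rw [hx] at e₁; linarith

theorem Resolved.subset {a c : ℕ} {l' r' : ℕ × ℕ} (h : Resolved Q l r a c)
    (hl : ∀ σ, Above Q l' σ → Above Q l σ) (hr : ∀ σ, Below Q r' σ → Below Q r σ) :
    Resolved Q l' r' a c := by
  obtain ⟨p, h₁, h₂, h₃⟩ := h
  exact ⟨p, h₁, h₂, fun t a b σ c d => h₃ t a b σ (hl σ c) (hr σ d)⟩

end

/-! ### Undecided blocks and how their number changes with the interval of slopes. -/

/-- All blocks of length `H` of the range `lo, …, hi` are resolved. -/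
def Blocks (Q : ℕ → Pt) (lo hi H : ℕ) (l r : ℕ × ℕ) : Prop :=
  ∀ a c, a < c → a ≤ hi → (∃ i, a = lo + i * H ∧ c = min (a + H) (hi + 1)) → Resolved Q l r a c

/-- The highest point of the left half of the block with number `k`. -/
noncomputable def itemFst (Q : ℕ → Pt) (lo H : ℕ) (g : ℕ × ℕ) (k : ℕ) : ℕ :=
  amax (Higher Q g) (lo + 2 * k * H) (H - 1)

/-- The highest point of the right half of the block with number `k`. -/
noncomputable def itemSnd (Q : ℕ → Pt) (lo hi H : ℕ) (g : ℕ × ℕ) (k : ℕ) : ℕ :=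
  amax (Higher Q g) (lo + 2 * k * H + H)
    (min (lo + 2 * k * H + H + H) (hi + 1) - (lo + 2 * k * H + H) - 1)

/-- The two halves of the block with number `k`. -/
noncomputable def item (Q : ℕ → Pt) (lo hi H : ℕ) (g : ℕ × ℕ) (k : ℕ) : ℕ × ℕ :=
  (itemFst Q lo H g k, itemSnd Q lo hi H g k)

/-- The block with number `k` has two halves, whose highest points have different abscissas. -/
def HasSlope (Q : ℕ → Pt) (lo hi H : ℕ) (g : ℕ × ℕ) (k : ℕ) : Prop :=
  lo + 2 * k * H + H ≤ hi ∧ (Q (item Q lo hi H g k).1).1 < (Q (item Q lo hi H g k).2).1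

/-- The block with number `k` is undecided between the slopes `l` and `r`. -/
def Cand (Q : ℕ → Pt) (lo hi H : ℕ) (g l r : ℕ × ℕ) (k : ℕ) : Prop :=
  HasSlope Q lo hi H g k ∧ Above Q l (slope Q (item Q lo hi H g k)) ∧
    Below Q r (slope Q (item Q lo hi H g k))

open Classical in
/-- The number of undecided blocks among those with numbers in `[a, c)`. -/
noncomputable def cnt (Q : ℕ → Pt) (lo hi H : ℕ) (g l r : ℕ × ℕ) (a c : ℕ) : ℕ :=
  ((Finset.Ico a c).filter (Cand Q lo hi H g l r)).card

section

variable {Q : ℕ → Pt} {lo hi H : ℕ} {g l r l' r' : ℕ × ℕ}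

theorem Cand.mono {k : ℕ} (hl : ∀ σ, Above Q l' σ → Above Q l σ)
    (hr : ∀ σ, Below Q r' σ → Below Q r σ) (h : Cand Q lo hi H g l' r' k) :
    Cand Q lo hi H g l r k := ⟨h.1, hl _ h.2.1, hr _ h.2.2⟩

theorem cnt_le_sub (a c : ℕ) : cnt Q lo hi H g l r a c ≤ c - a := by
  classical
  unfold cnt
  exact (Finset.card_filter_le _ _).trans (by simp)

theorem cnt_self (a : ℕ) : cnt Q lo hi H g l r a a = 0 := by simp [cnt]

open Classical in
theorem cnt_succ {a c : ℕ} (h : a ≤ c) : cnt Q lo hi H g l r a (c + 1) =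
    cnt Q lo hi H g l r a c + if Cand Q lo hi H g l r c then 1 else 0 := by
  unfold cnt
  rw [← Finset.insert_Ico_right_eq_Ico_add_one h, Finset.filter_insert]
  split_ifs with h
  · rw [Finset.card_insert_of_notMem (by simp)]
  · simp

theorem cnt_add {a b c : ℕ} (h₁ : a ≤ b) (h₂ : b ≤ c) : cnt Q lo hi H g l r a c =
    cnt Q lo hi H g l r a b + cnt Q lo hi H g l r b c := by
  classical
  unfold cnt
  rw [← Finset.Ico_union_Ico_eq_Ico h₁ h₂, Finset.filter_union, Finset.card_union_of_disjoint]
  exact (Finset.Ico_disjoint_Ico_consecutive a b c).mono (Finset.filter_subset _ _)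
    (Finset.filter_subset _ _)

/-- What a narrower interval loses on a part, it loses on the whole. -/
theorem cnt_narrow {a c a' c' : ℕ} (ha : a ≤ a') (hc : c' ≤ c)
    (hl : ∀ σ, Above Q l' σ → Above Q l σ) (hr : ∀ σ, Below Q r' σ → Below Q r σ) :
    cnt Q lo hi H g l' r' a c + cnt Q lo hi H g l r a' c' ≤
      cnt Q lo hi H g l r a c + cnt Q lo hi H g l' r' a' c' := by
  classical
  unfold cnt
  -- Both sides become sums for two sets. The union is contained in the undecided set of the wider
  -- interval on the whole, the intersection in that of the narrower interval on the part.
  rw [← Finset.card_union_add_card_inter]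
  apply add_le_add <;> apply Finset.card_le_card
  · intro k
    simp only [Finset.mem_union, Finset.mem_filter, Finset.mem_Ico]
    rintro (⟨h, h'⟩ | ⟨h, h'⟩)
    · exact ⟨h, h'.mono hl hr⟩
    · exact ⟨by omega, h'⟩
  · intro k
    simp only [Finset.mem_inter, Finset.mem_filter, Finset.mem_Ico]
    rintro ⟨⟨h, h'⟩, ⟨h'', h'''⟩⟩
    exact ⟨h'', h'⟩

/-- Inclusion and exclusion: slopes in one of the two half-narrowed intervals lie in the wide one,
and slopes in both lie in the interval narrowed at both ends. -/
theorem cnt_inter {a c : ℕ} (hl : ∀ σ, Above Q l' σ → Above Q l σ)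
    (hr : ∀ σ, Below Q r' σ → Below Q r σ) :
    cnt Q lo hi H g l' r a c + cnt Q lo hi H g l r' a c ≤
      cnt Q lo hi H g l r a c + cnt Q lo hi H g l' r' a c := by
  classical
  unfold cnt
  rw [← Finset.card_union_add_card_inter]
  apply add_le_add <;> apply Finset.card_le_card
  · intro k
    simp only [Finset.mem_union, Finset.mem_filter, Finset.mem_Ico]
    rintro (⟨h, h'⟩ | ⟨h, h'⟩)
    · exact ⟨h, h'.mono hl fun _ => id⟩
    · exact ⟨h, h'.mono (fun _ => id) hr⟩
  · intro k
    simp only [Finset.mem_inter, Finset.mem_filter, Finset.mem_Ico]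
    rintro ⟨⟨h, h'⟩, ⟨h'', h'''⟩⟩
    exact ⟨h'', h'.1, h'.2.1, h'''.2.2⟩

/-- If no part contains more than `k` undecided blocks, then `b` parts contain at most `b * k`. -/
theorem cnt_mul_le {a S k : ℕ} (b : ℕ)
    (h : ∀ c < b, cnt Q lo hi H g l r (a + c * S) (a + c * S + S) ≤ k) :
    cnt Q lo hi H g l r a (a + b * S) ≤ b * k := by
  induction b with
  | zero => simp [cnt_self]
  | succ b ih =>
    have e : a + (b + 1) * S = a + b * S + S := by ring
    rw [e, cnt_add (b := a + b * S) (by omega) (by omega)]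
    have h₁ := ih fun c hc => h c (by omega)
    have h₂ := h b (by omega)
    have : (b + 1) * k = b * k + k := by ring
    omega

/-- Where the halves of a block are resolved, the two highest points do not depend on the part of
the interval of slopes that is used. -/
theorem cand_iff_of_resolved {k : ℕ} (hH : 1 ≤ H)
    (hs : ∀ i j, lo ≤ i → i ≤ j → j ≤ hi → (Q i).1 ≤ (Q j).1)
    (hres : Blocks Q lo hi H g r)
    (hp : Proper Q g r) (hp' : Proper Q l' r')
    (hl : ∀ σ, Above Q l' σ → Above Q g σ) (hr : ∀ σ, Below Q r' σ → Below Q r σ)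
    (l₁ r₁ : ℕ × ℕ) :
    Cand Q lo hi H l' l₁ r₁ k ↔ Cand Q lo hi H g l₁ r₁ k := by
  by_cases hv : lo + 2 * k * H + H ≤ hi
  swap
  · simp [Cand, HasSlope, hv]
  have key : ∀ a c : ℕ, a ≤ hi → (∃ i, a = lo + i * H) → a + c + 1 = min (a + H) (hi + 1) →
      Q (amax (Higher Q l') a c) = Q (amax (Higher Q g) a c) := by
    rintro a c h₀ ⟨i, hi'⟩ hc
    have ha : lo ≤ a := by rw [hi']; exact Nat.le_add_right _ _
    have h₁ := hres a (a + c + 1) (by omega) h₀ ⟨i, hi', hc⟩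
    have h₂ := h₁.subset hl hr
    have hs' : ∀ i j, a ≤ i → i ≤ j → j ≤ a + c → (Q i).1 ≤ (Q j).1 :=
      fun i j h h' h'' => hs i j (by omega) h' (by omega)
    have b₁ := le_amax (Higher Q l') a c
    have b₂ := le_amax (Higher Q g) a c
    -- Scans at different lower bounds may return different indices, but both points are highest on
    -- the smaller interval, and so they coincide as points.
    apply eq_of_height_eq hp'
    intro σ h₃ h₄
    exact le_antisymm (h₁.amax hp hs' _ b₁.1 (by omega) σ (hl σ h₃) (hr σ h₄))
      (h₂.amax hp' hs' _ b₂.1 (by omega) σ h₃ h₄)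
  have e₁ : Q (itemFst Q lo H l' k) = Q (itemFst Q lo H g k) :=
    key _ _ (by omega) ⟨2 * k, by ring⟩ (by omega)
  have e₂ : Q (itemSnd Q lo hi H l' k) = Q (itemSnd Q lo hi H g k) :=
    key _ _ (by omega) ⟨2 * k + 1, by ring⟩ (by omega)
  have e₃ : slope Q (item Q lo hi H l' k) = slope Q (item Q lo hi H g k) := by
    simp only [slope, item, e₁, e₂]
  simp only [Cand, HasSlope, e₃]
  simp only [item, e₁, e₂]

end

end ReadOnly

/-! ### Bounds for the slope of the bridge, and merging of blocks. -/

namespace ReadOnly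

/-- The bridge over the gap before `mid` is steeper than `l`. -/
def SteeperThan (Q : ℕ → Pt) (lo mid hi : ℕ) (l : ℕ × ℕ) : Prop :=
  l.1 ≠ l.2 → ∃ q, mid ≤ q ∧ q ≤ hi ∧ ∀ p, lo ≤ p → p < mid →
    height Q (slope Q l) p < height Q (slope Q l) q

/-- The bridge over the gap before `mid` is less steep than `r`. -/
def FlatterThan (Q : ℕ → Pt) (lo mid hi : ℕ) (r : ℕ × ℕ) : Prop :=
  r.1 ≠ r.2 → ∃ p, lo ≤ p ∧ p < mid ∧ ∀ q, mid ≤ q → q ≤ hi →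
    height Q (slope Q r) q < height Q (slope Q r) p

section

variable {Q : ℕ → Pt} {lo hi H : ℕ} {g l r : ℕ × ℕ}

theorem Blocks.subset {l' r' : ℕ × ℕ} (h : Blocks Q lo hi H l r)
    (hl : ∀ σ, Above Q l' σ → Above Q l σ) (hr : ∀ σ, Below Q r' σ → Below Q r σ) :
    Blocks Q lo hi H l' r' := fun a c h₁ h₂ h₃ => (h a c h₁ h₂ h₃).subset hl hr

theorem blocks_one : Blocks Q lo hi 1 l r := by
  rintro a c h₁ h₂ ⟨i, h₃, h₄⟩
  refine ⟨a, le_rfl, h₁, fun t h₅ h₆ σ _ _ => ?_⟩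
  obtain rfl : t = a := by omega
  exact le_rfl

theorem height_le_iff_slope {u v : ℕ} (h : (Q u).1 < (Q v).1) (σ : ℝ) :
    height Q σ u ≤ height Q σ v ↔ σ ≤ slope Q (u, v) := by
  rw [slope, le_div_iff₀ (by simpa using h)]
  simp only [height]
  constructor <;> intro <;> linarith

theorem height_ge_iff_slope {u v : ℕ} (h : (Q u).1 < (Q v).1) (σ : ℝ) :
    height Q σ v ≤ height Q σ u ↔ slope Q (u, v) ≤ σ := by
  rw [slope, div_le_iff₀ (by simpa using h)]
  simp only [height]
  constructor <;> intro <;> linarith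

/-- If the halves of all blocks are resolved and no block is undecided, all blocks are resolved. -/
theorem Blocks.double (hH : 1 ≤ H) (h : Blocks Q lo hi H g r) (hp : Proper Q g r)
    (hs : ∀ i j, lo ≤ i → i ≤ j → j ≤ hi → (Q i).1 ≤ (Q j).1)
    (hc : ∀ k, lo + 2 * k * H + H ≤ hi → ¬ Cand Q lo hi H g g r k) :
    Blocks Q lo hi (2 * H) g r := by
  rintro a c h₁ h₂ ⟨i, h₃, h₄⟩
  have ha : a = lo + 2 * i * H := by rw [h₃]; ring
  have hla : lo ≤ a := by omega
  by_cases hv : a + H ≤ hi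
  swap
  · exact h a c h₁ h₂ ⟨2 * i, ha, by omega⟩
  have r₁ := h a (a + (H - 1) + 1) (by omega) h₂ ⟨2 * i, ha, by omega⟩
  have r₂ := h (a + H) (a + H + (min (a + H + H) (hi + 1) - (a + H) - 1) + 1) (by omega) hv
    ⟨2 * i + 1, by rw [ha]; ring, by omega⟩
  have b₁ := le_amax (Higher Q g) a (H - 1)
  have b₂ := le_amax (Higher Q g) (a + H) (min (a + H + H) (hi + 1) - (a + H) - 1)
  have m₁ := r₁.amax hp fun i j h h' h'' => hs i j (by omega) h' (by omega)
  have m₂ := r₂.amax hp fun i j h h' h'' => hs i j (by omega) h' (by omega)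
  have e₁ : amax (Higher Q g) a (H - 1) = itemFst Q lo H g i := by rw [itemFst, ha]
  have e₂ : amax (Higher Q g) (a + H) (min (a + H + H) (hi + 1) - (a + H) - 1) =
      itemSnd Q lo hi H g i := by rw [itemSnd, ha]
  rw [e₁] at b₁ m₁
  rw [e₂] at b₂ m₂
  set u := itemFst Q lo H g i with hu
  set v := itemSnd Q lo hi H g i with hv'
  have hx : (Q u).1 ≤ (Q v).1 := hs _ _ (by omega) (by omega) (by omega)
  -- The comparison of `u` with `v` changes only at the slope of the line through them. If that
  -- slope is outside the open interval, one of the two wins throughout.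
  have fin : (∀ σ, Above Q g σ → Below Q r σ → height Q σ u ≤ height Q σ v) ∨
      (∀ σ, Above Q g σ → Below Q r σ → height Q σ v ≤ height Q σ u) := by
    rcases eq_or_lt_of_le hx with hx | hx
    · rcases le_total (Q u).2 (Q v).2 with hy | hy
      · left; intro σ _ _; simp only [height, hx]; linarith
      · right; intro σ _ _; simp only [height, hx]; linarith
    · have := hc i (by omega)
      have hi' : item Q lo hi H g i = (u, v) := rfl
      rw [Cand, HasSlope, hi', not_and_or, not_and_or, not_and_or] at this
      rcases this with (h | h) | h | h
      · omega
      · exact absurd hx h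
      · right
        intro σ h₁ _
        rw [Above, not_or, not_lt] at h
        rw [height_ge_iff_slope hx]
        exact h.2.trans (h₁.resolve_left h.1).le
      · left
        intro σ _ h₁
        rw [Below, not_or, not_lt] at h
        rw [height_le_iff_slope hx]
        exact (h₁.resolve_left h.1).le.trans h.2
  rcases fin with fin | fin
  · refine ⟨v, by omega, by omega, fun t ht₁ ht₂ σ h₁ h₂ => ?_⟩
    by_cases ht : t < a + H
    · exact (m₁ t ht₁ (by omega) σ h₁ h₂).trans (fin σ h₁ h₂)
    · exact m₂ t (by omega) (by omega) σ h₁ h₂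
  · refine ⟨u, by omega, by omega, fun t ht₁ ht₂ σ h₁ h₂ => ?_⟩
    by_cases ht : t < a + H
    · exact m₁ t ht₁ (by omega) σ h₁ h₂
    · exact (m₂ t (by omega) (by omega) σ h₁ h₂).trans (fin σ h₁ h₂)

/-- As long as the bridge is not found, the whole range is undecided. -/
theorem Blocks.cand_zero (h : Blocks Q lo hi H g r) (hp : Proper Q g r)
    (hs : ∀ i j, lo ≤ i → i ≤ j → j ≤ hi → (Q i).1 ≤ (Q j).1)
    (hH : 1 ≤ H) (h₁ : lo + H ≤ hi) (h₂ : hi < lo + 2 * H)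
    (hlo : ∀ t, lo ≤ t → t ≤ hi → (Q t).1 = (Q lo).1 → (Q t).2 ≤ (Q lo).2)
    (hhi : ∀ t, lo ≤ t → t ≤ hi → (Q t).1 = (Q hi).1 → (Q t).2 ≤ (Q hi).2)
    (hx : (Q lo).1 < (Q hi).1)
    (hst : SteeperThan Q lo (lo + H) hi g) (hfl : FlatterThan Q lo (lo + H) hi r) :
    Cand Q lo hi H g g r 0 := by
  have r₁ := h lo (lo + (H - 1) + 1) (by omega) (by omega) ⟨0, by omega, by omega⟩
  have r₂ := h (lo + H) (lo + H + (min (lo + H + H) (hi + 1) - (lo + H) - 1) + 1) (by omega) h₁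
    ⟨1, by omega, by omega⟩
  have b₁ := le_amax (Higher Q g) lo (H - 1)
  have b₂ := le_amax (Higher Q g) (lo + H) (min (lo + H + H) (hi + 1) - (lo + H) - 1)
  have m₁ := r₁.amax hp fun i j h h' h'' => hs i j (by omega) h' (by omega)
  have m₂ := r₂.amax hp fun i j h h' h'' => hs i j (by omega) h' (by omega)
  have e₁ : amax (Higher Q g) lo (H - 1) = itemFst Q lo H g 0 := by simp [itemFst]
  have e₂ : amax (Higher Q g) (lo + H) (min (lo + H + H) (hi + 1) - (lo + H) - 1) =
      itemSnd Q lo hi H g 0 := by simp [itemSnd]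
  rw [e₁] at b₁ m₁
  rw [e₂] at b₂ m₂
  have hitem : item Q lo hi H g 0 = (itemFst Q lo H g 0, itemSnd Q lo hi H g 0) := rfl
  rw [Cand, HasSlope, hitem]
  set u := itemFst Q lo H g 0 with hu
  set v := itemSnd Q lo hi H g 0 with hv'
  have hxuv : (Q u).1 ≤ (Q v).1 := hs _ _ (by omega) (by omega) (by omega)
  -- `SteeperThan` supplies some point of the right half that beats the whole left half at the slope
  -- `g`; by passage to the limit `v` is at least as high there.
  have hl : g.1 ≠ g.2 → height Q (slope Q g) u < height Q (slope Q g) v := by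
    intro hg
    obtain ⟨q, q₁, q₂, hq⟩ := hst hg
    exact (hq u b₁.1 (by omega)).trans_le
      (height_le_at_lower hp hg fun σ h h' => m₂ q q₁ (by omega) σ h h')
  have hr : r.1 ≠ r.2 → height Q (slope Q r) v < height Q (slope Q r) u := by
    intro hr
    obtain ⟨q, q₁, q₂, hq⟩ := hfl hr
    exact (hq v b₂.1 (by omega)).trans_le
      (height_le_at_upper hp hr fun σ h h' => m₁ q q₁ (by omega) σ h h')
  have hlu : r.1 = r.2 → (Q u).1 ≤ (Q lo).1 := fun hr =>
    fst_le_of_no_upper hr fun σ h h' => m₁ lo le_rfl (by omega) σ h h'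
  have hhv : g.1 = g.2 → (Q hi).1 ≤ (Q v).1 := fun hg =>
    fst_le_of_no_lower hg fun σ h h' => m₂ hi h₁ (by omega) σ h h'
  -- If `u` and `v` had the same abscissa, their comparison would not depend on the slope, against
  -- `hl` and `hr`. When one bound is infinite, the missing inequality comes from `lo` or `hi` being
  -- the top of its column; when both are, from `hx`.
  have hlt : (Q u).1 < (Q v).1 := by
    refine lt_of_le_of_ne hxuv fun hne => ?_
    by_cases hg : g.1 = g.2
    · have e : (Q v).1 = (Q hi).1 := le_antisymm (hs _ _ (by omega) (by omega) le_rfl) (hhv hg)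
      by_cases hr' : r.1 = r.2
      · have := hlu hr'
        linarith
      · have h₃ := hr hr'
        have h₄ := hhi u (by omega) (by omega) (by linarith)
        obtain ⟨σ, τ, -, s₁, s₂, -, -⟩ := hp.exists_two
        have h₅ := m₂ hi h₁ (by omega) σ s₁ s₂
        simp only [height] at h₃ h₅
        rw [hne] at h₃
        rw [← e] at h₅
        linarith
    · by_cases hr' : r.1 = r.2
      · have e : (Q u).1 = (Q lo).1 :=
          le_antisymm (hlu hr') (hs _ _ le_rfl (by omega) (by omega))
        have h₃ := hl hg
        have h₄ := hlo v (by omega) (by omega) (by linarith)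
        obtain ⟨σ, τ, -, s₁, s₂, -, -⟩ := hp.exists_two
        have h₅ := m₁ lo le_rfl (by omega) σ s₁ s₂
        simp only [height] at h₃ h₅
        rw [hne] at h₃
        rw [← e] at h₅
        linarith
      · have h₃ := hl hg
        have h₄ := hr hr'
        simp only [height] at h₃ h₄
        rw [hne] at h₃ h₄
        linarith
  refine ⟨⟨by omega, hlt⟩, ?_, ?_⟩
  · by_cases hg : g.1 = g.2
    · exact .inl hg
    · exact .inr (by
        have := hl hg
        by_contra! hc
        have := (height_ge_iff_slope hlt _).2 hc
        linarith)
  · by_cases hr' : r.1 = r.2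
    · exact .inl hr'
    · exact .inr (by
        have := hr hr'
        by_contra! hc
        have := (height_le_iff_slope hlt _).2 hc
        linarith)

end

end ReadOnly

/-! ### Programs that scan blocks and count the undecided ones. -/

namespace ReadOnly

/-- The content of the work cell with a fixed address. -/
abbrev var (r : ℕ) : IExp := .load (.const r)

/-- Assignment to the work cell with a fixed address. -/
abbrev set (r : ℕ) (e : IExp) : Program := .store (.const r) e

/-- Disjunction of tests. -/
abbrev BExp.or (b c : BExp) : BExp := .not (.and (.not b) (.not c))

infixr:60 ";;" => Program.seq
infixl:65 "∔" => IExp.add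
infixl:70 "⨰" => IExp.mul

theorem Does.put {n : ℕ} {P : Fin n → Pt} {s w : ℕ} {a e : IExp} {m : Mem} {Q : Mem → Prop}
    {i v : ℕ} (ha : a.eval n m = i) (he : e.eval n m = v) (hi : i < s) (hv : v < 2 ^ w)
    (h : Q (Function.update m i v)) : Does P s w (.store a e) m 1 Q :=
  Does.store (by omega) (by omega) (by rwa [ha, he])

theorem Does.put_seq {n : ℕ} {P : Fin n → Pt} {s w : ℕ} {a e : IExp} {q : Program} {m : Mem}
    {k : ℕ} {Q : Mem → Prop} {i v : ℕ} (ha : a.eval n m = i) (he : e.eval n m = v) (hi : i < s)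
    (hv : v < 2 ^ w) (h : Does P s w q (Function.update m i v) k Q) :
    Does P s w (.store a e ;; q) m (1 + k) Q :=
  Does.seq (Does.put ha he hi hv h)

/-- A way to read a sequence of points from the input array. -/
structure Access where
  /-- The abscissa of the point with a given number. -/
  x : IExp → RExp
  /-- The ordinate of the point with a given number. -/
  y : IExp → RExp
  /-- The position in the input array of the point with a given number. -/
  idx : IExp → IExp

variable {n : ℕ} {P : Fin n → Pt} {s w : ℕ} {A : Access} {Q : ℕ → Pt}

/-- The points that are read are those of the sequence `Q`. -/
structure Access.Reads (A : Access) (P : Fin n → Pt) (Q : ℕ → Pt) : Prop where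
  x : ∀ e m, (A.x e).eval P m = (Q (e.eval n m)).1
  y : ∀ e m, (A.y e).eval P m = (Q (e.eval n m)).2

/-- The slope of the line through two points. -/
def slopeE (A : Access) (a b : IExp) : RExp :=
  .div (.sub (A.y b) (A.y a)) (.sub (A.x b) (A.x a))

/-- The intercept of the line through the point `t` parallel to the line through two points. -/
def heightE (A : Access) (a b t : IExp) : RExp :=
  .sub (A.y t) (.mul (slopeE A a b) (A.x t))

/-- The test `Higher`. -/
def higherE (A : Access) (a b i t : IExp) : BExp :=
  .or (.and (.ieq a b) (.or (.rlt (A.x t) (A.x i))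
      (.and (.req (A.x t) (A.x i)) (.rlt (A.y t) (A.y i)))))
    (.and (.not (.ieq a b)) (.rlt (heightE A a b t) (heightE A a b i)))

theorem slopeE_eval (hA : A.Reads P Q) (a b : IExp) (m : Mem) :
    (slopeE A a b).eval P m = slope Q (a.eval n m, b.eval n m) := by
  simp [slopeE, slope, RExp.eval, hA.x, hA.y]

theorem heightE_eval (hA : A.Reads P Q) (a b t : IExp) (m : Mem) :
    (heightE A a b t).eval P m = height Q (slope Q (a.eval n m, b.eval n m)) (t.eval n m) := by
  simp [heightE, height, RExp.eval, hA.x, hA.y, slopeE_eval hA]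

theorem BExp.or_eval (b c : BExp) (m : Mem) :
    (BExp.or b c).eval P m ↔ b.eval P m ∨ c.eval P m := by
  simp only [BExp.eval]; tauto

theorem higherE_eval (hA : A.Reads P Q) (a b i t : IExp) (m : Mem) :
    (higherE A a b i t).eval P m ↔
      Higher Q (a.eval n m, b.eval n m) (i.eval n m) (t.eval n m) := by
  rw [higherE, BExp.or_eval]
  simp only [BExp.eval, Higher, hA.x, hA.y, heightE_eval hA]
  tauto

/-- Scans from the number in cell `0` to the one before the number in cell `2`, and leaves the best
one in cell `1`. -/
def scan (bt : BExp) : Program :=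
  set 1 (var 0) ;; set 0 (var 0 ∔ .const 1) ;;
    .loop (.ilt (var 0) (var 2)) (.cond bt (set 1 (var 0)) .skip ;; set 0 (var 0 ∔ .const 1))

theorem does_scan {bt : BExp} {gt : ℕ → ℕ → Prop} {m : Mem} (hs : 40 ≤ s)
    (hbt : ∀ m', (∀ a, 2 ≤ a → m' a = m a) → (bt.eval P m' ↔ gt (m' 0) (m' 1)))
    (h₀ : m 0 + 1 < 2 ^ w) (h₂ : m 2 < 2 ^ w) :
    Does P s w (scan bt) m (4 * (m 2 - m 0) + 3) fun m' =>
      m' 1 = amax gt (m 0) (m 2 - m 0 - 1) ∧ ∀ a, 2 ≤ a → m' a = m a := by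
  have key : Does P s w (scan bt) m (1 + (1 + ((m 2 - m 0 - 1) * (3 + 1) + 1))) fun m' =>
      m' 1 = amax gt (m 0) (m 2 - m 0 - 1) ∧ ∀ a, 2 ≤ a → m' a = m a := by
    refine Does.store_seq (by simp [IExp.eval]; omega) (by simp [IExp.eval]; omega) ?_
    refine Does.store_seq (by simp [IExp.eval]; omega) (by simp [IExp.eval]; omega) ?_
    refine (Does.loop (k := 3) (fun r m' => ∃ i, i + r = m 2 - m 0 - 1 ∧ m' 0 = m 0 + 1 + i ∧
      m' 1 = amax gt (m 0) i ∧ ∀ a, 2 ≤ a → m' a = m a) ?_ ?_ _ _ ?_).mono le_rfl ?_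
    · rintro r m' ⟨i, h₁, h₃, h₄, h₅⟩
      have e₂ := h₅ 2 le_rfl
      refine ⟨by simp [BExp.eval, IExp.eval]; omega, ?_⟩
      refine (Does.seq (k₁ := 2) (k₂ := 1) (Does.cond (k := 1) (fun hb => ?_) fun hb => ?_))
      · refine Does.store (by simp [IExp.eval]; omega) (by simp [IExp.eval]; omega) ?_
        refine Does.store (by simp [IExp.eval]; omega) (by simp [IExp.eval]; omega) ?_
        refine ⟨i + 1, by omega, by simp [IExp.eval]; omega, ?_, fun a ha => ?_⟩
        · rw [hbt m' h₅, h₃, h₄] at hb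
          have : m 0 + i + 1 = m 0 + 1 + i := by omega
          simp [IExp.eval, amax, this, hb, h₃]
        · rw [← h₅ a ha]
          repeat rw [Function.update_of_ne (by simp only [IExp.eval]; omega)]
      · refine Does.skip (Does.store (by simp [IExp.eval]; omega) (by simp [IExp.eval]; omega) ?_)
        refine ⟨i + 1, by omega, by simp [IExp.eval]; omega, ?_, fun a ha => ?_⟩
        · rw [hbt m' h₅, h₃, h₄] at hb
          have : m 0 + i + 1 = m 0 + 1 + i := by omega
          simp [IExp.eval, amax, this, hb, h₄]
        · rw [← h₅ a ha]
          repeat rw [Function.update_of_ne (by simp only [IExp.eval]; omega)]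
    · rintro m' ⟨i, h₁, h₃, h₄, h₅⟩
      have e₂ := h₅ 2 le_rfl
      simp [BExp.eval, IExp.eval]; omega
    · refine ⟨0, by omega, by simp [IExp.eval], by simp [IExp.eval, amax], fun a ha => ?_⟩
      repeat rw [Function.update_of_ne (by simp only [IExp.eval]; omega)]
    · rintro m' ⟨i, h₁, h₃, h₄, h₅⟩
      obtain rfl : i = m 2 - m 0 - 1 := by omega
      exact ⟨h₄, h₅⟩
  exact key.mono (by omega) fun _ => id

/-- The parameters of the current range: it consists of the points with numbers `lo, …, hi`, the
halves of blocks have length `H`, and the slopes that are still possible are greater than `g`. -/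
structure Env (m : Mem) (lo hi H fb : ℕ) (g : ℕ × ℕ) : Prop where
  lo_eq : m 22 = lo
  hi_eq : m 23 = hi
  H_eq : m 24 = H
  fb_eq : m 29 = fb
  fb_le : 40 ≤ fb
  fst : m (fb + 1) = g.1
  snd : m (fb + 2) = g.2

theorem Env.congr {m m' : Mem} {lo hi H fb : ℕ} {g : ℕ × ℕ} (h : Env m lo hi H fb g)
    (h' : ∀ a, 22 ≤ a → m' a = m a) : Env m' lo hi H fb g := by
  have := h.fb_le
  exact ⟨(h' _ (by omega)).trans h.lo_eq, (h' _ (by omega)).trans h.hi_eq, (h' _ (by omega)).trans h.H_eq,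
    (h' _ (by omega)).trans h.fb_eq, h.fb_le, (h' _ (by omega)).trans h.fst,
    (h' _ (by omega)).trans h.snd⟩

/-- The test by which the highest points of blocks are found. -/
def blockTest (A : Access) : BExp :=
  higherE A (.load (var 29 ∔ .const 1)) (.load (var 29 ∔ .const 2)) (var 0) (var 1)

theorem blockTest_eval (hA : A.Reads P Q) {m : Mem} {lo hi H fb : ℕ} {g : ℕ × ℕ}
    (h : Env m lo hi H fb g) : (blockTest A).eval P m ↔ Higher Q g (m 0) (m 1) := by
  rw [blockTest, higherE_eval hA]
  simp [IExp.eval, h.fb_eq, h.fst, h.snd]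

/-- Finds the highest points of the two halves of the block whose number is in cell `5`. -/
def itemProg (A : Access) : Program :=
  set 0 (var 22 ∔ .const 2 ⨰ var 5 ⨰ var 24) ;; set 2 (var 0 ∔ var 24) ;;
  scan (blockTest A) ;; set 3 (var 1) ;;
  set 0 (var 22 ∔ .const 2 ⨰ var 5 ⨰ var 24 ∔ var 24) ;;
  .cond (.ilt (var 23 ∔ .const 1) (var 0 ∔ var 24)) (set 2 (var 23 ∔ .const 1))
    (set 2 (var 0 ∔ var 24)) ;;
  scan (blockTest A) ;; set 4 (var 1)

theorem does_itemProg (hA : A.Reads P Q) (hs : 40 ≤ s) {m : Mem} {lo hi H fb : ℕ} {g : ℕ × ℕ}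
    (h : Env m lo hi H fb g) (hH : 1 ≤ H) (hw : lo + 2 * m 5 * H + 2 * H + 1 < 2 ^ w)
    (hw' : hi + 1 < 2 ^ w) :
    Does P s w (itemProg A) m (8 * H + 20) fun m' =>
      (m' 3, m' 4) = item Q lo hi H g (m 5) ∧ ∀ a, 5 ≤ a → m' a = m a := by
  have key : Does P s w (itemProg A) m
      (1 + (1 + ((4 * H + 3) + (1 + (1 + ((1 + 1) + ((4 * H + 3) + 1))))))) fun m' =>
      (m' 3, m' 4) = item Q lo hi H g (m 5) ∧ ∀ a, 5 ≤ a → m' a = m a := by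
    refine Does.store_seq (by simp [IExp.eval]; omega)
      (by simp [IExp.eval, h.lo_eq, h.H_eq]; omega) ?_
    refine Does.store_seq (by simp [IExp.eval]; omega)
      (by simp [IExp.eval, h.lo_eq, h.H_eq]; omega) ?_
    simp only [IExp.eval, Function.update_self, h.lo_eq, h.H_eq, ne_eq, OfNat.ofNat_ne_zero,
      not_false_eq_true, Function.update_of_ne]
    set m₁ := Function.update (Function.update m 0 (lo + 2 * m 5 * H)) 2 (lo + 2 * m 5 * H + H)
      with hm₁
    have e₀ : m₁ 0 = lo + 2 * m 5 * H := by simp [hm₁]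
    have e₂ : m₁ 2 = lo + 2 * m 5 * H + H := by simp [hm₁]
    have f₁ : ∀ a, 3 ≤ a → m₁ a = m a := fun a ha => by
      rw [hm₁]; repeat rw [Function.update_of_ne (by omega)]
    refine Does.seq ((does_scan (gt := Higher Q g) hs (fun m' hm' => blockTest_eval hA
      (h.congr fun a ha => (hm' a (by omega)).trans (f₁ a (by omega)))) (by omega)
      (by omega)).mono (by omega) ?_)
    rintro m₂ ⟨r₂, f₂⟩
    have f₂' : ∀ a, 3 ≤ a → m₂ a = m a := fun a ha => (f₂ a (by omega)).trans (f₁ a ha)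
    have r₂' : m₂ 1 = itemFst Q lo H g (m 5) := by
      rw [r₂, e₀, e₂, itemFst]; congr 1; omega
    have b₂ := le_amax (Higher Q g) (lo + 2 * m 5 * H) (H - 1)
    rw [← itemFst] at b₂
    refine Does.store_seq (by simp [IExp.eval]; omega) (by simp [IExp.eval, r₂']; omega) ?_
    have q₅ := f₂' 5 (by omega)
    have q₁₇ := (f₂' 22 (by omega)).trans h.lo_eq
    have q₁₈ := (f₂' 23 (by omega)).trans h.hi_eq
    have q₁₉ := (f₂' 24 (by omega)).trans h.H_eq
    refine Does.store_seq (by simp [IExp.eval]; omega)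
      (by simp [IExp.eval, q₅, q₁₇, q₁₉]; omega) ?_
    simp only [IExp.eval, q₁₇, q₁₉, q₅, r₂', ne_eq,
      not_false_eq_true, Function.update_of_ne, Nat.reduceEqDiff]
    set m₃ := Function.update (Function.update m₂ 3 (itemFst Q lo H g (m 5))) 0
      (lo + 2 * m 5 * H + H) with hm₃
    have e₃ : m₃ 0 = lo + 2 * m 5 * H + H := by simp [hm₃]
    have e₃' : m₃ 3 = itemFst Q lo H g (m 5) := by simp [hm₃]
    have f₃ : ∀ a, 4 ≤ a → m₃ a = m a := fun a ha => by
      rw [hm₃, ← f₂' a (by omega)]; repeat rw [Function.update_of_ne (by omega)]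
    have p₁₈ := (f₃ 23 (by omega)).trans h.hi_eq
    have p₁₉ := (f₃ 24 (by omega)).trans h.H_eq
    -- The last half-block may be cut off by the end of the range. Both branches put the minimum of
    -- the two candidates for its end into cell `2`.
    suffices hfin : Does P s w (scan (blockTest A) ;; set 4 (var 1))
        (Function.update m₃ 2 (min (lo + 2 * m 5 * H + H + H) (hi + 1))) ((4 * H + 3) + 1) fun m' =>
        (m' 3, m' 4) = item Q lo hi H g (m 5) ∧ ∀ a, 5 ≤ a → m' a = m a by
      refine Does.seq (Does.cond (fun hb => ?_) fun hb => ?_)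
      · refine Does.store (by simp [IExp.eval]; omega) (by simp [IExp.eval, p₁₈]; omega) ?_
        simp only [BExp.eval, IExp.eval, p₁₈, p₁₉, e₃] at hb ⊢
        rw [min_eq_right (by omega)] at hfin
        exact hfin
      · refine Does.store (by simp [IExp.eval]; omega)
          (by simp [IExp.eval, p₁₉, e₃]; omega) ?_
        simp only [BExp.eval, IExp.eval, p₁₈, p₁₉, e₃] at hb ⊢
        rw [min_eq_left (by omega)] at hfin
        exact hfin
    set m₄ := Function.update m₃ 2 (min (lo + 2 * m 5 * H + H + H) (hi + 1)) with hm₄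
    have e₄ : m₄ 0 = lo + 2 * m 5 * H + H := by simp [hm₄, e₃]
    have e₄' : m₄ 2 = min (lo + 2 * m 5 * H + H + H) (hi + 1) := by simp [hm₄]
    have e₄'' : m₄ 3 = itemFst Q lo H g (m 5) := by simp [hm₄, e₃']
    have f₄ : ∀ a, 4 ≤ a → m₄ a = m a := fun a ha => by
      rw [hm₄, ← f₃ a (by omega)]; repeat rw [Function.update_of_ne (by omega)]
    refine Does.seq ((does_scan (gt := Higher Q g) hs (fun m' hm' => blockTest_eval hA
      (h.congr fun a ha => (hm' a (by omega)).trans (f₄ a (by omega)))) (by omega)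
      (by omega)).mono (by omega) ?_)
    rintro m₅ ⟨r₅, f₅⟩
    rw [e₄, e₄', ← itemSnd] at r₅
    have b₅ := le_amax (Higher Q g) (lo + 2 * m 5 * H + H)
      (min (lo + 2 * m 5 * H + H + H) (hi + 1) - (lo + 2 * m 5 * H + H) - 1)
    rw [← itemSnd] at b₅
    refine Does.store (by simp [IExp.eval]; omega) (by simp [IExp.eval, r₅]; omega) ⟨?_, ?_⟩
    · simp [IExp.eval, item, r₅, f₅, e₄'']
    · intro a ha
      rw [Function.update_of_ne (by simp only [IExp.eval]; omega), f₅ a (by omega),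
        f₄ a (by omega)]
  exact key.mono (by omega) fun _ => id

/-- The test whether the block whose number is in cell `5` is undecided between the slopes in the
cells `8, …, 11`. -/
def candTest (A : Access) : BExp :=
  .and (.and (.not (.ilt (var 23) (var 22 ∔ .const 2 ⨰ var 5 ⨰ var 24 ∔ var 24)))
      (.rlt (A.x (var 3)) (A.x (var 4))))
    (.and (.or (.ieq (var 8) (var 9)) (.rlt (slopeE A (var 8) (var 9)) (slopeE A (var 3) (var 4))))
      (.or (.ieq (var 10) (var 11))
        (.rlt (slopeE A (var 3) (var 4)) (slopeE A (var 10) (var 11)))))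

theorem candTest_eval (hA : A.Reads P Q) {m : Mem} {lo hi H fb : ℕ} {g : ℕ × ℕ}
    (h : Env m lo hi H fb g) (hi' : (m 3, m 4) = item Q lo hi H g (m 5)) :
    (candTest A).eval P m ↔ Cand Q lo hi H g (m 8, m 9) (m 10, m 11) (m 5) := by
  rw [Cand, HasSlope, ← hi', candTest]
  simp only [BExp.eval, IExp.eval, hA.x, slopeE_eval hA, h.lo_eq, h.hi_eq, h.H_eq, Above, Below]
  rw [not_lt]
  tauto

/-- Counts the undecided blocks with numbers from `st` to `en - 1`, with respect to the slopes
given by the last four expressions. The result is left in cell `7`. -/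
def countProg (A : Access) (st en la lb ra rb : IExp) : Program :=
  set 5 st ;; set 6 en ;; set 7 (.const 0) ;; set 8 la ;; set 9 lb ;; set 10 ra ;; set 11 rb ;;
  .loop (.ilt (var 5) (var 6))
    (itemProg A ;; .cond (candTest A) (set 7 (var 7 ∔ .const 1)) .skip ;;
      set 5 (var 5 ∔ .const 1))

/-- The expression `e` has the value `v`, whatever the contents of the cells below `k`. -/
def Val (n : ℕ) (m : Mem) (k : ℕ) (e : IExp) (v : ℕ) : Prop :=
  ∀ m' : Mem, (∀ a, k ≤ a → m' a = m a) → e.eval n m' = v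

theorem does_countProg (hA : A.Reads P Q) (hs : 40 ≤ s) {m : Mem} {lo hi H fb : ℕ} {g : ℕ × ℕ}
    (h : Env m lo hi H fb g) (hH : 1 ≤ H) {st en la lb ra rb : IExp} {a c : ℕ} {l r : ℕ × ℕ}
    (hst : Val n m 12 st a) (hen : Val n m 12 en c) (hla : Val n m 12 la l.1)
    (hlb : Val n m 12 lb l.2) (hra : Val n m 12 ra r.1) (hrb : Val n m 12 rb r.2) (hac : a ≤ c)
    (hl₁ : l.1 < 2 ^ w) (hl₂ : l.2 < 2 ^ w) (hr₁ : r.1 < 2 ^ w) (hr₂ : r.2 < 2 ^ w)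
    (hw : lo + 2 * (c + 1) * H + c + 1 < 2 ^ w) (hw' : hi + 1 < 2 ^ w) :
    Does P s w (countProg A st en la lb ra rb) m ((c - a) * (8 * H + 24) + 8) fun m' =>
      m' 7 = cnt Q lo hi H g l r a c ∧ ∀ a, 12 ≤ a → m' a = m a := by
  have key : Does P s w (countProg A st en la lb ra rb) m
      (1 + (1 + (1 + (1 + (1 + (1 + (1 + ((c - a) * ((8 * H + 20) + ((1 + 1) + 1) + 1) + 1))))))))
      fun m' => m' 7 = cnt Q lo hi H g l r a c ∧ ∀ a, 12 ≤ a → m' a = m a := by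
    have hstore : ∀ {i : ℕ} {e : IExp} {v : ℕ} {q : Program} {m₁ : Mem} {k : ℕ} {Q : Mem → Prop},
        i < 12 → Val n m 12 e v → v < 2 ^ w → (∀ a, 12 ≤ a → m₁ a = m a) →
        ((∀ a, 12 ≤ a → Function.update m₁ i v a = m a) →
          Does P s w q (Function.update m₁ i v) k Q) →
        Does P s w (set i e ;; q) m₁ (1 + k) Q := by
      intro i e v q m₁ k Q hi he hv hm hq
      have ev := he m₁ hm
      refine Does.store_seq (by simp only [IExp.eval]; omega) (by omega) ?_
      rw [ev]
      exact hq fun a ha => by rw [Function.update_of_ne (by omega), hm a ha]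
    have hcw : c < 2 ^ w := by omega
    refine hstore (by omega) hst (by omega) (fun _ _ => rfl) fun h₁ => ?_
    refine hstore (by omega) hen (by omega) h₁ fun h₂ => ?_
    refine hstore (by omega) (v := 0) (fun _ _ => rfl) (by omega) h₂ fun h₃ => ?_
    refine hstore (by omega) hla (by omega) h₃ fun h₄ => ?_
    refine hstore (by omega) hlb (by omega) h₄ fun h₅ => ?_
    refine hstore (by omega) hra (by omega) h₅ fun h₆ => ?_
    refine hstore (by omega) hrb (by omega) h₆ fun h₇ => ?_
    refine (Does.loop (k := (8 * H + 20) + ((1 + 1) + 1)) (fun k m' => m' 5 + k = c ∧ a ≤ m' 5 ∧ m' 6 = c ∧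
      m' 7 = cnt Q lo hi H g l r a (m' 5) ∧ m' 8 = l.1 ∧ m' 9 = l.2 ∧ m' 10 = r.1 ∧ m' 11 = r.2 ∧
      ∀ a, 12 ≤ a → m' a = m a) ?_ ?_ _ _ ?_).mono le_rfl ?_
    · rintro k m₁ ⟨i₅, i₅', i₆, i₇, i₈, i₉, i₁₀, i₁₁, hf⟩
      refine ⟨by simp [BExp.eval, IExp.eval]; omega, ?_⟩
      have hE : Env m₁ lo hi H fb g := h.congr fun a ha => hf a (by omega)
      have hm5 : m₁ 5 < c := by omega
      have hb : 2 * m₁ 5 * H + 2 * H ≤ 2 * (c + 1) * H := by nlinarith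
      refine Does.seq ((does_itemProg hA hs hE hH (by omega) hw').mono le_rfl ?_)
      rintro m₂ ⟨hit, hf₂⟩
      have hE₂ : Env m₂ lo hi H fb g := hE.congr fun a ha => hf₂ a (by omega)
      rw [← hf₂ 5 (by omega)] at hit
      have hct := candTest_eval hA hE₂ hit
      rw [hf₂ 5 (by omega), hf₂ 8 (by omega), hf₂ 9 (by omega), hf₂ 10 (by omega),
        hf₂ 11 (by omega), i₈, i₉, i₁₀, i₁₁] at hct
      have hcnt := cnt_succ (Q := Q) (lo := lo) (hi := hi) (H := H) (g := g) (l := l) (r := r) i₅'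
      -- The counter is at most the number of blocks seen, so its increment fits into a word.
      have hle := cnt_le_sub (Q := Q) (lo := lo) (hi := hi) (H := H) (g := g) (l := l) (r := r)
        a (m₁ 5)
      refine Does.seq (Does.cond (fun hb => ?_) fun hb => ?_)
      · refine Does.store (by simp [IExp.eval]; omega)
          (by simp [IExp.eval, hf₂, i₇]; omega) ?_
        refine Does.store (by simp [IExp.eval]; omega)
          (by simp [IExp.eval, hf₂]; omega) ?_
        rw [if_pos (hct.1 hb)] at hcnt
        refine ⟨?_, ?_, ?_, ?_, ?_, ?_, ?_, ?_, fun a ha => ?_⟩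
        · simp [IExp.eval, hf₂]; omega
        · simp [IExp.eval, hf₂]; omega
        · simp [IExp.eval, hf₂, i₆]
        · simp [IExp.eval, hf₂, i₇, hcnt]
        · simp [IExp.eval, hf₂, i₈]
        · simp [IExp.eval, hf₂, i₉]
        · simp [IExp.eval, hf₂, i₁₀]
        · simp [IExp.eval, hf₂, i₁₁]
        · rw [← hf a ha, ← hf₂ a (by omega)]
          repeat rw [Function.update_of_ne (by simp only [IExp.eval]; omega)]
      · refine Does.skip (Does.store (by simp [IExp.eval]; omega)
          (by simp [IExp.eval, hf₂]; omega) ?_)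
        rw [if_neg (fun h => hb (hct.2 h))] at hcnt
        refine ⟨?_, ?_, ?_, ?_, ?_, ?_, ?_, ?_, fun a ha => ?_⟩
        · simp [IExp.eval, hf₂]; omega
        · simp [IExp.eval, hf₂]; omega
        · simp [IExp.eval, hf₂, i₆]
        · simp [IExp.eval, hf₂, i₇, hcnt]
        · simp [IExp.eval, hf₂, i₈]
        · simp [IExp.eval, hf₂, i₉]
        · simp [IExp.eval, hf₂, i₁₀]
        · simp [IExp.eval, hf₂, i₁₁]
        · rw [← hf a ha, ← hf₂ a (by omega)]
          repeat rw [Function.update_of_ne (by simp only [IExp.eval]; omega)]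
    · rintro m' ⟨i₅, i₅', i₆, -⟩
      simp [BExp.eval, IExp.eval]; omega
    · refine ⟨?_, ?_, ?_, ?_, ?_, ?_, ?_, ?_, h₇⟩
      · simp; omega
      all_goals simp [cnt_self]
    · rintro m' ⟨i₅, i₅', i₆, i₇, i₈, i₉, i₁₀, i₁₁, hf⟩
      obtain rfl : m' 5 = c := by omega
      exact ⟨i₇, hf⟩
  have e : 8 * H + 20 + (1 + 1 + 1) + 1 = 8 * H + 24 := by omega
  rw [e] at key
  exact key.mono (by omega) fun _ => id

end ReadOnly

/-! ### Stack frames and the elementary steps of the selection of a pivot. -/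

namespace ReadOnly

variable {n : ℕ} {P : Fin n → Pt} {s w : ℕ} {A : Access} {Q : ℕ → Pt}

/-- The address of component `c` of the stack frame with number `d`. -/
abbrev fr (d : IExp) (c : ℕ) : IExp := var 29 ∔ .const 5 ⨰ d ∔ .const c

/-- A stack frame: the number of the first block, and the bounds for the slopes. -/
structure Frame (m : Mem) (a st : ℕ) (l r : ℕ × ℕ) : Prop where
  st_eq : m a = st
  l_fst : m (a + 1) = l.1
  l_snd : m (a + 2) = l.2
  r_fst : m (a + 3) = r.1
  r_snd : m (a + 4) = r.2

theorem Frame.congr {m m' : Mem} {a st : ℕ} {l r : ℕ × ℕ} (h : Frame m a st l r)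
    (h' : ∀ i, a ≤ i → i < a + 5 → m' i = m i) : Frame m' a st l r :=
  ⟨(h' _ (by omega) (by omega)).trans h.st_eq, (h' _ (by omega) (by omega)).trans h.l_fst,
    (h' _ (by omega) (by omega)).trans h.l_snd, (h' _ (by omega) (by omega)).trans h.r_fst,
    (h' _ (by omega) (by omega)).trans h.r_snd⟩

/-- Pushes a copy of the current stack frame, with first block `st`. -/
def pushProg (st : IExp) : Program :=
  .store (fr (var 18 ∔ .const 1) 0) st ;;
  .store (fr (var 18 ∔ .const 1) 1) (.load (fr (var 18) 1)) ;;
  .store (fr (var 18 ∔ .const 1) 2) (.load (fr (var 18) 2)) ;;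
  .store (fr (var 18 ∔ .const 1) 3) (.load (fr (var 18) 3)) ;;
  .store (fr (var 18 ∔ .const 1) 4) (.load (fr (var 18) 4)) ;;
  set 18 (var 18 ∔ .const 1)

theorem does_pushProg {m : Mem} {st : IExp} {fb d v v₀ : ℕ} {l r : ℕ × ℕ} (h29 : m 29 = fb)
    (hfb : 40 ≤ fb) (h18 : m 18 = d) (hF : Frame m (fb + 5 * d) v₀ l r) (hst : st.eval n m = v)
    (hs : fb + 5 * d + 10 ≤ s) (hv : v < 2 ^ w) (hl₁ : l.1 < 2 ^ w) (hl₂ : l.2 < 2 ^ w)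
    (hr₁ : r.1 < 2 ^ w) (hr₂ : r.2 < 2 ^ w) (hd : d + 1 < 2 ^ w) :
    Does P s w (pushProg st) m 6 fun m' => Frame m' (fb + 5 * (d + 1)) v l r ∧ m' 18 = d + 1 ∧
      ∀ a, a ≠ 18 → a < fb + 5 * (d + 1) → m' a = m a := by
  have key : ∀ {c : ℕ} {e : IExp} {x : ℕ} {q : Program} {m₁ : Mem} {k : ℕ} {Q : Mem → Prop},
      c < 5 → m₁ 29 = fb → m₁ 18 = d → e.eval n m₁ = x → x < 2 ^ w →
      Does P s w q (Function.update m₁ (fb + 5 * (d + 1) + c) x) k Q →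
      Does P s w (.store (fr (var 18 ∔ .const 1) c) e ;; q) m₁ (1 + k) Q := by
    intro c e x q m₁ k Q hc h₁ h₂ h₃ h₄ h₅
    refine Does.store_seq (by simp only [IExp.eval, h₁, h₂]; omega) (by omega) ?_
    simpa only [IExp.eval, h₁, h₂, h₃] using h₅
  show Does P s w (pushProg st) m (1 + (1 + (1 + (1 + (1 + 1))))) _
  refine key (c := 0) (by omega) h29 h18 hst hv ?_
  have t : ∀ {a c x : ℕ} {m₁ : Mem}, (a < fb + 5 * (d + 1)) →
      Function.update m₁ (fb + 5 * (d + 1) + c) x a = m₁ a :=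
    fun h => Function.update_of_ne (by omega) _ _
  refine key (c := 1) (x := l.1) (by omega) (by simp only [t (show 29 < fb + 5 * (d + 1) by omega), h29])
    (by simp only [t (show 18 < fb + 5 * (d + 1) by omega), h18]) ?_ hl₁ ?_
  · simp only [IExp.eval, t (show 29 < fb + 5 * (d + 1) by omega),
      t (show 18 < fb + 5 * (d + 1) by omega), h29, h18,
      t (show fb + 5 * d + 1 < fb + 5 * (d + 1) by omega), hF.l_fst]
  refine key (c := 2) (x := l.2) (by omega) (by simp only [t (show 29 < fb + 5 * (d + 1) by omega), h29])
    (by simp only [t (show 18 < fb + 5 * (d + 1) by omega), h18]) ?_ hl₂ ?_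
  · simp only [IExp.eval, t (show 29 < fb + 5 * (d + 1) by omega),
      t (show 18 < fb + 5 * (d + 1) by omega), h29, h18,
      t (show fb + 5 * d + 2 < fb + 5 * (d + 1) by omega), hF.l_snd]
  refine key (c := 3) (x := r.1) (by omega) (by simp only [t (show 29 < fb + 5 * (d + 1) by omega), h29])
    (by simp only [t (show 18 < fb + 5 * (d + 1) by omega), h18]) ?_ hr₁ ?_
  · simp only [IExp.eval, t (show 29 < fb + 5 * (d + 1) by omega),
      t (show 18 < fb + 5 * (d + 1) by omega), h29, h18,
      t (show fb + 5 * d + 3 < fb + 5 * (d + 1) by omega), hF.r_fst]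
  refine key (c := 4) (x := r.2) (by omega) (by simp only [t (show 29 < fb + 5 * (d + 1) by omega), h29])
    (by simp only [t (show 18 < fb + 5 * (d + 1) by omega), h18]) ?_ hr₂ ?_
  · simp only [IExp.eval, t (show 29 < fb + 5 * (d + 1) by omega),
      t (show 18 < fb + 5 * (d + 1) by omega), h29, h18,
      t (show fb + 5 * d + 4 < fb + 5 * (d + 1) by omega), hF.r_snd]
  refine Does.store (by simp only [IExp.eval]; omega) ?_ ?_
  · simp only [IExp.eval, t (show 18 < fb + 5 * (d + 1) by omega), h18]
    exact hd
  · simp only [IExp.eval, t (show 18 < fb + 5 * (d + 1) by omega), h18]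
    have n18 : ∀ c, fb + 5 * (d + 1) + c ≠ 18 := fun c => by omega
    have n18' : fb + 5 * (d + 1) ≠ 18 := by omega
    refine ⟨⟨?_, ?_, ?_, ?_, ?_⟩, ?_, fun a ha ha' => ?_⟩
    · simp [n18']
    · simp [n18]
    · simp [n18]
    · simp [n18]
    · simp [n18]
    · simp
    · rw [Function.update_of_ne ha]
      simp only [t ha']

/-- Counts the undecided blocks in part number `m 12` of the current stack frame, and compares with
the best part so far. -/
def heavyStep (A : Access) : Program :=
  countProg A (.load (fr (var 18) 0) ∔ var 12 ⨰ var 17)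
      (.load (fr (var 18) 0) ∔ var 12 ⨰ var 17 ∔ var 17)
      (.load (fr (var 18) 1)) (.load (fr (var 18) 2)) (.load (fr (var 18) 3))
      (.load (fr (var 18) 4)) ;;
    .cond (.ilt (var 13) (var 7))
      (set 13 (var 7) ;; set 14 (.load (fr (var 18) 0) ∔ var 12 ⨰ var 17)) .skip ;;
    set 12 (var 12 ∔ .const 1)

/-- Pushes the part of the current stack frame that contains the most undecided blocks. -/
def heavyProg (A : Access) : Program :=
  set 17 (.div (var 17) (var 25)) ;; set 12 (.const 0) ;; set 13 (.const 0) ;;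
  set 14 (.load (fr (var 18) 0)) ;; .loop (.ilt (var 12) (var 25)) (heavyStep A) ;;
  pushProg (var 14)

/-- The work space after some parts of the current stack frame have been examined. -/
structure HeavyInv (Q : ℕ → Pt) (m : Mem) (lo hi H b z st : ℕ) (g l r : ℕ × ℕ) (k : ℕ)
    (m' : Mem) : Prop where
  left : m' 12 + k = b
  size : m' 17 = z
  best : ∃ c < b, m' 14 = st + c * z ∧ m' 13 ≤ cnt Q lo hi H g l r (st + c * z) (st + c * z + z)
  le : ∀ c < m' 12, cnt Q lo hi H g l r (st + c * z) (st + c * z + z) ≤ m' 13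
  frame : ∀ a, 18 ≤ a → m' a = m a

theorem does_heavyStep (hA : A.Reads P Q) {m : Mem} {lo hi H fb b d z st S : ℕ} {g l r : ℕ × ℕ}
    (hE : Env m lo hi H fb g) (hH : 1 ≤ H) (h25 : m 25 = b) (h18 : m 18 = d)
    (hF : Frame m (fb + 5 * d) st l r)
    (hs : fb + 5 * d + 10 ≤ s) (hl₁ : l.1 < 2 ^ w) (hl₂ : l.2 < 2 ^ w) (hr₁ : r.1 < 2 ^ w)
    (hr₂ : r.2 < 2 ^ w) (hbw : b + 1 < 2 ^ w) (hS : st + b * z ≤ S)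
    (hw : lo + 2 * (S + 1) * H + S + 1 < 2 ^ w) (hw' : hi + 1 < 2 ^ w)
    {k : ℕ} {m₁ : Mem} (hI : HeavyInv Q m lo hi H b z st g l r (k + 1) m₁) :
    Does P s w (heavyStep A) m₁ ((z * (8 * H + 24) + 8) + ((1 + (1 + 1)) + 1))
      (HeavyInv Q m lo hi H b z st g l r k) := by
  have hfb := hE.fb_le
  obtain ⟨i₁, i₂, ⟨c, hc, i₃, i₄⟩, i₅, hf⟩ := hI
  have q29 : m₁ 29 = fb := (hf _ (by omega)).trans hE.fb_eq
  have q25 : m₁ 25 = b := (hf _ (by omega)).trans h25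
  have q18 : m₁ 18 = d := (hf _ (by omega)).trans h18
  have hF₁ : Frame m₁ (fb + 5 * d) st l r := hF.congr fun i _ _ => hf i (by omega)
  have hE₁ : Env m₁ lo hi H fb g := hE.congr fun a _ => hf a (by omega)
  -- At least one part is still to be examined, so the current one ends within the blocks of the
  -- frame.
  have hcz : m₁ 12 * z + z ≤ b * z := by nlinarith
  have hmul : 2 * (st + m₁ 12 * z + z + 1) * H ≤ 2 * (S + 1) * H :=
    Nat.mul_le_mul_right _ (by omega)
  refine Does.seq ((does_countProg hA (by omega) hE₁ hH (a := st + m₁ 12 * z)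
    (c := st + m₁ 12 * z + z) (l := l) (r := r) ?_ ?_ ?_ ?_ ?_ ?_ (by omega) hl₁ hl₂ hr₁ hr₂
    (by omega) hw').mono (by rw [Nat.add_sub_cancel_left]) ?_)
  · intro m' hm'
    simp only [IExp.eval]
    rw [hm' 29 (by omega), hm' 18 (by omega), hm' 12 le_rfl, hm' 17 (by omega), q29, q18, i₂,
      hm' _ (by omega), add_zero, hF₁.st_eq]
  · intro m' hm'
    simp only [IExp.eval]
    rw [hm' 29 (by omega), hm' 18 (by omega), hm' 12 le_rfl, hm' 17 (by omega), q29, q18, i₂,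
      hm' _ (by omega), add_zero, hF₁.st_eq]
  · intro m' hm'
    simp only [IExp.eval]
    rw [hm' 29 (by omega), hm' 18 (by omega), q29, q18, hm' _ (by omega), hF₁.l_fst]
  · intro m' hm'
    simp only [IExp.eval]
    rw [hm' 29 (by omega), hm' 18 (by omega), q29, q18, hm' _ (by omega), hF₁.l_snd]
  · intro m' hm'
    simp only [IExp.eval]
    rw [hm' 29 (by omega), hm' 18 (by omega), q29, q18, hm' _ (by omega), hF₁.r_fst]
  · intro m' hm'
    simp only [IExp.eval]
    rw [hm' 29 (by omega), hm' 18 (by omega), q29, q18, hm' _ (by omega), hF₁.r_snd]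
  rintro m₂ ⟨hcnt, hf₂⟩
  have u12 := hf₂ 12 le_rfl
  have u13 := hf₂ 13 (by omega)
  have u14 := hf₂ 14 (by omega)
  have u17 := (hf₂ 17 (by omega)).trans i₂
  have u18 := (hf₂ 18 (by omega)).trans q18
  have u29 := (hf₂ 29 (by omega)).trans q29
  have hle := cnt_le_sub (Q := Q) (lo := lo) (hi := hi) (H := H) (g := g) (l := l) (r := r)
    (st + m₁ 12 * z) (st + m₁ 12 * z + z)
  refine Does.seq (Does.cond (fun hb' => ?_) fun hb' => ?_)
  · simp only [BExp.eval, IExp.eval] at hb'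
    refine Does.store_seq (by simp only [IExp.eval]; omega)
      (by simp only [IExp.eval]; omega) ?_
    simp only [IExp.eval]
    have e1 : Function.update m₂ 13 (m₂ 7) (fb + 5 * d) = st := by
      rw [Function.update_of_ne (by omega), hf₂ _ (by omega), hF₁.st_eq]
    refine Does.store (by simp only [IExp.eval]; omega) ?_ ?_
    · simp only [IExp.eval, Function.update_of_ne (show (29 : ℕ) ≠ 13 by omega),
        Function.update_of_ne (show (18 : ℕ) ≠ 13 by omega),
        Function.update_of_ne (show (12 : ℕ) ≠ 13 by omega),
        Function.update_of_ne (show (17 : ℕ) ≠ 13 by omega), u29, u18, u17, u12, add_zero, e1]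
      omega
    · simp only [IExp.eval, Function.update_of_ne (show (29 : ℕ) ≠ 13 by omega),
        Function.update_of_ne (show (18 : ℕ) ≠ 13 by omega),
        Function.update_of_ne (show (12 : ℕ) ≠ 13 by omega),
        Function.update_of_ne (show (17 : ℕ) ≠ 13 by omega), u29, u18, u17, u12, add_zero, e1]
      refine Does.store (by simp only [IExp.eval]; omega) ?_ ?_
      · simp [IExp.eval, u12]; omega
      · refine ⟨?_, ?_, ⟨m₁ 12, by omega, ?_, ?_⟩, ?_, fun a ha => ?_⟩
        · simp [IExp.eval, u12]; omega
        · simp [IExp.eval, u17]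
        · simp [IExp.eval]
        · simp [IExp.eval, hcnt]
        · simp only [IExp.eval]
          simp only [ne_eq, Nat.reduceEqDiff, not_false_eq_true,
            Function.update_of_ne, Function.update_self, u12, hcnt]
          intro c' hc'
          rcases Nat.lt_succ_iff_lt_or_eq.1 hc' with h | h
          · exact (i₅ c' h).trans (by omega)
          · rw [h]
        · rw [← hf a ha, ← hf₂ a (by omega)]
          repeat rw [Function.update_of_ne (by simp only [IExp.eval]; omega)]
          repeat rw [Function.update_of_ne (by omega)]
  · simp only [BExp.eval, IExp.eval] at hb'
    refine (Does.skip ?_).mono (k := 1) (by omega) fun _ => id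
    refine Does.store (by simp only [IExp.eval]; omega) ?_ ?_
    · simp [IExp.eval, u12]; omega
    · refine ⟨?_, ?_, ⟨c, hc, ?_, ?_⟩, ?_, fun a ha => ?_⟩
      · simp [IExp.eval, u12]; omega
      · simp [IExp.eval, u17]
      · simp [IExp.eval, u14, i₃]
      · simp [IExp.eval, u13, i₄]
      · simp only [IExp.eval]
        simp only [ne_eq, Nat.reduceEqDiff, not_false_eq_true,
          Function.update_of_ne, Function.update_self, u12, u13]
        intro c' hc'
        rcases Nat.lt_succ_iff_lt_or_eq.1 hc' with h | h
        · exact i₅ c' h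
        · rw [h]; omega
      · rw [← hf a ha, ← hf₂ a (by omega)]
        repeat rw [Function.update_of_ne (by simp only [IExp.eval]; omega)]

theorem does_heavyProg (hA : A.Reads P Q) {m : Mem} {lo hi H fb b d z st S : ℕ} {g l r : ℕ × ℕ}
    (hE : Env m lo hi H fb g) (hH : 1 ≤ H) (h25 : m 25 = b) (hb : 1 ≤ b) (h18 : m 18 = d)
    (h17 : m 17 = z * b) (hF : Frame m (fb + 5 * d) st l r)
    (hs : fb + 5 * d + 10 ≤ s) (hl₁ : l.1 < 2 ^ w) (hl₂ : l.2 < 2 ^ w) (hr₁ : r.1 < 2 ^ w)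
    (hr₂ : r.2 < 2 ^ w) (hd : d + 1 < 2 ^ w) (hbw : b + 1 < 2 ^ w) (hS : st + b * z ≤ S)
    (hw : lo + 2 * (S + 1) * H + S + 1 < 2 ^ w) (hw' : hi + 1 < 2 ^ w) :
    Does P s w (heavyProg A) m (b * (z * (8 * H + 24) + 13) + 11) fun m' =>
      ∃ c < b, Frame m' (fb + 5 * (d + 1)) (st + c * z) l r ∧ m' 18 = d + 1 ∧ m' 17 = z ∧
        (∀ c' < b, cnt Q lo hi H g l r (st + c' * z) (st + c' * z + z) ≤
          cnt Q lo hi H g l r (st + c * z) (st + c * z + z)) ∧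
        (∀ a, 19 ≤ a → a < fb + 5 * (d + 1) → m' a = m a) := by
  have hfb := hE.fb_le
  have key : Does P s w (heavyProg A) m
      (1 + (1 + (1 + (1 + ((b * ((z * (8 * H + 24) + 8) + ((1 + (1 + 1)) + 1) + 1) + 1) + 6)))))
      fun m' => ∃ c < b, Frame m' (fb + 5 * (d + 1)) (st + c * z) l r ∧ m' 18 = d + 1 ∧
        m' 17 = z ∧
        (∀ c' < b, cnt Q lo hi H g l r (st + c' * z) (st + c' * z + z) ≤
          cnt Q lo hi H g l r (st + c * z) (st + c * z + z)) ∧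
        (∀ a, 19 ≤ a → a < fb + 5 * (d + 1) → m' a = m a) := by
    have hz : z ≤ S := by nlinarith
    have hdiv : z * b / b = z := Nat.mul_div_cancel _ (by omega)
    refine Does.put_seq (i := 17) (v := z) rfl (by simp only [IExp.eval, h17, h25, hdiv]) (by omega)
      (by omega) ?_
    refine Does.put_seq (i := 12) (v := 0) rfl rfl (by omega) (by omega) ?_
    refine Does.put_seq (i := 13) (v := 0) rfl rfl (by omega) (by omega) ?_
    have g0 : ∀ a, 18 ≤ a → Function.update (Function.update (Function.update m 17 z) 12 0) 13 0 a
        = m a := fun a ha => by repeat rw [Function.update_of_ne (by omega)]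
    refine Does.put_seq (i := 14) (v := st) rfl ?_ (by omega) (by omega) ?_
    · simp only [IExp.eval]
      rw [g0 29 (by omega), g0 18 (by omega), g0 _ (by rw [hE.fb_eq]; omega), h18, hE.fb_eq]
      exact hF.st_eq
    set m₀ := Function.update (Function.update (Function.update (Function.update m 17 z) 12 0) 13 0)
      14 st with hm₀
    refine Does.seq (k₁ := b * ((z * (8 * H + 24) + 8) + ((1 + (1 + 1)) + 1) + 1) + 1) (k₂ := 6)
      ((Does.loop (HeavyInv Q m lo hi H b z st g l r) ?_ ?_ b m₀ ?_).mono (le_refl _) ?_)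
    · intro k m₁ hI
      refine ⟨?_, does_heavyStep hA hE hH h25 h18 hF hs hl₁ hl₂ hr₁ hr₂ hbw hS hw hw' hI⟩
      have := hI.left
      have := hI.frame 25 (by omega)
      simp only [BExp.eval, IExp.eval]; omega
    · rintro m' ⟨i₁, -, -, -, hf⟩
      have := hf 25 (by omega)
      simp only [BExp.eval, IExp.eval]; omega
    -- Before any count, part `0` with recorded value `0` serves as the best one, since `best` asks
    -- only for an inequality.
    · refine ⟨by simp [hm₀], by simp [hm₀], ⟨0, by omega, by simp [hm₀], by simp [hm₀]⟩,
        by simp [hm₀], fun a ha => ?_⟩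
      rw [hm₀]; repeat rw [Function.update_of_ne (by omega)]
    · rintro m₁ ⟨i₁, i₂, ⟨c, hc, i₃, i₄⟩, i₅, hf⟩
      have hF₁ : Frame m₁ (fb + 5 * d) st l r := hF.congr fun i _ _ => hf i (by omega)
      have hcz : c * z ≤ b * z := Nat.mul_le_mul_right _ hc.le
      refine (does_pushProg ((hf 29 (by omega)).trans hE.fb_eq) hfb ((hf 18 le_rfl).trans h18) hF₁
        (v := st + c * z) (by simp only [IExp.eval]; exact i₃) hs (by omega) hl₁ hl₂ hr₁ hr₂
        hd).mono le_rfl ?_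
      rintro m₂ ⟨j₁, j₂, j₃⟩
      refine ⟨c, hc, j₁, j₂, ?_, fun c' hc' => (i₅ c' (by omega)).trans i₄, fun a h h' => ?_⟩
      · rw [j₃ 17 (by omega) (by omega), i₂]
      · rw [j₃ a (by omega) h', hf a (by omega)]
  refine key.mono ?_ fun _ => id
  have : (z * (8 * H + 24) + 8) + ((1 + (1 + 1)) + 1) + 1 = z * (8 * H + 24) + 13 := by omega
  rw [this]; omega

/-- Makes the slope of the only block of the current stack frame the pivot. -/
def leafProg (A : Access) : Program :=
  set 5 (.load (fr (var 18) 0)) ;; itemProg A ;; set 20 (var 3) ;; set 21 (var 4) ;;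
    set 19 (.const 1)

theorem does_leafProg (hA : A.Reads P Q) {m : Mem} {lo hi H fb d st : ℕ} {g : ℕ × ℕ}
    (hE : Env m lo hi H fb g) (hH : 1 ≤ H) (h18 : m 18 = d) (hst : m (fb + 5 * d) = st)
    (hs : 40 ≤ s) (hw : lo + 2 * (st + 1) * H + st + 1 < 2 ^ w) (hw' : hi + 1 < 2 ^ w) :
    Does P s w (leafProg A) m (8 * H + 24) fun m' =>
      (m' 20, m' 21) = item Q lo hi H g st ∧ m' 19 = 1 ∧ m' 17 = m 17 ∧ m' 18 = m 18 ∧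
        ∀ a, 22 ≤ a → m' a = m a := by
  have hfb := hE.fb_le
  have hexp : 2 * (st + 1) * H = 2 * st * H + 2 * H := by ring
  have key : Does P s w (leafProg A) m (1 + ((8 * H + 20) + (1 + (1 + 1)))) fun m' =>
      (m' 20, m' 21) = item Q lo hi H g st ∧ m' 19 = 1 ∧ m' 17 = m 17 ∧ m' 18 = m 18 ∧
        ∀ a, 22 ≤ a → m' a = m a := by
    have e0 : (IExp.load (fr (var 18) 0)).eval n m = st := by
      simp only [IExp.eval, h18, hE.fb_eq, add_zero, hst]
    refine Does.store_seq (by simp only [IExp.eval]; omega) (by rw [e0]; omega) ?_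
    rw [e0]
    have f₁ : ∀ a, 6 ≤ a → Function.update m ((IExp.const 5).eval n m) st a = m a := fun a ha =>
      Function.update_of_ne (by simp only [IExp.eval]; omega) _ _
    have e₅ : Function.update m ((IExp.const 5).eval n m) st 5 = st := by simp [IExp.eval]
    refine Does.seq ((does_itemProg hA hs (hE.congr fun a ha => f₁ a (by omega)) hH
      (by rw [e₅]; omega) hw').mono le_rfl ?_)
    rintro m₁ ⟨h₁, f₂⟩
    rw [e₅] at h₁
    have b₃ : m₁ 3 < 2 ^ w := by
      have := le_amax (Higher Q g) (lo + 2 * st * H) (H - 1)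
      have e : m₁ 3 = itemFst Q lo H g st := congrArg Prod.fst h₁
      rw [e, itemFst]; omega
    have b₄ : m₁ 4 < 2 ^ w := by
      have := le_amax (Higher Q g) (lo + 2 * st * H + H)
        (min (lo + 2 * st * H + H + H) (hi + 1) - (lo + 2 * st * H + H) - 1)
      have e : m₁ 4 = itemSnd Q lo hi H g st := congrArg Prod.snd h₁
      rw [e, itemSnd]; omega
    refine Does.store_seq (by simp only [IExp.eval]; omega) (by simpa [IExp.eval] using b₃) ?_
    refine Does.store_seq (by simp only [IExp.eval]; omega) (by simpa [IExp.eval] using b₄) ?_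
    refine Does.store (by simp only [IExp.eval]; omega) (by simp only [IExp.eval]; omega) ?_
    refine ⟨by simpa [IExp.eval] using h₁, by simp [IExp.eval], ?_, ?_, fun a ha => ?_⟩
    · simp [IExp.eval, f₂]
    · simp [IExp.eval, f₂]
    · rw [← f₁ a (by omega), ← f₂ a (by omega)]
      repeat rw [Function.update_of_ne (by simp only [IExp.eval]; omega)]
  exact key.mono (by omega) fun _ => id

end ReadOnly

namespace ReadOnly

variable {n : ℕ} {P : Fin n → Pt} {s w : ℕ} {A : Access} {Q : ℕ → Pt}

theorem Val.var {m : Mem} {k r v : ℕ} (hr : k ≤ r) (hv : m r = v) : Val n m k (var r) v :=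
  fun m' hm' => by simp only [IExp.eval]; rw [hm' r hr, hv]

theorem Val.add {m : Mem} {k : ℕ} {e f : IExp} {u v : ℕ} (he : Val n m k e u)
    (hf : Val n m k f v) : Val n m k (e ∔ f) (u + v) :=
  fun m' hm' => by simp only [IExp.eval, he m' hm', hf m' hm']

theorem Val.fr {m : Mem} {k fb d c v : ℕ} {e : IExp} (hk : k ≤ 29) (h29 : m 29 = fb)
    (hfb : 40 ≤ fb) (he : Val n m k e d) (hv : m (fb + 5 * d + c) = v) :
    Val n m k (.load (fr e c)) v := fun m' hm' => by
  simp only [IExp.eval, he m' hm', hm' 29 hk, h29]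
  rw [hm' _ (by omega), hv]

theorem Val.pred {m : Mem} {k d : ℕ} {e : IExp} (he : Val n m k e (d + 1)) :
    Val n m k (.sub e (.const 1)) d := fun m' hm' => by
  simp only [IExp.eval, he m' hm']; omega

/-- Compares the pivot with the middle of the undecided blocks of the current stack frame, and
narrows the bounds of the frame unless the pivot is close to the middle. -/
def narrowProg (A : Access) : Program :=
  set 17 (var 17 ⨰ var 25) ;;
  countProg A (.load (fr (var 18) 0)) (.load (fr (var 18) 0) ∔ var 17)
    (.load (fr (.sub (var 18) (.const 1)) 1)) (.load (fr (.sub (var 18) (.const 1)) 2))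
    (.load (fr (.sub (var 18) (.const 1)) 3)) (.load (fr (.sub (var 18) (.const 1)) 4)) ;;
  set 15 (var 7) ;;
  countProg A (.load (fr (var 18) 0)) (.load (fr (var 18) 0) ∔ var 17)
    (.load (fr (.sub (var 18) (.const 1)) 1)) (.load (fr (.sub (var 18) (.const 1)) 2))
    (var 20) (var 21) ;;
  .cond (.ilt (.const 3 ⨰ var 15) (.const 4 ⨰ var 7))
    (.store (fr (var 18) 3) (var 20) ;; .store (fr (var 18) 4) (var 21) ;; set 19 (.const 0))
    (countProg A (.load (fr (var 18) 0)) (.load (fr (var 18) 0) ∔ var 17) (var 20) (var 21)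
        (.load (fr (.sub (var 18) (.const 1)) 3)) (.load (fr (.sub (var 18) (.const 1)) 4)) ;;
      .cond (.ilt (.const 3 ⨰ var 15) (.const 4 ⨰ var 7))
        (.store (fr (var 18) 1) (var 20) ;; .store (fr (var 18) 2) (var 21) ;; set 19 (.const 0))
        .skip)

/-- All counts use the bounds `l`, `r` of the frame below, which are those with which the current
frame started. If more than three quarters of that count lie below the pivot, it is too steep and
becomes the upper bound of the current frame; in the opposite case it becomes the lower bound;
otherwise it is passed on. -/
theorem does_narrowProg (hA : A.Reads P Q) {m : Mem} {lo hi H fb b d z st st₀ S : ℕ}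
    {g l r l' r' τ : ℕ × ℕ} (hE : Env m lo hi H fb g) (hH : 1 ≤ H) (h25 : m 25 = b)
    (h18 : m 18 = d + 1) (h17 : m 17 = z) (h19 : m 19 = 1) (h20 : m 20 = τ.1) (h21 : m 21 = τ.2)
    (hF : Frame m (fb + 5 * (d + 1)) st l' r') (hF₀ : Frame m (fb + 5 * d) st₀ l r)
    (hs : fb + 5 * d + 10 ≤ s) (hl₁ : l.1 < 2 ^ w) (hl₂ : l.2 < 2 ^ w) (hr₁ : r.1 < 2 ^ w)
    (hr₂ : r.2 < 2 ^ w) (ht₁ : τ.1 < 2 ^ w) (ht₂ : τ.2 < 2 ^ w) (hS : st + z * b ≤ S)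
    (hw : lo + 2 * (S + 1) * H + S + 1 < 2 ^ w) (hw' : hi + 1 < 2 ^ w) :
    Does P s w (narrowProg A) m (3 * (z * b * (8 * H + 24) + 8) + 7) fun m' =>
      (∀ a, 22 ≤ a → a < fb + 5 * (d + 1) → m' a = m a) ∧ m' 17 = z * b ∧ m' 18 = d + 1 ∧
      m' 20 = τ.1 ∧ m' 21 = τ.2 ∧
      ((3 * cnt Q lo hi H g l r st (st + z * b) < 4 * cnt Q lo hi H g l τ st (st + z * b) ∧
          m' 19 = 0 ∧ Frame m' (fb + 5 * (d + 1)) st l' τ) ∨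
        (3 * cnt Q lo hi H g l r st (st + z * b) < 4 * cnt Q lo hi H g τ r st (st + z * b) ∧
          m' 19 = 0 ∧ Frame m' (fb + 5 * (d + 1)) st τ r') ∨
        (4 * cnt Q lo hi H g l τ st (st + z * b) ≤ 3 * cnt Q lo hi H g l r st (st + z * b) ∧
          4 * cnt Q lo hi H g τ r st (st + z * b) ≤ 3 * cnt Q lo hi H g l r st (st + z * b) ∧
          m' 19 = 1)) := by
  have hfb := hE.fb_le
  have hmul : 2 * (st + z * b + 1) * H ≤ 2 * (S + 1) * H := Nat.mul_le_mul_right _ (by omega)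
  set T := z * b * (8 * H + 24) + 8 with hT
  have hT' : (st + z * b - st) * (8 * H + 24) + 8 ≤ T := by rw [hT, Nat.add_sub_cancel_left]
  set M := cnt Q lo hi H g l r st (st + z * b) with hM
  have hMle : M ≤ z * b := by
    have := cnt_le_sub (Q := Q) (lo := lo) (hi := hi) (H := H) (g := g) (l := l) (r := r)
      st (st + z * b)
    omega
  refine Does.mono (k := 1 + (T + (1 + (T + (1 + (T + (1 + (1 + (1 + 1))))))))) ?_ (by omega)
    fun _ => id
  refine Does.put_seq (i := 17) (v := z * b) rfl (by simp only [IExp.eval, h17, h25]) (by omega)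
    (by omega) ?_
  set m₁ := Function.update m 17 (z * b) with hm₁
  have f₁ : ∀ a, 18 ≤ a → m₁ a = m a := fun a ha => Function.update_of_ne (by omega) _ _
  have e17 : m₁ 17 = z * b := by simp [hm₁]
  have v18 : Val n m₁ 12 (var 18) (d + 1) := .var (by omega) ((f₁ 18 (by omega)).trans h18)
  have e29 : m₁ 29 = fb := (f₁ 29 (by omega)).trans hE.fb_eq
  have vst : Val n m₁ 12 (.load (fr (var 18) 0)) st :=
    .fr (by omega) e29 hfb v18 ((f₁ _ (by omega)).trans hF.st_eq)
  have ven : Val n m₁ 12 (.load (fr (var 18) 0) ∔ var 17) (st + z * b) :=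
    vst.add (.var (by omega) e17)
  have vl₁ : Val n m₁ 12 (.load (fr (.sub (var 18) (.const 1)) 1)) l.1 :=
    .fr (by omega) e29 hfb v18.pred ((f₁ _ (by omega)).trans hF₀.l_fst)
  have vl₂ : Val n m₁ 12 (.load (fr (.sub (var 18) (.const 1)) 2)) l.2 :=
    .fr (by omega) e29 hfb v18.pred ((f₁ _ (by omega)).trans hF₀.l_snd)
  have vr₁ : Val n m₁ 12 (.load (fr (.sub (var 18) (.const 1)) 3)) r.1 :=
    .fr (by omega) e29 hfb v18.pred ((f₁ _ (by omega)).trans hF₀.r_fst)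
  have vr₂ : Val n m₁ 12 (.load (fr (.sub (var 18) (.const 1)) 4)) r.2 :=
    .fr (by omega) e29 hfb v18.pred ((f₁ _ (by omega)).trans hF₀.r_snd)
  have vt₁ : Val n m₁ 12 (var 20) τ.1 := .var (by omega) ((f₁ _ (by omega)).trans h20)
  have vt₂ : Val n m₁ 12 (var 21) τ.2 := .var (by omega) ((f₁ _ (by omega)).trans h21)
  have hE₁ : Env m₁ lo hi H fb g := hE.congr fun a ha => f₁ a (by omega)
  refine Does.seq (k₂ := 1 + (T + (1 + (T + (1 + (1 + (1 + 1)))))))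
    ((does_countProg hA (by omega) hE₁ hH vst ven vl₁ vl₂ vr₁ vr₂ (by omega) hl₁
    hl₂ hr₁ hr₂ (by omega) hw').mono hT' ?_)
  rintro m₂ ⟨h₇, f₂⟩
  rw [← hM] at h₇
  refine Does.put_seq (i := 15) (v := M) rfl (by simp only [IExp.eval, h₇]) (by omega)
    (by omega) ?_
  set m₃ := Function.update m₂ 15 M with hm₃
  have e15 : m₃ 15 = M := by simp [hm₃]
  have f₃ : ∀ a, 16 ≤ a → m₃ a = m₁ a := fun a ha => by
    rw [hm₃, Function.update_of_ne (by omega), f₂ a (by omega)]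
  have tr : ∀ {m' : Mem} {e : IExp} {v : ℕ}, (∀ a, 16 ≤ a → m' a = m₁ a) → Val n m₁ 16 e v →
      Val n m' 12 e v := fun h h' m'' h'' => h' m'' fun a ha => (h'' a (by omega)).trans (h a ha)
  -- From here on cell `15` has changed as well, so the operands are evaluated again relative to the
  -- cells from `16` on.
  clear vst ven vl₁ vl₂ vr₁ vr₂ vt₁ vt₂ v18
  have v18 : Val n m₁ 16 (var 18) (d + 1) := .var (by omega) ((f₁ 18 (by omega)).trans h18)
  have vst : Val n m₁ 16 (.load (fr (var 18) 0)) st :=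
    .fr (by omega) e29 hfb v18 ((f₁ _ (by omega)).trans hF.st_eq)
  have ven : Val n m₁ 16 (.load (fr (var 18) 0) ∔ var 17) (st + z * b) :=
    vst.add (.var (by omega) e17)
  have vl₁ : Val n m₁ 16 (.load (fr (.sub (var 18) (.const 1)) 1)) l.1 :=
    .fr (by omega) e29 hfb v18.pred ((f₁ _ (by omega)).trans hF₀.l_fst)
  have vl₂ : Val n m₁ 16 (.load (fr (.sub (var 18) (.const 1)) 2)) l.2 :=
    .fr (by omega) e29 hfb v18.pred ((f₁ _ (by omega)).trans hF₀.l_snd)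
  have vr₁ : Val n m₁ 16 (.load (fr (.sub (var 18) (.const 1)) 3)) r.1 :=
    .fr (by omega) e29 hfb v18.pred ((f₁ _ (by omega)).trans hF₀.r_fst)
  have vr₂ : Val n m₁ 16 (.load (fr (.sub (var 18) (.const 1)) 4)) r.2 :=
    .fr (by omega) e29 hfb v18.pred ((f₁ _ (by omega)).trans hF₀.r_snd)
  have vt₁ : Val n m₁ 16 (var 20) τ.1 := .var (by omega) ((f₁ _ (by omega)).trans h20)
  have vt₂ : Val n m₁ 16 (var 21) τ.2 := .var (by omega) ((f₁ _ (by omega)).trans h21)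
  have hE₃ : Env m₃ lo hi H fb g := hE₁.congr fun a ha => f₃ a (by omega)
  refine Does.seq (k₂ := 1 + (T + (1 + (1 + (1 + 1)))))
    ((does_countProg hA (by omega) hE₃ hH (tr f₃ vst) (tr f₃ ven) (tr f₃ vl₁)
    (tr f₃ vl₂) (tr f₃ vt₁) (tr f₃ vt₂) (by omega) hl₁ hl₂ ht₁ ht₂ (by omega) hw').mono hT' ?_)
  rintro m₄ ⟨h₇', f₄⟩
  have f₄' : ∀ a, 16 ≤ a → m₄ a = m₁ a := fun a ha => (f₄ a (by omega)).trans (f₃ a ha)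
  have f₄'' : ∀ a, 18 ≤ a → m₄ a = m a := fun a ha => (f₄' a (by omega)).trans (f₁ a ha)
  have q15 : m₄ 15 = M := (f₄ 15 (by omega)).trans e15
  have stores : ∀ (c : ℕ) (m' : Mem), c + 1 < 5 → (∀ a, 16 ≤ a → m' a = m₁ a) →
      Does P s w (.store (fr (var 18) c) (var 20) ;; .store (fr (var 18) (c + 1)) (var 21) ;;
        set 19 (.const 0)) m' (1 + (1 + 1)) fun m'' =>
        m'' = Function.update (Function.update (Function.update m' (fb + 5 * (d + 1) + c) τ.1)
          (fb + 5 * (d + 1) + (c + 1)) τ.2) 19 0 := by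
    intro c m' hc hm'
    have p18 : m' 18 = d + 1 := (hm' _ (by omega)).trans ((f₁ _ (by omega)).trans h18)
    have p29 : m' 29 = fb := (hm' _ (by omega)).trans e29
    have p20 : m' 20 = τ.1 := (hm' _ (by omega)).trans ((f₁ _ (by omega)).trans h20)
    have p21 : m' 21 = τ.2 := (hm' _ (by omega)).trans ((f₁ _ (by omega)).trans h21)
    refine Does.put_seq (i := fb + 5 * (d + 1) + c) (v := τ.1)
      (by simp only [IExp.eval, p18, p29]) (by simp only [IExp.eval, p20]) (by omega) ht₁ ?_
    have t : ∀ {a : ℕ}, a < 40 → Function.update m' (fb + 5 * (d + 1) + c) τ.1 a = m' a :=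
      fun h => Function.update_of_ne (by omega) _ _
    refine Does.put_seq (i := fb + 5 * (d + 1) + (c + 1)) (v := τ.2)
      (by simp only [IExp.eval, t (show 18 < 40 by omega), t (show 29 < 40 by omega), p18, p29])
      (by simp only [IExp.eval, t (show 21 < 40 by omega), p21]) (by omega) ht₂ ?_
    exact Does.put (i := 19) (v := 0) rfl rfl (by omega) (by omega) rfl
  refine (Does.cond (k := T + (1 + (1 + (1 + 1)))) (fun hb => ?_) fun hb => ?_)
  · simp only [BExp.eval, IExp.eval, q15, h₇'] at hb
    refine (stores 3 m₄ (by omega) f₄').mono (by omega) ?_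
    rintro m₅ rfl
    refine ⟨fun a h h' => ?_, ?_, ?_, ?_, ?_, .inl ⟨hb, by simp, ?_⟩⟩
    · rw [← f₄'' a (by omega)]
      repeat rw [Function.update_of_ne (by omega)]
    · repeat rw [Function.update_of_ne (by omega)]
      rw [f₄' _ (by omega), e17]
    · repeat rw [Function.update_of_ne (by omega)]
      rw [f₄'' _ (by omega), h18]
    · repeat rw [Function.update_of_ne (by omega)]
      rw [f₄'' _ (by omega), h20]
    · repeat rw [Function.update_of_ne (by omega)]
      rw [f₄'' _ (by omega), h21]
    · refine ⟨?_, ?_, ?_, ?_, ?_⟩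
      · repeat rw [Function.update_of_ne (by omega)]
        rw [f₄'' _ (by omega), hF.st_eq]
      · repeat rw [Function.update_of_ne (by omega)]
        rw [f₄'' _ (by omega), hF.l_fst]
      · repeat rw [Function.update_of_ne (by omega)]
        rw [f₄'' _ (by omega), hF.l_snd]
      · repeat rw [Function.update_of_ne (by omega)]
        rw [Function.update_self]
      · rw [Function.update_of_ne (by omega), Function.update_self]
  · simp only [BExp.eval, IExp.eval, q15, h₇'] at hb
    have hE₄ : Env m₄ lo hi H fb g := hE₁.congr fun a ha => f₄' a (by omega)
    refine Does.seq (k₂ := 1 + (1 + (1 + 1)))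
      ((does_countProg hA (by omega) hE₄ hH (tr f₄' vst) (tr f₄' ven) (tr f₄' vt₁)
      (tr f₄' vt₂) (tr f₄' vr₁) (tr f₄' vr₂) (by omega) ht₁ ht₂ hr₁ hr₂ (by omega) hw').mono hT' ?_)
    rintro m₅ ⟨h₇'', f₅⟩
    have f₅' : ∀ a, 16 ≤ a → m₅ a = m₁ a := fun a ha => (f₅ a (by omega)).trans (f₄' a ha)
    have f₅'' : ∀ a, 18 ≤ a → m₅ a = m a := fun a ha => (f₅' a (by omega)).trans (f₁ a ha)
    have p15 : m₅ 15 = M := (f₅ 15 (by omega)).trans q15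
    refine (Does.cond (k := 1 + (1 + 1)) (fun hb' => ?_) fun hb' => ?_)
    · simp only [BExp.eval, IExp.eval, p15, h₇''] at hb'
      refine (stores 1 m₅ (by omega) f₅').mono (by omega) ?_
      rintro m₆ rfl
      refine ⟨fun a h h' => ?_, ?_, ?_, ?_, ?_, .inr (.inl ⟨hb', by simp, ?_⟩)⟩
      · rw [← f₅'' a (by omega)]
        repeat rw [Function.update_of_ne (by omega)]
      · repeat rw [Function.update_of_ne (by omega)]
        rw [f₅' _ (by omega), e17]
      · repeat rw [Function.update_of_ne (by omega)]
        rw [f₅'' _ (by omega), h18]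
      · repeat rw [Function.update_of_ne (by omega)]
        rw [f₅'' _ (by omega), h20]
      · repeat rw [Function.update_of_ne (by omega)]
        rw [f₅'' _ (by omega), h21]
      · refine ⟨?_, ?_, ?_, ?_, ?_⟩
        · repeat rw [Function.update_of_ne (by omega)]
          rw [f₅'' _ (by omega), hF.st_eq]
        · repeat rw [Function.update_of_ne (by omega)]
          rw [Function.update_self]
        · rw [Function.update_of_ne (by omega), Function.update_self]
        · repeat rw [Function.update_of_ne (by omega)]
          rw [f₅'' _ (by omega), hF.r_fst]
        · repeat rw [Function.update_of_ne (by omega)]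
          rw [f₅'' _ (by omega), hF.r_snd]
    · simp only [BExp.eval, IExp.eval, p15, h₇''] at hb'
      refine (Does.skip (Q := _) ?_).mono (by omega) fun _ => id
      exact ⟨fun a h _ => f₅'' a (by omega), (f₅' _ (by omega)).trans e17,
        (f₅'' _ (by omega)).trans h18, (f₅'' _ (by omega)).trans h20, (f₅'' _ (by omega)).trans h21,
        .inr (.inr ⟨by omega, by omega, (f₅'' _ (by omega)).trans h19⟩)⟩

/-- One step of the search for a bridge. In mode `0`, a stack frame is pushed (by `top` if the stack
is empty) or the pivot is read off; in mode `1`, a frame is popped, and the pivot is used to narrow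
the bounds of the frame below (by `test` if that is the bottom of the stack). -/
def searchStep (A : Access) (top test : Program) : Program :=
  .cond (.ieq (var 19) (.const 0))
    (.cond (.ieq (var 18) (.const 0)) top
      (.cond (.ieq (var 17) (.const 1)) (leafProg A) (heavyProg A)))
    (set 18 (.sub (var 18) (.const 1)) ;;
      .cond (.ieq (var 18) (.const 0)) test (narrowProg A))

/-- The bridge has not been found yet. -/
def searching : BExp := .ieq (var 26) (.const 0)

/-- The time for the selection of a pivot from `b ^ e` blocks. -/
def selTime (H b : ℕ) : ℕ → ℕ
  | 0 => 8 * H + 28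
  | e + 1 => (4 * b + 1) * ((b * (b ^ e * (8 * H + 24) + 13) + 15) + selTime H b e +
      (3 * (b ^ e * b * (8 * H + 24) + 8) + 11))

/-- A level multiplies the bound by `4 * b + 1 ≤ 5 * b`. The counting of that level is of the same
order as the bound for the recursive call, and both are absorbed in the factor `16 * b`. -/
theorem selTime_le {H b : ℕ} (hH : 1 ≤ H) (hb : 1 ≤ b) (e : ℕ) :
    selTime H b e ≤ 400 * H * b ^ (e + 1) * 16 ^ e := by
  induction e with
  | zero =>
    have : H ≤ H * b := Nat.le_mul_of_pos_right _ hb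
    have e : 400 * H * b ^ (0 + 1) * 16 ^ 0 = 400 * (H * b) := by ring
    rw [selTime, e]; omega
  | succ e ih =>
    rw [selTime]
    have h₁ : 1 ≤ b ^ e := Nat.one_le_pow _ _ hb
    have h₂ : 1 ≤ (16 : ℕ) ^ e := Nat.one_le_pow _ _ (by omega)
    set p := b ^ e
    set q := 16 ^ e
    have e₁ : b ^ (e + 1) = p * b := pow_succ _ _
    have e₂ : b ^ (e + 1 + 1) = p * b * b := by rw [pow_succ, e₁]
    have e₃ : 16 ^ (e + 1) = q * 16 := pow_succ _ _
    rw [e₁] at ih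
    rw [e₂, e₃]
    have hpb : 1 ≤ p * b := Nat.mul_pos h₁ hb
    have hpbH : 1 ≤ p * b * H := Nat.mul_pos hpb hH
    have a₁ : b * (p * (8 * H + 24) + 13) ≤ 45 * (p * b * H) := by
      have : b * (p * (8 * H + 24) + 13) = 8 * (p * b * H) + 24 * (p * b) + 13 * b := by ring
      have h₃ : p * b ≤ p * b * H := Nat.le_mul_of_pos_right _ hH
      have h₄ : b ≤ p * b := Nat.le_mul_of_pos_left _ h₁
      omega
    have a₂ : 3 * (p * b * (8 * H + 24) + 8) ≤ 120 * (p * b * H) := by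
      have : p * b * (8 * H + 24) = 8 * (p * b * H) + 24 * (p * b) := by ring
      have h₃ : p * b ≤ p * b * H := Nat.le_mul_of_pos_right _ hH
      omega
    have a₃ : 400 * H * (p * b) * q = 400 * (p * b * H * q) := by ring
    have a₄ : p * b * H ≤ p * b * H * q := Nat.le_mul_of_pos_right _ h₂
    set X := p * b * H * q with hX
    -- The shares are 45 and 120 for counting, 26 for overhead and 400 for the recursive call.
    have a₅ : (b * (p * (8 * H + 24) + 13) + 15) + selTime H b e +
        (3 * (p * b * (8 * H + 24) + 8) + 11) ≤ 600 * X := by omega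
    have a₆ : 400 * H * (p * b * b) * (q * 16) = 6400 * (b * X) := by rw [hX]; ring
    rw [a₆]
    calc _ ≤ (4 * b + 1) * (600 * X) := Nat.mul_le_mul_left _ a₅
      _ ≤ (5 * b) * (600 * X) := Nat.mul_le_mul_right _ (by omega)
      _ = 3000 * (b * X) := by ring
      _ ≤ 6400 * (b * X) := Nat.mul_le_mul_right _ (by omega)

end ReadOnly

/-! ### Analysis of the recursive selection of a pivot. -/

namespace ReadOnly

variable {n : ℕ} {P : Fin n → Pt} {s w : ℕ} {A : Access} {Q : ℕ → Pt}

theorem Above.trans {l τ : ℕ × ℕ} {σ : ℝ} (h : Above Q l (slope Q τ)) (hτ : τ.1 ≠ τ.2)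
    (h' : Above Q τ σ) : Above Q l σ :=
  h.imp_right fun h => h.trans (h'.resolve_left hτ)

theorem Below.trans {r τ : ℕ × ℕ} {σ : ℝ} (h : Below Q r (slope Q τ)) (hτ : τ.1 ≠ τ.2)
    (h' : Below Q τ σ) : Below Q r σ :=
  h.imp_right fun h => (h'.resolve_left hτ).trans h

/-- The pivot `τ` lies between `l` and `r`, and at most three quarters of the undecided blocks with
numbers in `[a, c)` are on either side. -/
structure Pivot (Q : ℕ → Pt) (lo hi H : ℕ) (g l r : ℕ × ℕ) (a c : ℕ) (τ : ℕ × ℕ) : Prop where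
  fst_lt : (Q τ.1).1 < (Q τ.2).1
  above : Above Q l (slope Q τ)
  below : Below Q r (slope Q τ)
  left_le : 4 * cnt Q lo hi H g l τ a c ≤ 3 * cnt Q lo hi H g l r a c
  right_le : 4 * cnt Q lo hi H g τ r a c ≤ 3 * cnt Q lo hi H g l r a c

theorem Pivot.ne {lo hi H : ℕ} {g l r : ℕ × ℕ} {a c : ℕ} {τ : ℕ × ℕ}
    (h : Pivot Q lo hi H g l r a c τ) : τ.1 ≠ τ.2 := fun e => by
  have := h.fst_lt
  rw [e] at this
  exact lt_irrefl _ this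

/-- The bounds of an interval are strict, so a slope is not undecided with respect to itself. With
one block, both sides of its slope are empty. -/
theorem pivot_item {lo hi H : ℕ} {g l r : ℕ × ℕ} {k : ℕ} (h : 0 < cnt Q lo hi H g l r k (k + 1)) :
    Pivot Q lo hi H g l r k (k + 1) (item Q lo hi H g k) := by
  classical
  have hc : Cand Q lo hi H g l r k := by
    by_contra hc
    rw [cnt_succ le_rfl, cnt_self, if_neg hc] at h
    omega
  have hne : (item Q lo hi H g k).1 ≠ (item Q lo hi H g k).2 := fun e => by
    have := hc.1.2
    rw [e] at this
    exact lt_irrefl _ this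
  refine ⟨hc.1.2, hc.2.1, hc.2.2, ?_, ?_⟩
  · rw [cnt_succ le_rfl, cnt_self, if_neg]
    · omega
    · rintro ⟨-, -, h'⟩
      exact lt_irrefl _ (h'.resolve_left hne)
  · rw [cnt_succ le_rfl, cnt_self, if_neg]
    · omega
    · rintro ⟨-, h', -⟩
      exact lt_irrefl _ (h'.resolve_left hne)

/-- The fixed parameters of the selection of a pivot, and the bounds that make all numbers fit into
words and all stack frames fit into the work space. -/
structure SelCtx (s w lo hi H fb b S : ℕ) : Prop where
  H_pos : 1 ≤ H
  b_ge : 2 ≤ b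
  fb_le : 40 ≤ fb
  b_lt : b + 1 < 2 ^ w
  S_lt : lo + 2 * (S + 1) * H + S + 1 < 2 ^ w
  hi_lt : hi + 1 < 2 ^ w
  s_lt : s < 2 ^ w

/-- A work space at the beginning of a step in the given mode, with `d` stack frames above the
bottom and `z` blocks in the current frame. -/
structure SelState (m : Mem) (lo hi H fb b : ℕ) (g : ℕ × ℕ) (mode d z : ℕ) : Prop where
  env : Env m lo hi H fb g
  mode_eq : m 19 = mode
  depth : m 18 = d
  size : m 17 = z
  base : m 25 = b
  running : m 26 = 0

theorem SelState.of_eq {m m' : Mem} {lo hi H fb b : ℕ} {g : ℕ × ℕ} {mode d z mode' d' z' : ℕ}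
    (h : SelState m lo hi H fb b g mode d z) (h19 : m' 19 = mode') (h18 : m' 18 = d')
    (h17 : m' 17 = z') (hf : ∀ a, 22 ≤ a → a < fb + 5 → m' a = m a) :
    SelState m' lo hi H fb b g mode' d' z' := by
  have hfb := h.env.fb_le
  refine ⟨⟨?_, ?_, ?_, ?_, hfb, ?_, ?_⟩, h19, h18, h17, ?_, ?_⟩
  · exact (hf _ (by omega) (by omega)).trans h.env.lo_eq
  · exact (hf _ (by omega) (by omega)).trans h.env.hi_eq
  · exact (hf _ (by omega) (by omega)).trans h.env.H_eq
  · exact (hf _ (by omega) (by omega)).trans h.env.fb_eq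
  · exact (hf _ (by omega) (by omega)).trans h.env.fst
  · exact (hf _ (by omega) (by omega)).trans h.env.snd
  · exact (hf _ (by omega) (by omega)).trans h.base
  · exact (hf _ (by omega) (by omega)).trans h.running

theorem searching_eval {m : Mem} : searching.eval P m ↔ m 26 = 0 := by
  simp [searching, BExp.eval, IExp.eval]

/-- The bounds of a slope interval fit into words. -/
def Small (w : ℕ) (l : ℕ × ℕ) : Prop := l.1 < 2 ^ w ∧ l.2 < 2 ^ w

theorem heavy_reach {top test : Program} (hA : A.Reads P Q) {lo hi H fb b S d z st : ℕ}
    {g l r : ℕ × ℕ} {m : Mem} (hc : SelCtx s w lo hi H fb b S)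
    (hm : SelState m lo hi H fb b g 0 (d + 1) (z * b)) (hz : 1 ≤ z)
    (hF : Frame m (fb + 5 * (d + 1)) st l r) (hs : fb + 5 * (d + 1) + 10 ≤ s) (hl : Small w l)
    (hr : Small w r) (hS : st + b * z ≤ S) :
    ∃ m' c, c < b ∧ Reach P s w searching (searchStep A top test) m m' []
        (b * (z * (8 * H + 24) + 13) + 15) ∧
      SelState m' lo hi H fb b g 0 (d + 2) z ∧ Frame m' (fb + 5 * (d + 2)) (st + c * z) l r ∧
      (∀ c' < b, cnt Q lo hi H g l r (st + c' * z) (st + c' * z + z) ≤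
          cnt Q lo hi H g l r (st + c * z) (st + c * z + z)) ∧
      (∀ a, 22 ≤ a → a < fb + 5 * (d + 2) → m' a = m a) := by
  have h2 := hc.b_ge
  have hsw := hc.s_lt
  have hfb := hc.fb_le
  -- Since `b ≥ 2`, a frame with several parts is never mistaken for a single block.
  have hzb : z * b ≠ 1 := by nlinarith
  have := does_heavyProg (P := P) (s := s) (w := w) hA hm.env hc.H_pos hm.base (by omega) hm.depth
    hm.size hF hs hl.1 hl.2 hr.1 hr.2 (by omega) hc.b_lt hS hc.S_lt hc.hi_lt
  have hd : Does P s w (searchStep A top test) m (1 + (1 + (1 + _))) _ :=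
    Does.cond (fun _ => Does.cond
      (fun h => absurd h (by simp only [BExp.eval, IExp.eval, hm.depth]; omega))
      fun _ => Does.cond (fun h => absurd h (by simpa only [BExp.eval, IExp.eval, hm.size] using hzb))
        fun _ => this)
      fun h => absurd (show _ by simp only [BExp.eval, IExp.eval, hm.mode_eq]) h
  obtain ⟨m', hreach, c, hcb, h₁, h₂, h₃, h₄, h₅⟩ :=
    Reach.of_does (b := searching) (searching_eval.2 hm.running) hd
  refine ⟨m', c, hcb, hreach.mono (by omega), ?_, h₁, h₄, fun a h h' => h₅ a (by omega) h'⟩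
  exact hm.of_eq ((h₅ 19 (by omega) (by omega)).trans hm.mode_eq) h₂ h₃
    fun a h h' => h₅ a (by omega) (by omega)

theorem leaf_reach {top test : Program} (hA : A.Reads P Q) {lo hi H fb b S d st : ℕ}
    {g l r : ℕ × ℕ} {m : Mem} (hc : SelCtx s w lo hi H fb b S)
    (hm : SelState m lo hi H fb b g 0 (d + 1) 1)
    (hF : Frame m (fb + 5 * (d + 1)) st l r) (hs : 40 ≤ s) (hS : st ≤ S) :
    ∃ m', Reach P s w searching (searchStep A top test) m m' [] (8 * H + 28) ∧
      SelState m' lo hi H fb b g 1 (d + 1) 1 ∧ (m' 20, m' 21) = item Q lo hi H g st ∧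
      (∀ a, 22 ≤ a → m' a = m a) := by
  have hmul : 2 * (st + 1) * H ≤ 2 * (S + 1) * H := Nat.mul_le_mul_right _ (by omega)
  have hSw := hc.S_lt
  have := does_leafProg (P := P) (s := s) (w := w) hA hm.env hc.H_pos hm.depth hF.st_eq hs
    (by omega) hc.hi_lt
  have hd : Does P s w (searchStep A top test) m (1 + (1 + (1 + _))) _ :=
    Does.cond (fun _ => Does.cond
      (fun h => absurd h (by simp only [BExp.eval, IExp.eval, hm.depth]; omega))
      fun _ => Does.cond (fun _ => this)
        fun h => absurd (show _ by simp only [BExp.eval, IExp.eval, hm.size]) h)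
      fun h => absurd (show _ by simp only [BExp.eval, IExp.eval, hm.mode_eq]) h
  obtain ⟨m', hreach, h₁, h₂, h₃, h₄, h₅⟩ :=
    Reach.of_does (b := searching) (searching_eval.2 hm.running) hd
  exact ⟨m', hreach.mono (by omega), hm.of_eq h₂ (h₄.trans hm.depth) (h₃.trans hm.size)
    fun a h _ => h₅ a h, h₁, h₅⟩

theorem narrow_reach {top test : Program} (hA : A.Reads P Q) {lo hi H fb b S d z st st₀ : ℕ}
    {g l r l' r' τ : ℕ × ℕ} {m : Mem} (hc : SelCtx s w lo hi H fb b S)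
    (hm : SelState m lo hi H fb b g 1 (d + 2) z) (hτ : (m 20, m 21) = τ)
    (hF : Frame m (fb + 5 * (d + 1)) st l' r') (hF₀ : Frame m (fb + 5 * d) st₀ l r)
    (hs : fb + 5 * d + 10 ≤ s) (hl : Small w l) (hr : Small w r) (ht : Small w τ)
    (hS : st + z * b ≤ S) :
    ∃ m' mode l₁ r₁, Reach P s w searching (searchStep A top test) m m' []
        (3 * (z * b * (8 * H + 24) + 8) + 11) ∧
      SelState m' lo hi H fb b g mode (d + 1) (z * b) ∧ (m' 20, m' 21) = τ ∧
      (∀ a, 22 ≤ a → a < fb + 5 * (d + 1) → m' a = m a) ∧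
      ((mode = 0 ∧ Frame m' (fb + 5 * (d + 1)) st l₁ r₁ ∧
        ((l₁ = l' ∧ r₁ = τ ∧
          3 * cnt Q lo hi H g l r st (st + z * b) < 4 * cnt Q lo hi H g l τ st (st + z * b)) ∨
        (l₁ = τ ∧ r₁ = r' ∧
          3 * cnt Q lo hi H g l r st (st + z * b) < 4 * cnt Q lo hi H g τ r st (st + z * b)))) ∨
      (mode = 1 ∧
        4 * cnt Q lo hi H g l τ st (st + z * b) ≤ 3 * cnt Q lo hi H g l r st (st + z * b) ∧
        4 * cnt Q lo hi H g τ r st (st + z * b) ≤ 3 * cnt Q lo hi H g l r st (st + z * b))) := by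
  have hfb := hc.fb_le
  have hsw := hc.s_lt
  set m₁ := Function.update m 18 (d + 1) with hm₁
  have f₁ : ∀ a, a ≠ 18 → m₁ a = m a := fun a ha => Function.update_of_ne ha _ _
  have e18 : m₁ 18 = d + 1 := by simp [hm₁]
  have hE₁ : Env m₁ lo hi H fb g := hm.env.congr fun a ha => f₁ a (by omega)
  have := does_narrowProg (P := P) (s := s) (w := w) (m := m₁) (τ := τ) hA hE₁ hc.H_pos
    ((f₁ 25 (by omega)).trans hm.base) e18 ((f₁ 17 (by omega)).trans hm.size)
    ((f₁ 19 (by omega)).trans hm.mode_eq)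
    ((f₁ 20 (by omega)).trans (congrArg Prod.fst hτ))
    ((f₁ 21 (by omega)).trans (congrArg Prod.snd hτ))
    (hF.congr fun a _ _ => f₁ a (by omega)) (hF₀.congr fun a _ _ => f₁ a (by omega)) hs hl.1 hl.2
    hr.1 hr.2 ht.1 ht.2 hS hc.S_lt hc.hi_lt
  have hd : Does P s w (searchStep A top test) m (1 + (1 + (1 + _))) _ :=
    Does.cond (fun h => absurd h (by simp only [BExp.eval, IExp.eval, hm.mode_eq]; omega))
      fun _ => Does.put_seq (i := 18) (v := d + 1) rfl
        (by simp only [IExp.eval, hm.depth]; omega) (by omega) (by omega)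
        (Does.cond
          (fun h => absurd h (by simp only [BExp.eval, IExp.eval, Function.update_self]; omega))
          fun _ => this)
  obtain ⟨m', hreach, h₁, h₂, h₃, h₄, h₅, h₆⟩ :=
    Reach.of_does (b := searching) (searching_eval.2 hm.running) hd
  have hf : ∀ a, 22 ≤ a → a < fb + 5 * (d + 1) → m' a = m a := fun a h h' =>
    (h₁ a h h').trans (f₁ a (by omega))
  have hτ' : (m' 20, m' 21) = τ := by rw [h₄, h₅]
  rcases h₆ with ⟨h, h19, hF'⟩ | ⟨h, h19, hF'⟩ | ⟨h, h', h19⟩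
  · exact ⟨m', 0, l', τ, hreach.mono (by omega), hm.of_eq h19 h₃ h₂ fun a h h' =>
      hf a h (by omega), hτ', hf, .inl ⟨rfl, hF', .inl ⟨rfl, rfl, h⟩⟩⟩
  · exact ⟨m', 0, τ, r', hreach.mono (by omega), hm.of_eq h19 h₃ h₂ fun a h h' =>
      hf a h (by omega), hτ', hf, .inl ⟨rfl, hF', .inr ⟨rfl, rfl, h⟩⟩⟩
  -- In mode `1` nothing is claimed about the new bounds, so any witnesses do.
  · exact ⟨m', 1, l, r, hreach.mono (by omega), hm.of_eq h19 h₃ h₂ fun a h h' =>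
      hf a h (by omega), hτ', hf, .inr ⟨rfl, h, h'⟩⟩

/-- The rounds of the selection within one stack frame, given that a pivot can be selected from the
part of the frame with the most undecided blocks. -/
theorem select_rounds {top test : Program} (hA : A.Reads P Q) {lo hi H fb b S e d st st₀ : ℕ}
    {g l r : ℕ × ℕ} (hc : SelCtx s w lo hi H fb b S)
    (ih : ∀ (d st : ℕ) (l r : ℕ × ℕ) (m : Mem),
      SelState m lo hi H fb b g 0 (d + 1) (b ^ e) → Frame m (fb + 5 * (d + 1)) st l r →
      (∃ st₀, Frame m (fb + 5 * d) st₀ l r) → fb + 5 * (d + e + 1) + 10 ≤ s → Small w l →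
      Small w r → st + b ^ e ≤ S → 0 < cnt Q lo hi H g l r st (st + b ^ e) →
      ∃ m', Reach P s w searching (searchStep A top test) m m' [] (selTime H b e) ∧
        SelState m' lo hi H fb b g 1 (d + 1) (b ^ e) ∧ Small w (m' 20, m' 21) ∧
        Pivot Q lo hi H g l r st (st + b ^ e) (m' 20, m' 21) ∧
        ∀ a, 22 ≤ a → a < fb + 5 * (d + 1) → m' a = m a)
    (hs : fb + 5 * (d + (e + 1) + 1) + 10 ≤ s) (hl : Small w l) (hr : Small w r)
    (hS : st + b ^ e * b ≤ S) (hpos : 0 < cnt Q lo hi H g l r st (st + b ^ e * b)) (f : ℕ) :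
    ∀ (m : Mem) (l' r' : ℕ × ℕ), SelState m lo hi H fb b g 0 (d + 1) (b ^ e * b) →
      Frame m (fb + 5 * (d + 1)) st l' r' → Frame m (fb + 5 * d) st₀ l r →
      Small w l' → Small w r' →
      (∀ σ, Above Q l' σ → Above Q l σ) → (∀ σ, Below Q r' σ → Below Q r σ) →
      3 * cnt Q lo hi H g l r st (st + b ^ e * b) ≤ 4 * cnt Q lo hi H g l' r st (st + b ^ e * b) →
      3 * cnt Q lo hi H g l r st (st + b ^ e * b) ≤ 4 * cnt Q lo hi H g l r' st (st + b ^ e * b) →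
      8 * b * cnt Q lo hi H g l' r' st (st + b ^ e * b) ≤
        (4 * b + f) * cnt Q lo hi H g l r st (st + b ^ e * b) →
      ∃ m', Reach P s w searching (searchStep A top test) m m' []
          ((f + 1) * ((b * (b ^ e * (8 * H + 24) + 13) + 15) + selTime H b e +
            (3 * (b ^ e * b * (8 * H + 24) + 8) + 11))) ∧
        SelState m' lo hi H fb b g 1 (d + 1) (b ^ e * b) ∧ Small w (m' 20, m' 21) ∧
        Pivot Q lo hi H g l r st (st + b ^ e * b) (m' 20, m' 21) ∧
        ∀ a, 22 ≤ a → a < fb + 5 * (d + 1) → m' a = m a := by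
  have hb := hc.b_ge
  have hfb := hc.fb_le
  set M := cnt Q lo hi H g l r st (st + b ^ e * b) with hM
  have hcomm : b ^ e * b = b * b ^ e := mul_comm _ _
  have hpow : 1 ≤ b ^ e := Nat.one_le_pow _ _ (by omega)
  set T := (b * (b ^ e * (8 * H + 24) + 13) + 15) + selTime H b e +
    (3 * (b ^ e * b * (8 * H + 24) + 8) + 11) with hT
  -- Narrowing at either end alone leaves at least three quarters of `M`, so by `cnt_inter`
  -- narrowing at both ends leaves at least half.
  have half : ∀ l' r' : ℕ × ℕ, (∀ σ, Above Q l' σ → Above Q l σ) →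
      (∀ σ, Below Q r' σ → Below Q r σ) →
      3 * M ≤ 4 * cnt Q lo hi H g l' r st (st + b ^ e * b) →
      3 * M ≤ 4 * cnt Q lo hi H g l r' st (st + b ^ e * b) →
      M ≤ 2 * cnt Q lo hi H g l' r' st (st + b ^ e * b) := by
    intro l' r' sl sr hL hR
    have := cnt_inter (lo := lo) (hi := hi) (H := H) (g := g) (a := st)
      (c := st + b ^ e * b) sl sr
    omega
  -- One round either delivers a pivot for the whole frame, or preserves the two three-quarter
  -- conditions and reduces the count by at least `M / (8 b)`.
  have round : ∀ (m : Mem) (l' r' : ℕ × ℕ), SelState m lo hi H fb b g 0 (d + 1) (b ^ e * b) →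
      Frame m (fb + 5 * (d + 1)) st l' r' → Frame m (fb + 5 * d) st₀ l r →
      Small w l' → Small w r' →
      (∀ σ, Above Q l' σ → Above Q l σ) → (∀ σ, Below Q r' σ → Below Q r σ) →
      3 * M ≤ 4 * cnt Q lo hi H g l' r st (st + b ^ e * b) →
      3 * M ≤ 4 * cnt Q lo hi H g l r' st (st + b ^ e * b) →
      ∃ m', Reach P s w searching (searchStep A top test) m m' [] T ∧
        (∀ a, 22 ≤ a → a < fb + 5 * (d + 1) → m' a = m a) ∧
        ((SelState m' lo hi H fb b g 1 (d + 1) (b ^ e * b) ∧ Small w (m' 20, m' 21) ∧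
            Pivot Q lo hi H g l r st (st + b ^ e * b) (m' 20, m' 21)) ∨
          ∃ l₁ r₁, SelState m' lo hi H fb b g 0 (d + 1) (b ^ e * b) ∧
            Frame m' (fb + 5 * (d + 1)) st l₁ r₁ ∧ Small w l₁ ∧ Small w r₁ ∧
            (∀ σ, Above Q l₁ σ → Above Q l σ) ∧ (∀ σ, Below Q r₁ σ → Below Q r σ) ∧
            3 * M ≤ 4 * cnt Q lo hi H g l₁ r st (st + b ^ e * b) ∧
            3 * M ≤ 4 * cnt Q lo hi H g l r₁ st (st + b ^ e * b) ∧
            8 * b * cnt Q lo hi H g l₁ r₁ st (st + b ^ e * b) + M ≤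
              8 * b * cnt Q lo hi H g l' r' st (st + b ^ e * b)) := by
    intro m l' r' hm hF hF₀ hl' hr' sl sr hL hR
    obtain ⟨m₁, c, hcb, hreach₁, hm₁, hF₁, hmax, hf₁⟩ := heavy_reach (P := P) (top := top)
      (test := test) hA hc hm hpow hF (by omega) hl' hr' (by rw [← hcomm]; exact hS)
    have hhalf := half l' r' sl sr hL hR
    have hsum := cnt_mul_le (Q := Q) (lo := lo) (hi := hi) (H := H) (g := g) (l := l') (r := r')
      (a := st) (S := b ^ e) b hmax
    rw [← hcomm] at hsum
    set k := cnt Q lo hi H g l' r' (st + c * b ^ e) (st + c * b ^ e + b ^ e) with hk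
    -- The heaviest part contains at least `M / (2 b)` undecided blocks, so the recursive selection
    -- applies to it.
    have hkpos : 0 < k := by
      rcases Nat.eq_zero_or_pos k with h | h
      · rw [h] at hsum; omega
      · exact h
    have hsub : c * b ^ e + b ^ e ≤ b ^ e * b := by nlinarith
    obtain ⟨m₂, hreach₂, hm₂, ht, hpiv, hf₂⟩ := ih (d + 1) (st + c * b ^ e) l' r' m₁ hm₁ hF₁
      ⟨st, hF.congr fun a _ _ => hf₁ a (by omega) (by omega)⟩ (by omega) hl' hr' (by omega) hkpos
    have hf₂' : ∀ a, 22 ≤ a → a < fb + 5 * (d + 2) → m₂ a = m a := fun a h h' =>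
      (hf₂ a h h').trans (hf₁ a h h')
    obtain ⟨m₃, mode, l₁, r₁, hreach₃, hm₃, hτ, hf₃, hcase⟩ := narrow_reach (P := P) (top := top)
      (test := test) hA hc hm₂ rfl (hF.congr fun a _ _ => hf₂' a (by omega) (by omega))
      (hF₀.congr fun a _ _ => hf₂' a (by omega) (by omega)) (by omega) hl hr ht hS
    set τ := (m₂ 20, m₂ 21) with hτ'
    have hne := hpiv.ne
    have hsubl : ∀ σ, Above Q τ σ → Above Q l' σ := fun σ => hpiv.above.trans hne
    have hsubr : ∀ σ, Below Q τ σ → Below Q r' σ := fun σ => hpiv.below.trans hne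
    refine ⟨m₃, ?_, fun a h h' => (hf₃ a h h').trans (hf₂' a h (by omega)), ?_⟩
    · exact ((hreach₁.trans hreach₂).trans hreach₃).mono (by omega)
    have hpl := hpiv.left_le
    have hpr := hpiv.right_le
    rw [← hk] at hpl hpr
    rcases hcase with ⟨rfl, hF₃, ⟨rfl, rfl, h⟩ | ⟨rfl, rfl, h⟩⟩ | ⟨rfl, h, h'⟩
    · right
      refine ⟨l₁, τ, hm₃, hF₃, hl', ht, sl, fun σ h => sr σ (hsubr σ h), hL, h.le, ?_⟩
      -- In the heavy part at most three quarters of the `k` undecided blocks survive. The whole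
      -- frame loses at least as many as this part does, that is `k / 4 ≥ M / (8 b)`.
      have := cnt_narrow (lo := lo) (hi := hi) (H := H) (g := g) (a := st)
        (c := st + b ^ e * b) (a' := st + c * b ^ e) (c' := st + c * b ^ e + b ^ e) (l := l₁)
        (l' := l₁) (by omega) (by omega) (fun _ => id) hsubr
      rw [← hk] at this
      nlinarith
    · right
      refine ⟨τ, r₁, hm₃, hF₃, ht, hr', fun σ h => sl σ (hsubl σ h), sr, h.le, hR, ?_⟩
      have := cnt_narrow (lo := lo) (hi := hi) (H := H) (g := g) (a := st)
        (c := st + b ^ e * b) (a' := st + c * b ^ e) (c' := st + c * b ^ e + b ^ e) (r := r₁)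
        (r' := r₁) (by omega) (by omega) hsubl (fun _ => id)
      rw [← hk] at this
      nlinarith
    · left
      rw [hτ]
      exact ⟨hm₃, ht, hpiv.fst_lt, sl _ hpiv.above, sr _ hpiv.below, h, h'⟩
  -- The count exceeds `M / 2` by at most `f` units of `M / (8 b)`, and each unsuccessful round uses
  -- up a unit.
  induction f with
  | zero =>
    intro m l' r' hm hF hF₀ hl' hr' sl sr hL hR hΦ
    obtain ⟨m', hreach, hf, ⟨h₁, h₂, h₃⟩ | ⟨l₁, r₁, h₁, h₂, h₃, h₄, h₅, h₆, h₇, h₈, h₉⟩⟩ :=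
      round m l' r' hm hF hF₀ hl' hr' sl sr hL hR
    · exact ⟨m', hreach.mono (by omega), h₁, h₂, h₃, hf⟩
    -- The count was at most `M / 2` already, so a further loss contradicts `half`.
    · have := half l₁ r₁ h₅ h₆ h₇ h₈
      exfalso
      nlinarith
  | succ f ihf =>
    intro m l' r' hm hF hF₀ hl' hr' sl sr hL hR hΦ
    obtain ⟨m', hreach, hf, ⟨h₁, h₂, h₃⟩ | ⟨l₁, r₁, h₁, h₂, h₃, h₄, h₅, h₆, h₇, h₈, h₉⟩⟩ :=
      round m l' r' hm hF hF₀ hl' hr' sl sr hL hR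
    · exact ⟨m', hreach.mono (by nlinarith), h₁, h₂, h₃, hf⟩
    · obtain ⟨m'', hreach', a₁, a₂, a₃, hf'⟩ := ihf m' l₁ r₁ h₁ h₂
        (hF₀.congr fun a _ _ => hf a (by omega) (by omega)) h₃ h₄ h₅ h₆ h₇ h₈ (by nlinarith)
      refine ⟨m'', (hreach.trans hreach').mono (le_of_eq (by ring)), a₁, a₂, a₃, fun a h h' =>
        (hf' a h h').trans (hf a h h')⟩

/-- Selection of a pivot from the blocks of the current stack frame. -/
theorem select_reach {top test : Program} (hA : A.Reads P Q) {lo hi H fb b S : ℕ} {g : ℕ × ℕ}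
    (hc : SelCtx s w lo hi H fb b S) (e : ℕ) :
    ∀ (d st : ℕ) (l r : ℕ × ℕ) (m : Mem),
      SelState m lo hi H fb b g 0 (d + 1) (b ^ e) → Frame m (fb + 5 * (d + 1)) st l r →
      (∃ st₀, Frame m (fb + 5 * d) st₀ l r) → fb + 5 * (d + e + 1) + 10 ≤ s → Small w l →
      Small w r → st + b ^ e ≤ S → 0 < cnt Q lo hi H g l r st (st + b ^ e) →
      ∃ m', Reach P s w searching (searchStep A top test) m m' [] (selTime H b e) ∧
        SelState m' lo hi H fb b g 1 (d + 1) (b ^ e) ∧ Small w (m' 20, m' 21) ∧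
        Pivot Q lo hi H g l r st (st + b ^ e) (m' 20, m' 21) ∧
        ∀ a, 22 ≤ a → a < fb + 5 * (d + 1) → m' a = m a := by
  have hfb := hc.fb_le
  have hH := hc.H_pos
  induction e with
  | zero =>
    intro d st l r m hm hF _ hs hl hr hS hpos
    rw [pow_zero] at hm hS hpos ⊢
    obtain ⟨m', hreach, hm', hτ, hf⟩ := leaf_reach (P := P) (top := top) (test := test) hA hc hm hF
      (by omega) (by omega)
    refine ⟨m', hreach, hm', ?_, ?_, fun a h _ => hf a h⟩
    · have hSw := hc.S_lt
      have hmul : 2 * (st + 1) * H ≤ 2 * (S + 1) * H := Nat.mul_le_mul_right _ (by omega)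
      have hexp : 2 * (st + 1) * H = 2 * st * H + 2 * H := by ring
      have b₁ := le_amax (Higher Q g) (lo + 2 * st * H) (H - 1)
      have b₂ := le_amax (Higher Q g) (lo + 2 * st * H + H)
        (min (lo + 2 * st * H + H + H) (hi + 1) - (lo + 2 * st * H + H) - 1)
      rw [hτ]
      constructor
      · show itemFst Q lo H g st < _
        rw [itemFst]; omega
      · show itemSnd Q lo hi H g st < _
        rw [itemSnd]; omega
    · rw [hτ]; exact pivot_item hpos
  | succ e ih =>
    intro d st l r m hm hF ⟨st₀, hF₀⟩ hs hl hr hS hpos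
    rw [pow_succ] at hm hS hpos ⊢
    -- Initially the count is `M`, which is `4 * b` units of `M / (8 b)` above `M / 2`. The current
    -- bounds are those of the frame below.
    exact select_rounds hA hc ih hs hl hr hS hpos (4 * b) m l r hm hF hF₀ hl hr (fun _ => id)
      (fun _ => id) (by omega) (by omega) (by nlinarith)

end ReadOnly

/-! ### Choosing the size of the search tree, and testing a pivot. -/

namespace ReadOnly

variable {n : ℕ} {P : Fin n → Pt} {s w : ℕ} {A : Access} {Q : ℕ → Pt}

/-- The points `p` and `q`, on either side of the gap before `mid`, are the leftmost and the
rightmost highest point of the range `lo, …, hi` for some slope. -/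
def IsBridge (Q : ℕ → Pt) (lo mid hi p q : ℕ) : Prop :=
  lo ≤ p ∧ p < mid ∧ mid ≤ q ∧ q ≤ hi ∧ ∃ σ, height Q σ p = height Q σ q ∧
    (∀ t, lo ≤ t → t ≤ hi → height Q σ t ≤ height Q σ p) ∧
    (∀ t, lo ≤ t → t < p → height Q σ t < height Q σ p) ∧
    (∀ t, q < t → t ≤ hi → height Q σ t < height Q σ p)

/-- Computes the least power of the number in cell `25` that is at least the number of blocks. -/
def sizeProg : Program :=
  set 17 (.const 1) ;;
  .loop (.ilt (var 17 ⨰ (.const 2 ⨰ var 24)) (.sub (var 23 ∔ .const 1) (var 22)))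
    (set 17 (var 17 ⨰ var 25))

/-- Rounding up to a power of `b` costs at most a factor `b`: the preceding power was too small, or
the exponent is `0` and `H` is at most the length. This keeps the selection time linear in the
length of the range. -/
theorem does_sizeProg {m : Mem} {lo hi H b q : ℕ} (hs : 40 ≤ s) (h22 : m 22 = lo) (h23 : m 23 = hi)
    (h24 : m 24 = H) (h25 : m 25 = b) (hb : 2 ≤ b) (hH : 1 ≤ H) (hHl : H ≤ hi + 1 - lo)
    (hq : hi + 1 - lo ≤ b ^ q) (hw : b * (hi + 1 - lo) < 2 ^ w) :
    Does P s w sizeProg m (2 * q + 2) fun m' => ∃ e ≤ q, m' 17 = b ^ e ∧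
      hi + 1 - lo ≤ b ^ e * (2 * H) ∧ b ^ e * H ≤ b * (hi + 1 - lo) ∧ ∀ a, a ≠ 17 → m' a = m a := by
  classical
  set len := hi + 1 - lo with hlen
  have hex : ∃ e, len ≤ b ^ e * (2 * H) := ⟨q, by nlinarith⟩
  set e₀ := Nat.find hex with he₀
  have hspec : len ≤ b ^ e₀ * (2 * H) := Nat.find_spec hex
  have hmin : ∀ e < e₀, b ^ e * (2 * H) < len := fun e he => by
    have := Nat.find_min hex he
    omega
  have he₀q : e₀ ≤ q := Nat.find_min' hex (by nlinarith)
  have h1w : 1 < 2 ^ w := by nlinarith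
  refine Does.mono (k := 1 + (e₀ * (1 + 1) + 1)) ?_ (by omega) fun _ => id
  refine Does.put_seq (i := 17) (v := 1) rfl rfl (by omega) (by omega) ?_
  refine (Does.loop (k := 1) (fun r m' => (∃ i, i + r = e₀ ∧ m' 17 = b ^ i) ∧
    ∀ a, a ≠ 17 → m' a = m a) ?_ ?_ e₀ _ ?_).mono le_rfl ?_
  · rintro r m' ⟨⟨i, hi', h17⟩, hf⟩
    have h22' := (hf 22 (by omega)).trans h22
    have h23' := (hf 23 (by omega)).trans h23
    have h24' := (hf 24 (by omega)).trans h24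
    have h25' := (hf 25 (by omega)).trans h25
    have hlt := hmin i (by omega)
    refine ⟨?_, ?_⟩
    · simp only [BExp.eval, IExp.eval, h17, h22', h23', h24', ← hlen]
      exact hlt
    · refine Does.put (i := 17) (v := b ^ (i + 1)) rfl
        (by simp only [IExp.eval, h17, h25', pow_succ]) (by omega) ?_
        ⟨⟨i + 1, by omega, by simp⟩, fun a ha => by rw [Function.update_of_ne ha, hf a ha]⟩
      rw [pow_succ]
      nlinarith
  · rintro m' ⟨⟨i, hi', h17⟩, hf⟩
    have h22' := (hf 22 (by omega)).trans h22
    have h23' := (hf 23 (by omega)).trans h23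
    have h24' := (hf 24 (by omega)).trans h24
    obtain rfl : i = e₀ := by omega
    simp only [BExp.eval, IExp.eval, h17, h22', h23', h24', ← hlen]
    omega
  · exact ⟨⟨0, by omega, by simp⟩, fun a ha => Function.update_of_ne ha _ _⟩
  · rintro m' ⟨⟨i, hi', h17⟩, hf⟩
    obtain rfl : i = e₀ := by omega
    refine ⟨e₀, he₀q, h17, hspec, ?_, hf⟩
    rcases Nat.eq_zero_or_pos e₀ with h | h
    · rw [h]; nlinarith
    · obtain ⟨e, he⟩ : ∃ e, e₀ = e + 1 := ⟨e₀ - 1, by omega⟩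
      have := hmin e (by omega)
      rw [he, pow_succ]
      nlinarith

/-- The work space at the bottom of the stack: counts the undecided blocks, and then either starts
the selection of a pivot or doubles the length of the blocks. -/
def topProg (A : Access) : Program :=
  countProg A (.const 0) (var 17) (.load (fr (.const 0) 1)) (.load (fr (.const 0) 2))
    (.load (fr (.const 0) 3)) (.load (fr (.const 0) 4)) ;;
  .cond (.ieq (var 7) (.const 0)) (set 24 (.const 2 ⨰ var 24) ;; sizeProg) (pushProg (.const 0))

/-- Finds the highest points on both sides of the gap before the number in cell `31` with respect
to the slope of the pivot, and decides on which side of the pivot the slope of the bridge lies. -/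
def testProg (A : Access) : Program :=
  set 0 (var 22) ;; set 2 (var 31) ;;
  scan (.rlt (heightE A (var 20) (var 21) (var 1)) (heightE A (var 20) (var 21) (var 0))) ;;
  set 27 (var 1) ;; set 0 (var 31) ;; set 2 (var 23 ∔ .const 1) ;;
  scan (.not (.rlt (heightE A (var 20) (var 21) (var 0)) (heightE A (var 20) (var 21) (var 1)))) ;;
  set 28 (var 1) ;; set 19 (.const 0) ;;
  .cond (.req (heightE A (var 20) (var 21) (var 27)) (heightE A (var 20) (var 21) (var 28)))
    (set 26 (.const 1))
    (.cond (.rlt (heightE A (var 20) (var 21) (var 27)) (heightE A (var 20) (var 21) (var 28)))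
      (.store (fr (.const 0) 1) (var 20) ;; .store (fr (.const 0) 2) (var 21))
      (.store (fr (.const 0) 3) (var 20) ;; .store (fr (.const 0) 4) (var 21)))

/-- The two tangents of slope `τ`, to the left and to the right part, decide. If they are the same
line, it carries the bridge; if the right one is higher, the bridge is steeper than `τ`; otherwise
it is flatter. Taking the first maximum on the left and the last on the right makes the bridge as
long as possible. -/
theorem does_testProg (hA : A.Reads P Q) {m : Mem} {lo mid hi fb st : ℕ} {l r τ : ℕ × ℕ}
    (h22 : m 22 = lo) (h23 : m 23 = hi) (h31 : m 31 = mid) (h29 : m 29 = fb) (hfb : 40 ≤ fb)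
    (hτ : (m 20, m 21) = τ) (h26 : m 26 = 0) (hF : Frame m fb st l r) (hlo : lo < mid)
    (hmid : mid ≤ hi) (hs : fb + 5 ≤ s) (hw : hi + 1 < 2 ^ w) (ht : Small w τ) :
    Does P s w (testProg A) m (4 * (hi + 1 - lo) + 20) fun m' =>
      m' 17 = m 17 ∧ m' 18 = m 18 ∧ m' 19 = 0 ∧ (∀ a, 22 ≤ a → a < 26 → m' a = m a) ∧
      (∀ a, 29 ≤ a → a < fb → m' a = m a) ∧
      ((m' 26 = 1 ∧ IsBridge Q lo mid hi (m' 27) (m' 28)) ∨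
        (m' 26 = 0 ∧ SteeperThan Q lo mid hi τ ∧ Frame m' fb st τ r) ∨
        (m' 26 = 0 ∧ FlatterThan Q lo mid hi τ ∧ Frame m' fb st l τ)) := by
  set σ := slope Q τ with hσ
  have hts : slope Q (m 20, m 21) = σ := by rw [hτ]
  refine Does.mono (k := 1 + (1 + ((4 * (mid - lo) + 3) + (1 + (1 + (1 + ((4 * (hi + 1 - mid) + 3) +
    (1 + (1 + (1 + (1 + (1 + 1))))))))))))  ?_ (by omega) fun _ => id
  refine Does.put_seq (i := 0) (v := lo) rfl (by simp only [IExp.eval, h22]) (by omega)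
    (by omega) ?_
  refine Does.put_seq (i := 2) (v := mid) rfl (by simp [IExp.eval, h31]) (by omega) (by omega) ?_
  set m₁ := Function.update (Function.update m 0 lo) 2 mid with hm₁
  have f₁ : ∀ a, 3 ≤ a → m₁ a = m a := fun a ha => by
    rw [hm₁]; repeat rw [Function.update_of_ne (by omega)]
  have e₀ : m₁ 0 = lo := by simp [hm₁]
  have e₂ : m₁ 2 = mid := by simp [hm₁]
  have ev : ∀ {m' : Mem} (c : ℕ), (∀ a, 20 ≤ a → a ≤ 21 → m' a = m a) →
      (heightE A (var 20) (var 21) (var c)).eval P m' = height Q σ (m' c) := by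
    intro m' c h
    rw [heightE_eval hA]
    simp only [IExp.eval]
    rw [h 20 (by omega) (by omega), h 21 (by omega) (by omega), hts]
  refine Does.seq ((does_scan (gt := fun i b => height Q σ b < height Q σ i) (by omega)
    (fun m' hm' => ?_) (by omega) (by omega)).mono (by omega) ?_)
  · have hh : ∀ a, 20 ≤ a → a ≤ 21 → m' a = m a := fun a h _ =>
      (hm' a (by omega)).trans (f₁ a (by omega))
    simp only [BExp.eval, ev 0 hh, ev 1 hh]
  rintro m₂ ⟨r₂, f₂⟩
  have f₂' : ∀ a, 3 ≤ a → m₂ a = m a := fun a ha => (f₂ a (by omega)).trans (f₁ a ha)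
  rw [e₀, e₂] at r₂
  have b₂ := le_amax (fun i b => height Q σ b < height Q σ i) lo (mid - lo - 1)
  have k₂ := amax_strict (height Q σ) (gt := fun i b => height Q σ b < height Q σ i)
    (fun _ _ => Iff.rfl) lo (mid - lo - 1)
  rw [← r₂] at b₂ k₂
  set p := m₂ 1 with hp
  refine Does.put_seq (i := 27) (v := p) rfl rfl (by omega) (by omega) ?_
  refine Does.put_seq (i := 0) (v := mid) rfl (by simp [IExp.eval, f₂', h31]) (by omega)
    (by omega) ?_
  refine Does.put_seq (i := 2) (v := hi + 1) rfl (by simp [IExp.eval, f₂', h23]) (by omega)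
    (by omega) ?_
  set m₃ := Function.update (Function.update (Function.update m₂ 27 p) 0 mid) 2 (hi + 1) with hm₃
  have f₃ : ∀ a, 3 ≤ a → a ≠ 27 → m₃ a = m a := fun a ha ha' => by
    rw [hm₃, ← f₂' a ha]; repeat rw [Function.update_of_ne (by omega)]
  have q₀ : m₃ 0 = mid := by simp [hm₃]
  have q₂ : m₃ 2 = hi + 1 := by simp [hm₃]
  have q₂₇ : m₃ 27 = p := by simp [hm₃]
  refine Does.seq ((does_scan (gt := fun i b => height Q σ b ≤ height Q σ i) (by omega)
    (fun m' hm' => ?_) (by omega) (by omega)).mono (by omega) ?_)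
  · have hh : ∀ a, 20 ≤ a → a ≤ 21 → m' a = m a := fun a h _ =>
      (hm' a (by omega)).trans (f₃ a (by omega) (by omega))
    simp only [BExp.eval, ev 0 hh, ev 1 hh, not_lt]
  rintro m₄ ⟨r₄, f₄⟩
  have f₄' : ∀ a, 3 ≤ a → a ≠ 27 → m₄ a = m a := fun a ha h =>
    (f₄ a (by omega)).trans (f₃ a ha h)
  rw [q₀, q₂] at r₄
  have b₄ := le_amax (fun i b => height Q σ b ≤ height Q σ i) mid (hi + 1 - mid - 1)
  have k₄ := amax_weak (height Q σ) (gt := fun i b => height Q σ b ≤ height Q σ i)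
    (fun _ _ => Iff.rfl) mid (hi + 1 - mid - 1)
  rw [← r₄] at b₄ k₄
  set q := m₄ 1 with hq
  refine Does.put_seq (i := 28) (v := q) rfl rfl (by omega) (by omega) ?_
  refine Does.put_seq (i := 19) (v := 0) rfl rfl (by omega) (by omega) ?_
  set m₅ := Function.update (Function.update m₄ 28 q) 19 0 with hm₅
  have f₅ : ∀ a, 3 ≤ a → a ≠ 27 → a ≠ 28 → a ≠ 19 → m₅ a = m a := fun a h₁ h₂ h₃ h₄ => by
    rw [hm₅, ← f₄' a h₁ h₂]; repeat rw [Function.update_of_ne (by omega)]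
  have e27 : m₅ 27 = p := by simp [hm₅, f₄, q₂₇]
  have e28 : m₅ 28 = q := by simp [hm₅]
  have e19 : m₅ 19 = 0 := by simp [hm₅]
  have hh₅ : ∀ a, 20 ≤ a → a ≤ 21 → m₅ a = m a := fun a _ _ =>
    f₅ a (by omega) (by omega) (by omega) (by omega)
  have t20 : m₅ 20 = τ.1 := (hh₅ 20 (by omega) (by omega)).trans (congrArg Prod.fst hτ)
  have t21 : m₅ 21 = τ.2 := (hh₅ 21 (by omega) (by omega)).trans (congrArg Prod.snd hτ)
  have t29 : m₅ 29 = fb := (f₅ 29 (by omega) (by omega) (by omega) (by omega)).trans h29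
  have t26 : m₅ 26 = 0 := (f₅ 26 (by omega) (by omega) (by omega) (by omega)).trans h26
  have stores : ∀ c : ℕ, c + 1 < 5 →
      Does P s w (.store (fr (.const 0) c) (var 20) ;; .store (fr (.const 0) (c + 1)) (var 21))
        m₅ (1 + 1) fun m'' =>
        m'' = Function.update (Function.update m₅ (fb + c) τ.1) (fb + (c + 1)) τ.2 := by
    intro c hc
    refine Does.put_seq (i := fb + c) (v := τ.1) (by simp [IExp.eval, t29])
      (by simp only [IExp.eval, t20]) (by omega) ht.1 ?_
    have t : ∀ {a : ℕ}, a < 40 → Function.update m₅ (fb + c) τ.1 a = m₅ a :=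
      fun h => Function.update_of_ne (by omega) _ _
    exact Does.put (i := fb + (c + 1)) (v := τ.2)
      (by simp [IExp.eval, t (show 29 < 40 by omega), t29])
      (by simp only [IExp.eval, t (show 21 < 40 by omega), t21]) (by omega) ht.2 rfl
  have keep : ∀ {c : ℕ} {a : ℕ}, a < fb →
      Function.update (Function.update m₅ (fb + c) τ.1) (fb + (c + 1)) τ.2 a = m₅ a := by
    intro c a ha
    rw [Function.update_of_ne (by omega), Function.update_of_ne (by omega)]
  refine Does.cond (k := 1 + (1 + 1)) (fun hb => ?_) fun hb => ?_
  · simp only [BExp.eval, ev 27 hh₅, ev 28 hh₅, e27, e28] at hb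
    refine (Does.put (i := 26) (v := 1) rfl rfl (by omega) (by omega) ?_).mono (k := 1) (by omega)
      fun _ => id
    refine ⟨?_, ?_, ?_, fun a h h' => ?_, fun a h h' => ?_, .inl ⟨by simp, ?_⟩⟩
    · rw [Function.update_of_ne (by omega), f₅ _ (by omega) (by omega) (by omega) (by omega)]
    · rw [Function.update_of_ne (by omega), f₅ _ (by omega) (by omega) (by omega) (by omega)]
    · rw [Function.update_of_ne (by omega), e19]
    · rw [Function.update_of_ne (by omega), f₅ _ (by omega) (by omega) (by omega) (by omega)]
    · rw [Function.update_of_ne (by omega), f₅ _ (by omega) (by omega) (by omega) (by omega)]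
    · rw [Function.update_of_ne (by omega), Function.update_of_ne (by omega), e27, e28]
      -- The slope of the pivot is the witness for the support line.
      refine ⟨b₂.1, by omega, b₄.1, by omega, σ, hb, fun t h₁ h₂ => ?_, fun t h₁ h₂ => k₂.2 t h₁ h₂,
        fun t h₁ h₂ => ?_⟩
      · by_cases h : t < mid
        · exact k₂.1 t h₁ (by omega)
        · rw [hb]; exact k₄.1 t (by omega) (by omega)
      · rw [hb]; exact k₄.2 t h₁ (by omega)
  · simp only [BExp.eval, ev 27 hh₅, ev 28 hh₅, e27, e28] at hb
    refine Does.cond (k := 1 + 1) (fun hb' => ?_) fun hb' => ?_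
    · simp only [BExp.eval, ev 27 hh₅, ev 28 hh₅, e27, e28] at hb'
      refine (stores 1 (by omega)).mono le_rfl ?_
      rintro m₆ rfl
      refine ⟨?_, ?_, ?_, fun a h h' => ?_, fun a h h' => ?_, .inr (.inl ⟨?_, ?_, ?_⟩)⟩
      · rw [keep (by omega), f₅ _ (by omega) (by omega) (by omega) (by omega)]
      · rw [keep (by omega), f₅ _ (by omega) (by omega) (by omega) (by omega)]
      · rw [keep (by omega), e19]
      · rw [keep (by omega), f₅ _ (by omega) (by omega) (by omega) (by omega)]
      · rw [keep (by omega), f₅ _ (by omega) (by omega) (by omega) (by omega)]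
      · rw [keep (by omega), t26]
      · exact fun _ => ⟨q, b₄.1, by omega, fun t h₁ h₂ => (k₂.1 t h₁ (by omega)).trans_lt hb'⟩
      · refine ⟨?_, ?_, ?_, ?_, ?_⟩
        · repeat rw [Function.update_of_ne (by omega)]
          rw [f₅ _ (by omega) (by omega) (by omega) (by omega), hF.st_eq]
        · rw [Function.update_of_ne (by omega), Function.update_self]
        · rw [Function.update_self]
        · repeat rw [Function.update_of_ne (by omega)]
          rw [f₅ _ (by omega) (by omega) (by omega) (by omega), hF.r_fst]
        · repeat rw [Function.update_of_ne (by omega)]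
          rw [f₅ _ (by omega) (by omega) (by omega) (by omega), hF.r_snd]
    · simp only [BExp.eval, ev 27 hh₅, ev 28 hh₅, e27, e28] at hb'
      have hlt : height Q σ q < height Q σ p := lt_of_le_of_ne (not_lt.1 hb') (Ne.symm hb)
      refine (stores 3 (by omega)).mono le_rfl ?_
      rintro m₆ rfl
      refine ⟨?_, ?_, ?_, fun a h h' => ?_, fun a h h' => ?_, .inr (.inr ⟨?_, ?_, ?_⟩)⟩
      · rw [keep (by omega), f₅ _ (by omega) (by omega) (by omega) (by omega)]
      · rw [keep (by omega), f₅ _ (by omega) (by omega) (by omega) (by omega)]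
      · rw [keep (by omega), e19]
      · rw [keep (by omega), f₅ _ (by omega) (by omega) (by omega) (by omega)]
      · rw [keep (by omega), f₅ _ (by omega) (by omega) (by omega) (by omega)]
      · rw [keep (by omega), t26]
      · exact fun _ => ⟨p, b₂.1, by omega, fun t h₁ h₂ => (k₄.1 t h₁ (by omega)).trans_lt hlt⟩
      · refine ⟨?_, ?_, ?_, ?_, ?_⟩
        · repeat rw [Function.update_of_ne (by omega)]
          rw [f₅ _ (by omega) (by omega) (by omega) (by omega), hF.st_eq]
        · repeat rw [Function.update_of_ne (by omega)]
          rw [f₅ _ (by omega) (by omega) (by omega) (by omega), hF.l_fst]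
        · repeat rw [Function.update_of_ne (by omega)]
          rw [f₅ _ (by omega) (by omega) (by omega) (by omega), hF.l_snd]
        · rw [Function.update_of_ne (by omega), Function.update_self]
        · rw [Function.update_self]

end ReadOnly

/-! ### Convergence of the search for a bridge. -/

namespace ReadOnly

variable {n : ℕ} {P : Fin n → Pt} {s w : ℕ} {A : Access} {Q : ℕ → Pt}

/-- A bound for the time between two moments at which the stack of the search is empty. -/
def roundTime (b q len : ℕ) : ℕ := 500 * (b * b * len * 16 ^ q)

/-- The range `lo, …, hi` to which the search for a bridge is applied. -/
structure RangeCtx (Q : ℕ → Pt) (s w lo hi J fb b q : ℕ) : Prop where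
  mid_le : lo + 2 ^ J ≤ hi
  lt_mid : hi < lo + 2 * 2 ^ J
  sorted : ∀ i j, lo ≤ i → i ≤ j → j ≤ hi → (Q i).1 ≤ (Q j).1
  top_lo : ∀ t, lo ≤ t → t ≤ hi → (Q t).1 = (Q lo).1 → (Q t).2 ≤ (Q lo).2
  top_hi : ∀ t, lo ≤ t → t ≤ hi → (Q t).1 = (Q hi).1 → (Q t).2 ≤ (Q hi).2
  fst_lt : (Q lo).1 < (Q hi).1
  fb_le : 40 ≤ fb
  b_ge : 2 ≤ b
  len_le : hi + 1 - lo ≤ b ^ q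
  fits : fb + 5 * (q + 1) + 10 ≤ s
  s_lt : s < 2 ^ w
  w_ge : 8 * b * (hi + 2) < 2 ^ w

/-- The work space when the stack of the search is empty. -/
structure TopState (Q : ℕ → Pt) (w lo hi J fb b q : ℕ) (m : Mem) (j e : ℕ) (l r : ℕ × ℕ) :
    Prop where
  sel : SelState m lo hi (2 ^ j) fb b l 0 0 (b ^ e)
  frame : ∃ st, Frame m fb st l r
  mid : m 31 = lo + 2 ^ J
  small_l : Small w l
  small_r : Small w r
  j_le : j ≤ J
  e_le : e ≤ q
  size_ge : hi + 1 - lo ≤ b ^ e * (2 * 2 ^ j)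
  size_le : b ^ e * 2 ^ j ≤ b * (hi + 1 - lo)
  blocks : Blocks Q lo hi (2 ^ j) l r
  proper : Proper Q l r
  steeper : SteeperThan Q lo (lo + 2 ^ J) hi l
  flatter : FlatterThan Q lo (lo + 2 ^ J) hi r

variable {lo hi J fb b q : ℕ}

theorem RangeCtx.pow_le (hc : RangeCtx Q s w lo hi J fb b q) {j : ℕ} (hj : j ≤ J) :
    2 ^ j ≤ hi + 1 - lo := by
  have := Nat.pow_le_pow_right (n := 2) (by omega) hj
  have := hc.mid_le
  omega

theorem TopState.selCtx {m : Mem} {j e : ℕ} {l r : ℕ × ℕ} (hc : RangeCtx Q s w lo hi J fb b q)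
    (h : TopState Q w lo hi J fb b q m j e l r) : SelCtx s w lo hi (2 ^ j) fb b (b ^ e) := by
  have hb := hc.b_ge
  have hw := hc.w_ge
  have hm := hc.mid_le
  have hsz := h.size_le
  have hH := hc.pow_le h.j_le
  have hpos : 1 ≤ 2 ^ j := Nat.one_le_two_pow
  have h₁ : b * (hi + 1 - lo) ≤ b * (hi + 1) := Nat.mul_le_mul_left _ (by omega)
  have h₂ : b ^ e ≤ b ^ e * 2 ^ j := Nat.le_mul_of_pos_right _ hpos
  have h₃ : 2 * (b ^ e + 1) * 2 ^ j = 2 * (b ^ e * 2 ^ j) + 2 * 2 ^ j := by ring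
  have h₄ : 8 * b * (hi + 2) = 8 * (b * (hi + 1)) + 8 * b := by ring
  have h₅ : 2 * (hi + 1) ≤ b * (hi + 1) := Nat.mul_le_mul_right _ hb
  exact ⟨hpos, hb, hc.fb_le, by omega, by omega, by omega, hc.s_lt⟩

/-- By `size_le` the number of blocks times their length is at most `b` times the length of the
range. This turns `selTime_le` into a bound that depends on neither `j` nor `e`; the count, the test
and the resizing are absorbed in the remaining 100 of the factor 500. -/
theorem TopState.times {m : Mem} {j e : ℕ} {l r : ℕ × ℕ} (hc : RangeCtx Q s w lo hi J fb b q)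
    (h : TopState Q w lo hi J fb b q m j e l r) :
    selTime (2 ^ j) b e + b ^ e * (8 * 2 ^ j + 24) + 4 * (hi + 1 - lo) + 2 * q + 60 ≤
      roundTime b q (hi + 1 - lo) := by
  have hb := hc.b_ge
  have hm := hc.mid_le
  have hsz := h.size_le
  have hH := hc.pow_le h.j_le
  have hpos : 1 ≤ 2 ^ j := Nat.one_le_two_pow
  have hJ : 1 ≤ 2 ^ J := Nat.one_le_two_pow
  have hsel := selTime_le hpos (by omega : 1 ≤ b) e
  set len := hi + 1 - lo with hlen
  have h16 : 16 ^ e ≤ 16 ^ q := Nat.pow_le_pow_right (by omega) h.e_le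
  have hq : q + 1 ≤ 16 ^ q := Nat.lt_pow_self (by omega)
  set X := b * b * len * 16 ^ q with hX
  have h₁ : 400 * 2 ^ j * b ^ (e + 1) * 16 ^ e ≤ 400 * X := by
    have : 400 * 2 ^ j * b ^ (e + 1) * 16 ^ e = 400 * ((b ^ e * 2 ^ j) * b * 16 ^ e) := by ring
    rw [this, hX]
    refine Nat.mul_le_mul_left _ ?_
    calc b ^ e * 2 ^ j * b * 16 ^ e ≤ (b * len) * b * 16 ^ q := by gcongr
      _ = b * b * len * 16 ^ q := by ring
  have hbl : b * len ≤ X := by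
    have : X = b * len * (b * 16 ^ q) := by rw [hX]; ring
    rw [this]
    exact Nat.le_mul_of_pos_right _ (by positivity)
  have hlen2 : 2 ≤ len := by omega
  have hl : 4 * len ≤ X := by
    have : X = len * (b * b * 16 ^ q) := by rw [hX]; ring
    rw [this, mul_comm 4]
    refine Nat.mul_le_mul_left _ ?_
    nlinarith
  have hqX : 8 * (q + 1) ≤ X := by
    have : X = (b * b * len) * 16 ^ q := hX
    rw [this]
    refine Nat.mul_le_mul ?_ hq
    nlinarith
  have h₂ : b ^ e * (8 * 2 ^ j + 24) ≤ 32 * (b ^ e * 2 ^ j) := by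
    have : b ^ e ≤ b ^ e * 2 ^ j := Nat.le_mul_of_pos_right _ hpos
    have e' : b ^ e * (8 * 2 ^ j + 24) = 8 * (b ^ e * 2 ^ j) + 24 * b ^ e := by ring
    omega
  rw [roundTime, ← hX]
  omega

theorem cnt_eq_zero_iff {H : ℕ} {g l r : ℕ × ℕ} {a c : ℕ} :
    cnt Q lo hi H g l r a c = 0 ↔ ∀ k, a ≤ k → k < c → ¬ Cand Q lo hi H g l r k := by
  classical
  rw [cnt, Finset.card_eq_zero, Finset.filter_eq_empty_iff]
  simp only [Finset.mem_Ico, and_imp]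

/-- What the search for a bridge leaves unchanged. -/
def Keeps (fb : ℕ) (m m' : Mem) : Prop := ∀ a, (a = 30 ∨ 32 ≤ a) → a < fb → m' a = m a

theorem Keeps.trans {m₁ m₂ m₃ : Mem} (h₁ : Keeps fb m₁ m₂) (h₂ : Keeps fb m₂ m₃) :
    Keeps fb m₁ m₃ := fun a h h' => (h₂ a h h').trans (h₁ a h h')

theorem does_topCount (hA : A.Reads P Q) {m : Mem} {j e : ℕ} {l r : ℕ × ℕ}
    (hc : RangeCtx Q s w lo hi J fb b q) (h : TopState Q w lo hi J fb b q m j e l r)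
    {p : Program} {k : ℕ} {R : Mem → Prop}
    (hp : ∀ m', m' 7 = cnt Q lo hi (2 ^ j) l l r 0 (b ^ e) → (∀ a, 12 ≤ a → m' a = m a) →
      Does P s w p m' k R) :
    Does P s w (countProg A (.const 0) (var 17) (.load (fr (.const 0) 1)) (.load (fr (.const 0) 2))
      (.load (fr (.const 0) 3)) (.load (fr (.const 0) 4)) ;; p) m
      ((b ^ e * (8 * 2 ^ j + 24) + 8) + k) R := by
  have hsc := h.selCtx hc
  have hfb := hc.fb_le
  have hfit := hc.fits
  have hS := hsc.S_lt
  obtain ⟨st, hF⟩ := h.frame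
  have v0 : Val n m 12 (.const 0) 0 := fun _ _ => rfl
  refine Does.seq ((does_countProg hA (by omega) h.sel.env hsc.H_pos v0
    (.var (by omega) h.sel.size) (.fr (by omega) h.sel.env.fb_eq hfb v0 hF.l_fst)
    (.fr (by omega) h.sel.env.fb_eq hfb v0 hF.l_snd)
    (.fr (by omega) h.sel.env.fb_eq hfb v0 hF.r_fst)
    (.fr (by omega) h.sel.env.fb_eq hfb v0 hF.r_snd) (by omega) h.small_l.1 h.small_l.2
    h.small_r.1 h.small_r.2 (by omega) hsc.hi_lt).mono (by rw [Nat.sub_zero]) ?_)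
  rintro m' ⟨h₁, h₂⟩
  exact hp m' h₁ h₂

/-- When no block is undecided, the length of the blocks is doubled. -/
theorem top_double_reach (hA : A.Reads P Q) {m : Mem} {j e : ℕ} {l r : ℕ × ℕ}
    (hc : RangeCtx Q s w lo hi J fb b q) (h : TopState Q w lo hi J fb b q m j e l r)
    (h0 : cnt Q lo hi (2 ^ j) l l r 0 (b ^ e) = 0) :
    j < J ∧ ∃ m' e', Reach P s w searching (searchStep A (topProg A) (testProg A)) m m' []
        (roundTime b q (hi + 1 - lo)) ∧
      TopState Q w lo hi J fb b q m' (j + 1) e' l r ∧ Keeps fb m m' := by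
  have hsc := h.selCtx hc
  have hfb := hc.fb_le
  have hb := hc.b_ge
  have hfit := hc.fits
  have hS := hsc.S_lt
  have hH := hsc.H_pos
  have hm := hc.mid_le
  have hw := hc.w_ge
  have htime := h.times hc
  rw [cnt_eq_zero_iff] at h0
  have hpe : 1 ≤ b ^ e := Nat.one_le_pow _ _ (by omega)
  -- At length `2 ^ J` the two halves of block `0` make up the whole range, and by
  -- `Blocks.cand_zero` this block is undecided.
  have hj : j < J := by
    refine lt_of_le_of_ne h.j_le fun hj => ?_
    subst hj
    exact h0 0 le_rfl hpe (h.blocks.cand_zero h.proper hc.sorted hH hc.mid_le hc.lt_mid hc.top_lo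
      hc.top_hi hc.fst_lt h.steeper h.flatter)
  refine ⟨hj, ?_⟩
  have hpj := hc.pow_le (j := j + 1) hj
  have hmul : b * (hi + 1 - lo) ≤ b * (hi + 2) := Nat.mul_le_mul_left _ (by omega)
  have hmul' : 8 * b * (hi + 2) = 8 * (b * (hi + 2)) := by ring
  have h2b : 2 * (hi + 2) ≤ b * (hi + 2) := Nat.mul_le_mul_right _ hb
  have hd : Does P s w (searchStep A (topProg A) (testProg A)) m
      (1 + (1 + ((b ^ e * (8 * 2 ^ j + 24) + 8) + (1 + (1 + (2 * q + 2)))))) fun m' =>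
      ∃ e' ≤ q, m' 17 = b ^ e' ∧ hi + 1 - lo ≤ b ^ e' * (2 * 2 ^ (j + 1)) ∧
        b ^ e' * 2 ^ (j + 1) ≤ b * (hi + 1 - lo) ∧ m' 24 = 2 ^ (j + 1) ∧
        ∀ a, 18 ≤ a → a ≠ 24 → m' a = m a := by
    refine Does.cond (fun _ => Does.cond (fun _ => ?_) fun h' => absurd
      (show _ by simp only [BExp.eval, IExp.eval, h.sel.depth]) h')
      fun h' => absurd (show _ by simp only [BExp.eval, IExp.eval, h.sel.mode_eq]) h'
    refine does_topCount hA hc h fun m₁ h7 f₁ => ?_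
    refine Does.cond (fun _ => ?_) fun h' => absurd
      (show _ by simp only [BExp.eval, IExp.eval, h7]; exact cnt_eq_zero_iff.2 h0) h'
    have e24 : m₁ 24 = 2 ^ j := (f₁ 24 (by omega)).trans h.sel.env.H_eq
    refine Does.put_seq (i := 24) (v := 2 ^ (j + 1)) rfl
      (by simp only [IExp.eval, e24, pow_succ]; omega) (by omega) (by omega) ?_
    set m₂ := Function.update m₁ 24 (2 ^ (j + 1)) with hm₂
    have f₂ : ∀ a, 12 ≤ a → a ≠ 24 → m₂ a = m a := fun a ha ha' => by
      rw [hm₂, Function.update_of_ne ha', f₁ a ha]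
    have e24' : m₂ 24 = 2 ^ (j + 1) := by simp [hm₂]
    refine (does_sizeProg (lo := lo) (hi := hi) (by omega)
      ((f₂ 22 (by omega) (by omega)).trans h.sel.env.lo_eq)
      ((f₂ 23 (by omega) (by omega)).trans h.sel.env.hi_eq) e24'
      ((f₂ 25 (by omega) (by omega)).trans h.sel.base) hb Nat.one_le_two_pow hpj hc.len_le
      (by omega)).mono le_rfl ?_
    rintro m₃ ⟨e', h₁, h₂, h₃, h₄, f₃⟩
    exact ⟨e', h₁, h₂, h₃, h₄, (f₃ 24 (by omega)).trans e24', fun a ha ha' =>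
      (f₃ a (by omega)).trans (f₂ a (by omega) ha')⟩
  obtain ⟨m', hreach, e', h₁, h₂, h₃, h₄, h₅, hf⟩ :=
    Reach.of_does (b := searching) (searching_eval.2 h.sel.running) hd
  refine ⟨m', e', hreach.mono (by omega), ?_, fun a ha _ => hf a (by omega) (by omega)⟩
  have hE := h.sel.env
  refine ⟨⟨⟨?_, ?_, h₅, ?_, hfb, ?_, ?_⟩, ?_, ?_, h₂, ?_, ?_⟩, ?_, ?_, h.small_l, h.small_r, hj, h₁,
    h₃, h₄, ?_, h.proper, h.steeper, h.flatter⟩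
  · exact (hf _ (by omega) (by omega)).trans hE.lo_eq
  · exact (hf _ (by omega) (by omega)).trans hE.hi_eq
  · exact (hf _ (by omega) (by omega)).trans hE.fb_eq
  · exact (hf _ (by omega) (by omega)).trans hE.fst
  · exact (hf _ (by omega) (by omega)).trans hE.snd
  · exact (hf _ (by omega) (by omega)).trans h.sel.mode_eq
  · exact (hf _ (by omega) (by omega)).trans h.sel.depth
  · exact (hf _ (by omega) (by omega)).trans h.sel.base
  · exact (hf _ (by omega) (by omega)).trans h.sel.running
  · obtain ⟨st, hF⟩ := h.frame
    exact ⟨st, hF.congr fun a _ _ => hf a (by omega) (by omega)⟩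
  · exact (hf _ (by omega) (by omega)).trans h.mid
  · rw [pow_succ, mul_comm]
    -- By `size_ge`, every block that has a right half has a number below `b ^ e` and has therefore
    -- been counted.
    refine h.blocks.double hH h.proper hc.sorted fun k hk => h0 k (by omega) ?_
    have := h.size_ge
    have e₁ : 2 * k * 2 ^ j = k * (2 * 2 ^ j) := by ring
    by_contra! hcon
    have := Nat.mul_le_mul_right (2 * 2 ^ j) hcon
    omega

/-- When some blocks are undecided, a pivot is selected and tested. -/
theorem top_pivot_reach (hA : A.Reads P Q) {m : Mem} {j e : ℕ} {l r : ℕ × ℕ}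
    (hc : RangeCtx Q s w lo hi J fb b q) (h : TopState Q w lo hi J fb b q m j e l r)
    (hpos : 0 < cnt Q lo hi (2 ^ j) l l r 0 (b ^ e)) :
    ∃ m', Reach P s w searching (searchStep A (topProg A) (testProg A)) m m' []
        (roundTime b q (hi + 1 - lo)) ∧ Keeps fb m m' ∧
      ((m' 26 = 1 ∧ m' 25 = b ∧ m' 29 = fb ∧ IsBridge Q lo (lo + 2 ^ J) hi (m' 27) (m' 28)) ∨
        ∃ l' r', TopState Q w lo hi J fb b q m' j e l' r' ∧
          4 * cnt Q lo hi (2 ^ j) l' l' r' 0 (b ^ e) ≤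
            3 * cnt Q lo hi (2 ^ j) l l r 0 (b ^ e)) := by
  have hsc := h.selCtx hc
  have hfb := hc.fb_le
  have hb := hc.b_ge
  have hfit := hc.fits
  have hS := hsc.S_lt
  have hH := hsc.H_pos
  have hm := hc.mid_le
  have hsw := hc.s_lt
  have he := h.e_le
  have htime := h.times hc
  obtain ⟨st, hF⟩ := h.frame
  have hd : Does P s w (searchStep A (topProg A) (testProg A)) m
      (1 + (1 + ((b ^ e * (8 * 2 ^ j + 24) + 8) + (1 + 6)))) fun m' =>
      Frame m' (fb + 5 * (0 + 1)) 0 l r ∧ m' 18 = 0 + 1 ∧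
        ∀ a, 12 ≤ a → a ≠ 18 → a < fb + 5 * (0 + 1) → m' a = m a := by
    refine Does.cond (fun _ => Does.cond (fun _ => ?_) fun h' => absurd
      (show _ by simp only [BExp.eval, IExp.eval, h.sel.depth]) h')
      fun h' => absurd (show _ by simp only [BExp.eval, IExp.eval, h.sel.mode_eq]) h'
    refine does_topCount hA hc h fun m₁ h7 f₁ => ?_
    refine Does.cond (fun h' => absurd h' (by simp only [BExp.eval, IExp.eval, h7]; omega))
      fun _ => ?_
    refine (does_pushProg (d := 0) (v := 0) ((f₁ 29 (by omega)).trans h.sel.env.fb_eq) hfb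
      ((f₁ 18 (by omega)).trans h.sel.depth) (hF.congr fun a _ _ => f₁ a (by omega)) rfl
      (by omega) (by omega) h.small_l.1 h.small_l.2 h.small_r.1 h.small_r.2 (by omega)).mono
      le_rfl ?_
    rintro m₂ ⟨h₁, h₂, f₂⟩
    exact ⟨h₁, h₂, fun a ha ha' ha'' => (f₂ a ha' ha'').trans (f₁ a ha)⟩
  obtain ⟨m₁, hreach₁, hF₁, h18, f₁⟩ :=
    Reach.of_does (b := searching) (searching_eval.2 h.sel.running) hd
  have hm₁ : SelState m₁ lo hi (2 ^ j) fb b l 0 (0 + 1) (b ^ e) :=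
    h.sel.of_eq ((f₁ 19 (by omega) (by omega) (by omega)).trans h.sel.mode_eq) h18
      ((f₁ 17 (by omega) (by omega) (by omega)).trans h.sel.size)
      fun a ha ha' => f₁ a (by omega) (by omega) (by omega)
  obtain ⟨m₂, hreach₂, hm₂, ht, hpiv, f₂⟩ := select_reach (P := P) (top := topProg A)
    (test := testProg A) hA hsc e 0 0 l r m₁ hm₁ hF₁
    ⟨st, hF.congr fun a _ _ => f₁ a (by omega) (by omega) (by omega)⟩ (by omega) h.small_l
    h.small_r (by omega) (by rwa [Nat.zero_add])
  rw [Nat.zero_add] at hpiv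
  have f₂' : ∀ a, 22 ≤ a → a < fb + 5 → m₂ a = m a := fun a h h' =>
    (f₂ a h (by omega)).trans (f₁ a (by omega) (by omega) (by omega))
  set τ := (m₂ 20, m₂ 21) with hτ
  have hne := hpiv.ne
  set m₃ := Function.update m₂ 18 0 with hm₃
  have f₃ : ∀ a, a ≠ 18 → m₃ a = m₂ a := fun a ha => Function.update_of_ne ha _ _
  have e18 : m₃ 18 = 0 := by simp [hm₃]
  have htest := does_testProg (P := P) (s := s) (w := w) (m := m₃) (mid := lo + 2 ^ J) (τ := τ)
    (l := l) (r := r) (st := st) (lo := lo) (hi := hi) (fb := fb) hA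
    ((f₃ _ (by omega)).trans hm₂.env.lo_eq) ((f₃ _ (by omega)).trans hm₂.env.hi_eq)
    ((f₃ _ (by omega)).trans ((f₂' _ (by omega) (by omega)).trans h.mid))
    ((f₃ _ (by omega)).trans hm₂.env.fb_eq) hfb
    (by rw [f₃ 20 (by omega), f₃ 21 (by omega)]) ((f₃ _ (by omega)).trans hm₂.running)
    (hF.congr fun a ha ha' => (f₃ a (by omega)).trans (f₂' a (by omega) (by omega)))
    (by have := Nat.one_le_two_pow (n := J); omega) hm (by omega) hsc.hi_lt ht
  have hd' : Does P s w (searchStep A (topProg A) (testProg A)) m₂ (1 + (1 + (1 + _))) _ :=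
    Does.cond (fun h => absurd h (by simp only [BExp.eval, IExp.eval, hm₂.mode_eq]; omega))
      fun _ => Does.put_seq (i := 18) (v := 0) rfl
        (by simp only [IExp.eval, hm₂.depth]) (by omega) (by omega)
        (Does.cond (fun _ => htest)
          fun h => absurd (show _ by simp only [BExp.eval, IExp.eval, Function.update_self]) h)
  obtain ⟨m₄, hreach₄, h17, h18', h19, hf, hf', hcase⟩ :=
    Reach.of_does (b := searching) (searching_eval.2 hm₂.running) hd'
  have k₁ : ∀ a, 22 ≤ a → a < 26 → m₄ a = m a := fun a h h' =>
    (hf a h h').trans ((f₃ a (by omega)).trans (f₂' a h (by omega)))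
  have k₂ : ∀ a, 29 ≤ a → a < fb → m₄ a = m a := fun a h h' =>
    (hf' a h h').trans ((f₃ a (by omega)).trans (f₂' a (by omega) (by omega)))
  have h25 : m₄ 25 = b := (k₁ _ (by omega) (by omega)).trans h.sel.base
  have h29 : m₄ 29 = fb := (k₂ _ (by omega) (by omega)).trans h.sel.env.fb_eq
  have e17 : m₄ 17 = b ^ e := h17.trans ((f₃ _ (by omega)).trans hm₂.size)
  have e18' : m₄ 18 = 0 := h18'.trans e18
  have e22 := (k₁ 22 (by omega) (by omega)).trans h.sel.env.lo_eq
  have e23 := (k₁ 23 (by omega) (by omega)).trans h.sel.env.hi_eq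
  have e24 := (k₁ 24 (by omega) (by omega)).trans h.sel.env.H_eq
  have e31 := (k₂ 31 (by omega) (by omega)).trans h.mid
  -- The counts of the selection use highest points found at the old lower bound, the next round
  -- uses the new one. In resolved blocks these are the same points.
  have cntEq : ∀ l' r' : ℕ × ℕ, Proper Q l' r' → (∀ σ, Above Q l' σ → Above Q l σ) →
      (∀ σ, Below Q r' σ → Below Q r σ) →
      cnt Q lo hi (2 ^ j) l' l' r' 0 (b ^ e) = cnt Q lo hi (2 ^ j) l l' r' 0 (b ^ e) := by
    intro l' r' hp hl hr
    classical
    unfold cnt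
    congr 1
    ext k
    rw [Finset.mem_filter, Finset.mem_filter]
    exact and_congr_right fun _ => cand_iff_of_resolved hH hc.sorted h.blocks h.proper hp hl
      hr l' r'
  refine ⟨m₄, ((hreach₁.trans hreach₂).trans hreach₄).mono (by omega), fun a ha ha' =>
    k₂ a (by omega) ha', ?_⟩
  rcases hcase with ⟨h26, hbr⟩ | ⟨h26, hst, hF₄⟩ | ⟨h26, hfl, hF₄⟩
  · exact .inl ⟨h26, h25, h29, hbr⟩
  · right
    have sl : ∀ σ, Above Q τ σ → Above Q l σ := fun σ => hpiv.above.trans hne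
    have hp : Proper Q τ r := hpiv.below.elim (fun h => .inr (.inl h)) fun h => .inr (.inr h)
    refine ⟨τ, r, ⟨⟨⟨e22, e23, e24, h29, hfb, hF₄.l_fst, hF₄.l_snd⟩, h19, e18', e17, h25, h26⟩,
      ⟨st, hF₄⟩, e31, ht, h.small_r, h.j_le, h.e_le, h.size_ge, h.size_le,
      h.blocks.subset sl fun _ => id, hp, hst, h.flatter⟩, ?_⟩
    rw [cntEq τ r hp sl fun _ => id]
    exact hpiv.right_le
  · right
    have sr : ∀ σ, Below Q τ σ → Below Q r σ := fun σ => hpiv.below.trans hne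
    have hp : Proper Q l τ := hpiv.above.elim (fun h => .inl h) fun h => .inr (.inr h)
    refine ⟨l, τ, ⟨⟨⟨e22, e23, e24, h29, hfb, hF₄.l_fst, hF₄.l_snd⟩, h19, e18', e17, h25, h26⟩,
      ⟨st, hF₄⟩, e31, h.small_l, ht, h.j_le, h.e_le, h.size_ge, h.size_le,
      h.blocks.subset (fun _ => id) sr, hp, h.steeper, hfl⟩, ?_⟩
    exact hpiv.left_le

/-- The search finds the bridge. -/
theorem search_reach (hA : A.Reads P Q) (hc : RangeCtx Q s w lo hi J fb b q) {K : ℕ}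
    (hK : b ^ q * 3 ^ K < 4 ^ K) (i : ℕ) :
    ∀ (k : ℕ) (m : Mem) (j e : ℕ) (l r : ℕ × ℕ), TopState Q w lo hi J fb b q m j e l r →
      j + i = J → cnt Q lo hi (2 ^ j) l l r 0 (b ^ e) * 3 ^ k < 4 ^ k →
      ∃ m', Reach P s w searching (searchStep A (topProg A) (testProg A)) m m' []
          ((i * (K + 1) + k) * roundTime b q (hi + 1 - lo)) ∧ Keeps fb m m' ∧
        m' 26 = 1 ∧ m' 25 = b ∧ m' 29 = fb ∧ IsBridge Q lo (lo + 2 ^ J) hi (m' 27) (m' 28) := by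
  have hb := hc.b_ge
  induction i with
  | zero =>
    intro k
    induction k with
    | zero =>
      intro m j e l r h hj hk
      -- For `k = 0` the assumption says that no block is undecided, which is impossible at the
      -- final block length.
      have := (top_double_reach hA hc h (by simpa using hk)).1
      omega
    | succ k ih =>
      intro m j e l r h hj hk
      rcases Nat.eq_zero_or_pos (cnt Q lo hi (2 ^ j) l l r 0 (b ^ e)) with h0 | h0
      · have := (top_double_reach hA hc h h0).1
        omega
      · obtain ⟨m', hr, hkeep, ⟨h₁, h₂, h₃, h₄⟩ | ⟨l', r', h', hle⟩⟩ := top_pivot_reach hA hc h h0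
        · exact ⟨m', hr.mono (Nat.le_mul_of_pos_left _ (by omega)), hkeep, h₁, h₂, h₃, h₄⟩
        · rw [pow_succ, pow_succ] at hk
          -- The loss of a quarter of the undecided blocks pays for one unit of `k`.
          have hmul := Nat.mul_le_mul_right (3 ^ k) hle
          obtain ⟨m'', hr', hkeep', hrest⟩ := ih m' j e l' r' h' hj (by linarith)
          exact ⟨m'', (hr.trans hr').mono (le_of_eq (by ring)), hkeep.trans hkeep', hrest⟩
  | succ i ihi =>
    have double : ∀ (k : ℕ) (m : Mem) (j e : ℕ) (l r : ℕ × ℕ),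
        TopState Q w lo hi J fb b q m j e l r → j + (i + 1) = J →
        cnt Q lo hi (2 ^ j) l l r 0 (b ^ e) = 0 →
        ∃ m', Reach P s w searching (searchStep A (topProg A) (testProg A)) m m' []
          (((i + 1) * (K + 1) + k) * roundTime b q (hi + 1 - lo)) ∧ Keeps fb m m' ∧
        m' 26 = 1 ∧ m' 25 = b ∧ m' 29 = fb ∧ IsBridge Q lo (lo + 2 ^ J) hi (m' 27) (m' 28) := by
      intro k m j e l r h hj h0
      obtain ⟨-, m', e', hr, h', hkeep⟩ := top_double_reach hA hc h h0
      -- After doubling, the number of undecided blocks can be large again, but at most `b ^ q`, so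
      -- the allowance of `K` pivots is renewed.
      have hle : cnt Q lo hi (2 ^ (j + 1)) l l r 0 (b ^ e') ≤ b ^ q :=
        (cnt_le_sub _ _).trans (by
          rw [Nat.sub_zero]; exact Nat.pow_le_pow_right (by omega) h'.e_le)
      obtain ⟨m'', hr', hkeep', hrest⟩ := ihi K m' (j + 1) e' l r h' (by omega)
        ((Nat.mul_le_mul_right _ hle).trans_lt hK)
      refine ⟨m'', (hr.trans hr').mono ?_, hkeep.trans hkeep', hrest⟩
      have : ((i + 1) * (K + 1) + k) * roundTime b q (hi + 1 - lo) =
          roundTime b q (hi + 1 - lo) + (i * (K + 1) + K) * roundTime b q (hi + 1 - lo) +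
          k * roundTime b q (hi + 1 - lo) := by ring
      omega
    intro k
    induction k with
    | zero =>
      intro m j e l r h hj hk
      exact double 0 m j e l r h hj (by simpa using hk)
    | succ k ih =>
      intro m j e l r h hj hk
      rcases Nat.eq_zero_or_pos (cnt Q lo hi (2 ^ j) l l r 0 (b ^ e)) with h0 | h0
      · exact double _ m j e l r h hj h0
      · obtain ⟨m', hr, hkeep, ⟨h₁, h₂, h₃, h₄⟩ | ⟨l', r', h', hle⟩⟩ := top_pivot_reach hA hc h h0
        · exact ⟨m', hr.mono (Nat.le_mul_of_pos_left _ (by omega)), hkeep, h₁, h₂, h₃, h₄⟩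
        · rw [pow_succ, pow_succ] at hk
          have hmul := Nat.mul_le_mul_right (3 ^ k) hle
          obtain ⟨m'', hr', hkeep', hrest⟩ := ih m' j e l' r' h' hj (by linarith)
          exact ⟨m'', (hr.trans hr').mono (le_of_eq (by ring)), hkeep.trans hkeep', hrest⟩

end ReadOnly

/-! ### The complete program for a bridge. -/

namespace ReadOnly

variable {n : ℕ} {P : Fin n → Pt} {s w : ℕ} {A : Access} {Q : ℕ → Pt} {lo hi J fb b q : ℕ}

/-- Computes the position of the gap over which the bridge is searched. -/
def midProg : Program :=
  set 31 (.const 1) ;;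
  .loop (.ilt (.const 2 ⨰ var 31) (.sub (var 23 ∔ .const 1) (var 22)))
    (set 31 (.const 2 ⨰ var 31)) ;;
  set 31 (var 22 ∔ var 31)

theorem does_midProg {m : Mem} (hs : 40 ≤ s) (h22 : m 22 = lo) (h23 : m 23 = hi)
    (h₁ : lo + 2 ^ J ≤ hi) (h₂ : hi < lo + 2 * 2 ^ J) (hw : hi < 2 ^ w) :
    Does P s w midProg m (2 * J + 3) fun m' =>
      m' 31 = lo + 2 ^ J ∧ ∀ a, a ≠ 31 → m' a = m a := by
  have hJ : 1 ≤ 2 ^ J := Nat.one_le_two_pow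
  refine Does.mono (k := 1 + ((J * (1 + 1) + 1) + 1)) ?_ (by omega) fun _ => id
  refine Does.put_seq (i := 31) (v := 1) rfl rfl (by omega) (by omega) ?_
  refine Does.seq ((Does.loop (k := 1) (fun r m' => (∃ i, i + r = J ∧ m' 31 = 2 ^ i) ∧
    ∀ a, a ≠ 31 → m' a = m a) ?_ ?_ J _ ?_).mono le_rfl ?_)
  · rintro r m' ⟨⟨i, hi', h31⟩, hf⟩
    have h22' := (hf 22 (by omega)).trans h22
    have h23' := (hf 23 (by omega)).trans h23
    have hle : 2 ^ (i + 1) ≤ 2 ^ J := Nat.pow_le_pow_right (by omega) (by omega)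
    have hp : 2 ^ (i + 1) = 2 * 2 ^ i := by rw [pow_succ, mul_comm]
    refine ⟨?_, ?_⟩
    · simp only [BExp.eval, IExp.eval, h31, h22', h23']
      omega
    · exact Does.put (i := 31) (v := 2 ^ (i + 1)) rfl (by simp only [IExp.eval, h31, hp])
        (by omega) (by omega)
        ⟨⟨i + 1, by omega, by simp⟩, fun a ha => by rw [Function.update_of_ne ha, hf a ha]⟩
  · rintro m' ⟨⟨i, hi', h31⟩, hf⟩
    have h22' := (hf 22 (by omega)).trans h22
    have h23' := (hf 23 (by omega)).trans h23
    obtain rfl : i = J := by omega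
    simp only [BExp.eval, IExp.eval, h31, h22', h23']
    omega
  · exact ⟨⟨0, by omega, by simp⟩, fun a ha => Function.update_of_ne ha _ _⟩
  · rintro m' ⟨⟨i, hi', h31⟩, hf⟩
    obtain rfl : i = J := by omega
    have h22' := (hf 22 (by omega)).trans h22
    exact Does.put (i := 31) (v := lo + 2 ^ i) rfl (by simp only [IExp.eval, h31, h22'])
      (by omega) (by omega)
      ⟨by simp, fun a ha => by rw [Function.update_of_ne ha, hf a ha]⟩

/-- Prepares the search for a bridge. -/
def startProg : Program :=
  .store (fr (.const 0) 1) (.const 0) ;; .store (fr (.const 0) 2) (.const 0) ;;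
  .store (fr (.const 0) 3) (.const 0) ;; .store (fr (.const 0) 4) (.const 0) ;;
  set 24 (.const 1) ;; set 18 (.const 0) ;; set 19 (.const 0) ;; set 26 (.const 0)

theorem does_startProg {m : Mem} (h29 : m 29 = fb) (hfb : 40 ≤ fb) (hs : fb + 5 ≤ s)
    (hw : 1 < 2 ^ w) :
    Does P s w startProg m 8 fun m' => Frame m' fb (m fb) (0, 0) (0, 0) ∧ m' 24 = 1 ∧ m' 18 = 0 ∧
      m' 19 = 0 ∧ m' 26 = 0 ∧
      ∀ a, a ≠ 24 → a ≠ 18 → a ≠ 19 → a ≠ 26 → a ≤ fb → m' a = m a := by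
  refine Does.mono (k := 1 + (1 + (1 + (1 + (1 + (1 + (1 + 1))))))) ?_ (by omega) fun _ => id
  have ev : ∀ (m' : Mem) (c : ℕ), m' 29 = m 29 → (fr (.const 0) c).eval n m' = fb + c := by
    intro m' c h
    simp only [IExp.eval, h, h29]; omega
  refine Does.put_seq (i := fb + 1) (v := 0) (ev _ _ rfl) rfl (by omega) (by omega) ?_
  refine Does.put_seq (i := fb + 2) (v := 0) (ev _ _ ?_) rfl (by omega) (by omega) ?_
  · rw [Function.update_of_ne (by omega)]
  refine Does.put_seq (i := fb + 3) (v := 0) (ev _ _ ?_) rfl (by omega) (by omega) ?_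
  · repeat rw [Function.update_of_ne (by omega)]
  refine Does.put_seq (i := fb + 4) (v := 0) (ev _ _ ?_) rfl (by omega) (by omega) ?_
  · repeat rw [Function.update_of_ne (by omega)]
  refine Does.put_seq (i := 24) (v := 1) rfl rfl (by omega) (by omega) ?_
  refine Does.put_seq (i := 18) (v := 0) rfl rfl (by omega) (by omega) ?_
  refine Does.put_seq (i := 19) (v := 0) rfl rfl (by omega) (by omega) ?_
  refine Does.put (i := 26) (v := 0) rfl rfl (by omega) (by omega) ?_
  refine ⟨⟨?_, ?_, ?_, ?_, ?_⟩, by simp, by simp, by simp, by simp, fun a _ _ _ _ _ => ?_⟩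
  all_goals
    simp only [Function.update_apply]
    repeat rw [if_neg (by omega)]
    try rw [if_pos trivial]

/-- Finds the bridge of the range given by the cells `22` and `23`. -/
def bridgeProg (A : Access) : Program :=
  midProg ;; startProg ;; sizeProg ;; .loop searching (searchStep A (topProg A) (testProg A))

/-- A bound for the time to find the bridge of a range of length `len`. -/
def bridgeTime (q len : ℕ) : ℕ := 4 * (q * q + 1) ^ 2 * roundTime (2 ^ q) q len

/-- Because `(4 / 3) ^ 3 = 64 / 27 > 2`, three pivots halve the number of undecided blocks. -/
theorem two_pow_mul_three_pow_lt (t : ℕ) : 2 ^ t * 3 ^ (3 * (t + 1)) < 4 ^ (3 * (t + 1)) := by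
  rw [pow_mul, pow_mul]
  calc 2 ^ t * (3 ^ 3) ^ (t + 1) < 2 ^ (t + 1) * (3 ^ 3) ^ (t + 1) :=
        Nat.mul_lt_mul_of_pos_right (Nat.pow_lt_pow_right (by omega) (by omega)) (by positivity)
    _ = 54 ^ (t + 1) := by rw [← mul_pow]; norm_num
    _ ≤ (4 ^ 3) ^ (t + 1) := Nat.pow_le_pow_left (by omega) _

theorem does_bridgeProg (hA : A.Reads P Q) (hc : RangeCtx Q s w lo hi J fb (2 ^ q) q) {m : Mem}
    (h22 : m 22 = lo) (h23 : m 23 = hi) (h25 : m 25 = 2 ^ q) (h29 : m 29 = fb) :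
    Does P s w (bridgeProg A) m (bridgeTime q (hi + 1 - lo)) fun m' =>
      IsBridge Q lo (lo + 2 ^ J) hi (m' 27) (m' 28) ∧ m' 25 = 2 ^ q ∧ m' 29 = fb ∧
        Keeps fb m m' := by
  have hfb := hc.fb_le
  have hb := hc.b_ge
  have hfit := hc.fits
  have hm := hc.mid_le
  have hw := hc.w_ge
  have hlen := hc.len_le
  have hJ1 : 1 ≤ 2 ^ J := Nat.one_le_two_pow
  have hmul : 2 ^ q * (hi + 1 - lo) ≤ 2 ^ q * (hi + 2) := Nat.mul_le_mul_left _ (by omega)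
  have hmul' : 8 * 2 ^ q * (hi + 2) = 8 * (2 ^ q * (hi + 2)) := by ring
  have h2b : 2 * (hi + 2) ≤ 2 ^ q * (hi + 2) := Nat.mul_le_mul_right _ hb
  -- `2 ^ J` is less than the length of the range, which is at most `2 ^ (q * q)`.
  have hJ : J < q * q := by
    rw [← pow_mul] at hlen
    exact (Nat.pow_lt_pow_iff_right (a := 2) (by omega)).1 (by omega)
  set R := roundTime (2 ^ q) q (hi + 1 - lo) with hR
  have hK := two_pow_mul_three_pow_lt (q * q)
  set K := 3 * (q * q + 1) with hKdef
  have hRge : 2 * J + 2 * q + 16 ≤ R := by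
    have h16 : q + 1 ≤ 16 ^ q := Nat.lt_pow_self (by omega)
    have h16' : q * q + 1 ≤ 16 ^ q := by
      have h4 : q + 1 ≤ 4 ^ q := Nat.lt_pow_self (by omega)
      calc q * q + 1 ≤ (q + 1) * (q + 1) := by nlinarith
        _ ≤ 4 ^ q * 4 ^ q := Nat.mul_le_mul h4 h4
        _ = 16 ^ q := by rw [← mul_pow]; norm_num
    have hX : 16 ^ q ≤ 2 ^ q * 2 ^ q * (hi + 1 - lo) * 16 ^ q :=
      Nat.le_mul_of_pos_left _ (by have : 0 < hi + 1 - lo := by omega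
                                   positivity)
    rw [hR, roundTime]
    omega
  refine Does.mono (k := (2 * J + 3) + (8 + ((2 * q + 2) + ((J * (K + 1) + K) * R + 1)))) ?_ ?_
    fun _ => id
  swap
  · have e₁ : bridgeTime q (hi + 1 - lo) = 4 * (q * q + 1) ^ 2 * R := rfl
    -- Each of fewer than `q * q` block lengths that get doubled needs at most `K` pivots and one
    -- doubling, and the last needs `K` pivots; the preparation counts as one more round.
    have e₂ : (J * (K + 1) + K + 1) * R ≤ 4 * (q * q + 1) ^ 2 * R := by
      refine Nat.mul_le_mul_right _ ?_
      have : J * (K + 1) ≤ (q * q) * (K + 1) := Nat.mul_le_mul_right _ hJ.le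
      rw [hKdef] at this ⊢
      nlinarith
    have e₃ : (J * (K + 1) + K + 1) * R = (J * (K + 1) + K) * R + R := by ring
    omega
  refine Does.seq ((does_midProg (by omega) h22 h23 hm hc.lt_mid (by omega)).mono le_rfl ?_)
  rintro m₁ ⟨h31, f₁⟩
  refine Does.seq ((does_startProg ((f₁ _ (by omega)).trans h29) hfb (by omega)
    (by omega)).mono le_rfl ?_)
  rintro m₂ ⟨hF, h24, h18, h19, h26, f₂⟩
  have f₂' : ∀ a, a ≠ 24 → a ≠ 18 → a ≠ 19 → a ≠ 26 → a ≤ fb → a ≠ 31 → m₂ a = m a :=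
    fun a h₁ h₂ h₃ h₄ h₅ h₆ => (f₂ a h₁ h₂ h₃ h₄ h₅).trans (f₁ a h₆)
  have k22 := (f₂' 22 (by omega) (by omega) (by omega) (by omega) (by omega) (by omega)).trans h22
  have k23 := (f₂' 23 (by omega) (by omega) (by omega) (by omega) (by omega) (by omega)).trans h23
  have k25 := (f₂' 25 (by omega) (by omega) (by omega) (by omega) (by omega) (by omega)).trans h25
  have k29 := (f₂' 29 (by omega) (by omega) (by omega) (by omega) (by omega) (by omega)).trans h29
  have k31 := (f₂ 31 (by omega) (by omega) (by omega) (by omega) (by omega)).trans h31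
  refine Does.seq ((does_sizeProg (by omega) k22 k23 h24 k25 hb le_rfl (by omega) hlen
    (by omega)).mono le_rfl ?_)
  rintro m₃ ⟨e, he, h17, hge, hle, f₃⟩
  have hF₃ : Frame m₃ fb _ (0, 0) (0, 0) := hF.congr fun a _ _ => f₃ a (by omega)
  have hsm : Small w (0, 0) := ⟨by positivity, by positivity⟩
  -- Pairs of equal indices encode infinite bounds, so nothing has to be known about the bridge at
  -- the start, and blocks of single points are resolved.
  have hT : TopState Q w lo hi J fb (2 ^ q) q m₃ 0 e (0, 0) (0, 0) :=
    ⟨⟨⟨(f₃ _ (by omega)).trans k22, (f₃ _ (by omega)).trans k23, (f₃ _ (by omega)).trans h24,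
        (f₃ _ (by omega)).trans k29, hfb, hF₃.l_fst, hF₃.l_snd⟩, (f₃ _ (by omega)).trans h19,
        (f₃ _ (by omega)).trans h18, h17, (f₃ _ (by omega)).trans k25,
        (f₃ _ (by omega)).trans h26⟩,
      ⟨_, hF₃⟩, (f₃ _ (by omega)).trans k31, hsm, hsm, Nat.zero_le _, he, hge, hle, blocks_one,
      .inl rfl, fun h => absurd rfl h, fun h => absurd rfl h⟩
  obtain ⟨m₄, hreach, hkeep, h26', h25', h29', hbr⟩ := search_reach hA hc (K := K)
    (by rwa [← pow_mul]) J K m₃ 0 e _ _ hT (by omega) (by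
      refine (Nat.mul_le_mul_right _ (cnt_le_sub _ _)).trans_lt ?_
      refine (Nat.mul_le_mul_right _ ?_).trans_lt hK
      rw [Nat.sub_zero, ← pow_mul]
      exact Nat.pow_le_pow_right (by omega) (Nat.mul_le_mul_left _ he))
  obtain ⟨k', hk', hrun⟩ := hreach.run (by rw [searching_eval]; omega)
  refine ⟨m₄, k', hrun, hk', hbr, h25', h29', fun a ha ha' => ?_⟩
  exact (hkeep a ha ha').trans ((f₃ a (by omega)).trans (f₂' a (by omega) (by omega) (by omega)
    (by omega) (by omega) (by omega)))

end ReadOnly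

/-! ### Geometry of upper hulls: vertices, edges and paths. -/

namespace ReadOnly

/-- `(u, v)` is an edge of the upper hull of `S`: a line supports `S` from above, and `u` and `v`
are the leftmost and the rightmost point of `S` on it. -/
structure UpperEdge (S : Set Pt) (u v : Pt) : Prop where
  left_mem : u ∈ S
  right_mem : v ∈ S
  lt : u.1 < v.1
  support : ∃ σ : ℝ, u.2 - σ * u.1 = v.2 - σ * v.1 ∧ ∀ p ∈ S, p.2 - σ * p.1 ≤ u.2 - σ * u.1 ∧
    (p.2 - σ * p.1 = u.2 - σ * u.1 → u.1 ≤ p.1 ∧ p.1 ≤ v.1)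

/-- The point `p` of `S` lies above all other points with the same abscissa and above all chords
between points on its left and on its right. -/
structure UpperVertex (S : Set Pt) (p : Pt) : Prop where
  mem : p ∈ S
  top : ∀ c ∈ S, c.1 = p.1 → c.2 ≤ p.2
  above : ∀ c ∈ S, ∀ z ∈ S, c.1 < p.1 → p.1 < z.1 →
    (z.1 - p.1) * c.2 + (p.1 - c.1) * z.2 < (z.1 - c.1) * p.2

variable {S : Set Pt} {u v p c z : Pt}

/-- If `c` and `z` were both on or above a line and `p` on or below it, the chord from `c` to `z`
would pass on or above `p`. -/
theorem UpperVertex.not_chord (h : UpperVertex S p) (hc : c ∈ S) (hz : z ∈ S) (h₁ : c.1 < p.1)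
    (h₂ : p.1 < z.1) {σ k : ℝ} (hp : p.2 - σ * p.1 ≤ k) (hck : k ≤ c.2 - σ * c.1) :
    z.2 - σ * z.1 < k := by
  by_contra! hzk
  have h₃ := h.above c hc z hz h₁ h₂
  have h₄ := mul_le_mul_of_nonneg_left hck (sub_nonneg.2 h₂.le)
  have h₅ := mul_le_mul_of_nonneg_left hzk (sub_nonneg.2 h₁.le)
  have h₆ := mul_le_mul_of_nonneg_left hp (sub_nonneg.2 (h₁.trans h₂).le)
  linarith

/-- A chord over the leftmost point of a support line starts strictly below the line and ends on or
below it, so it passes strictly below that point. -/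
theorem UpperVertex.of_left {σ : ℝ} (hp : p ∈ S) (h : ∀ c ∈ S, c.2 - σ * c.1 ≤ p.2 - σ * p.1)
    (h' : ∀ c ∈ S, c.1 < p.1 → c.2 - σ * c.1 < p.2 - σ * p.1) : UpperVertex S p := by
  refine ⟨hp, fun c hc hcp => ?_, fun c hc z hz h₁ h₂ => ?_⟩
  · have := h c hc
    rw [hcp] at this
    linarith
  · have h₃ := mul_lt_mul_of_pos_left (h' c hc h₁) (sub_pos.2 h₂)
    have h₄ := mul_le_mul_of_nonneg_left (h z hz) (sub_nonneg.2 h₁.le)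
    linarith

theorem UpperVertex.of_right {σ : ℝ} (hp : p ∈ S) (h : ∀ c ∈ S, c.2 - σ * c.1 ≤ p.2 - σ * p.1)
    (h' : ∀ c ∈ S, p.1 < c.1 → c.2 - σ * c.1 < p.2 - σ * p.1) : UpperVertex S p := by
  refine ⟨hp, fun c hc hcp => ?_, fun c hc z hz h₁ h₂ => ?_⟩
  · have := h c hc
    rw [hcp] at this
    linarith
  · have h₃ := mul_lt_mul_of_pos_left (h' z hz h₂) (sub_pos.2 h₁)
    have h₄ := mul_le_mul_of_nonneg_left (h c hc) (sub_nonneg.2 h₂.le)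
    linarith

theorem UpperVertex.eq_of_fst_eq (hu : UpperVertex S u) (hv : UpperVertex S v) (h : u.1 = v.1) :
    u = v :=
  Prod.ext h (le_antisymm (hv.top u hu.mem h) (hu.top v hv.mem h.symm))

section

variable {Q : ℕ → Pt} {n lo mid hi i j : ℕ}

/-- A support line of a range between two vertices is a support line of the whole sequence. -/
theorem support_of_range (hsort : ∀ i j, i ≤ j → j < n → (Q i).1 ≤ (Q j).1) (hn : hi < n)
    (hlo : UpperVertex (Q '' Set.Iio n) (Q lo)) (hhi : UpperVertex (Q '' Set.Iio n) (Q hi))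
    {σ : ℝ} (hi₁ : lo ≤ i) (hij : i ≤ j) (hj₁ : j ≤ hi) (heq : height Q σ i = height Q σ j)
    (hle : ∀ t, lo ≤ t → t ≤ hi → height Q σ t ≤ height Q σ i)
    (hlt : ∀ t, lo ≤ t → t < i → height Q σ t < height Q σ i)
    (hgt : ∀ t, j < t → t ≤ hi → height Q σ t < height Q σ i) (h₁ : (Q lo).1 < (Q j).1)
    (h₂ : (Q i).1 < (Q hi).1) :
    ∀ p ∈ Q '' Set.Iio n, p.2 - σ * p.1 ≤ (Q i).2 - σ * (Q i).1 ∧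
      (p.2 - σ * p.1 = (Q i).2 - σ * (Q i).1 → (Q i).1 ≤ p.1 ∧ p.1 ≤ (Q j).1) := by
  have mem : ∀ t, t < n → Q t ∈ Q '' Set.Iio n := fun t ht => ⟨t, ht, rfl⟩
  rintro _ ⟨t, ht, rfl⟩
  have ht : t < n := ht
  change height Q σ t ≤ height Q σ i ∧ (height Q σ t = height Q σ i → _)
  have sx := hsort lo i (by omega) (by omega)
  have sy := hsort j hi (by omega) (by omega)
  have sij := hsort i j hij (by omega)
  rcases lt_or_ge t lo with htl | htl
  · have hxt := hsort t lo htl.le (by omega)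
    rcases hxt.lt_or_eq with hx | hx
    · have : height Q σ t < height Q σ i := by
        -- A point to the left of `lo` on or above the line would form with `j`, which is on the
        -- line, a chord over `lo`; but the vertex `lo` is on or below the line.
        by_contra! hcon
        have := hlo.not_chord (σ := σ) (k := height Q σ i) (mem t ht) (mem j (by omega)) hx h₁
          (hle lo le_rfl (by omega)) hcon
        exact this.ne heq.symm
      exact ⟨this.le, fun h => absurd h this.ne⟩
    · have h3 : height Q σ t ≤ height Q σ lo := by
        have := hlo.top _ (mem t ht) hx
        simp only [height, hx]
        linarith
      have h4 := hle lo le_rfl (by omega)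
      refine ⟨h3.trans h4, fun h => ?_⟩
      have : ¬ lo < i := fun hl => by linarith [hlt lo le_rfl hl]
      obtain rfl : lo = i := by omega
      exact ⟨hx.ge, hx.le.trans sij⟩
  rcases lt_or_ge hi t with hth | hth
  · have hxt := hsort hi t hth.le (by omega)
    rcases hxt.lt_or_eq with hx | hx
    · have : height Q σ t < height Q σ i :=
        hhi.not_chord (σ := σ) (k := height Q σ i) (mem i (by omega)) (mem t ht) h₂ hx
          (hle hi (by omega) le_rfl) le_rfl
      exact ⟨this.le, fun h => absurd h this.ne⟩
    · have h3 : height Q σ t ≤ height Q σ hi := by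
        have := hhi.top _ (mem t ht) hx.symm
        simp only [height, hx]
        linarith
      have h4 := hle hi (by omega) le_rfl
      refine ⟨h3.trans h4, fun h => ?_⟩
      have : ¬ j < hi := fun hl => by linarith [hgt hi hl le_rfl]
      obtain rfl : j = hi := by omega
      exact ⟨sij.trans hx.le, hx.ge⟩
  · refine ⟨hle t htl hth, fun h => ⟨?_, ?_⟩⟩
    · have : ¬ t < i := fun hl => by linarith [hlt t htl hl]
      exact hsort i t (by omega) ht
    · have : ¬ j < t := fun hl => by linarith [hgt t hl hth]
      exact hsort t j (by omega) (by omega)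

/-- The ends of a bridge are vertices, and the bridge is an edge unless its ends coincide. -/
theorem IsBridge.upper (hsort : ∀ i j, i ≤ j → j < n → (Q i).1 ≤ (Q j).1) (hn : hi < n)
    (hlo : UpperVertex (Q '' Set.Iio n) (Q lo)) (hhi : UpperVertex (Q '' Set.Iio n) (Q hi))
    (h : IsBridge Q lo mid hi i j) :
    UpperVertex (Q '' Set.Iio n) (Q i) ∧ UpperVertex (Q '' Set.Iio n) (Q j) ∧
      ((Q i).1 < (Q j).1 → UpperEdge (Q '' Set.Iio n) (Q i) (Q j)) := by
  obtain ⟨hi₁, hi₂, hj₁, hj₂, σ, heq, hle, hlt, hgt⟩ := h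
  have mem : ∀ t, t < n → Q t ∈ Q '' Set.Iio n := fun t ht => ⟨t, ht, rfl⟩
  have sx := hsort lo i hi₁ (by omega)
  have sy := hsort j hi hj₂ (by omega)
  have sij := hsort i j (by omega) (by omega)
  have eqp : ∀ {s t : ℕ}, UpperVertex (Q '' Set.Iio n) (Q s) → (Q s).1 = (Q t).1 → t < n →
      height Q σ s ≤ height Q σ t → Q t = Q s := by
    intro s t hs hst ht hh
    refine Prod.ext hst.symm (le_antisymm (hs.top _ (mem t ht) hst.symm) ?_)
    simp only [height, hst] at hh
    linarith
  -- The chord argument needs `j` strictly to the right of `lo` and `i` strictly to the left of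
  -- `hi`. Otherwise the bridge lies in the column of `lo` or of `hi`; being highest, both its ends
  -- coincide with that vertex, and it carries no edge.
  by_cases h₁ : (Q lo).1 < (Q j).1
  · by_cases h₂ : (Q i).1 < (Q hi).1
    · have key := support_of_range hsort hn hlo hhi hi₁ (by omega) hj₂ heq hle hlt hgt h₁ h₂
      have heq' : (Q i).2 - σ * (Q i).1 = (Q j).2 - σ * (Q j).1 := heq
      refine ⟨.of_left (σ := σ) (mem i (by omega)) (fun c hc => (key c hc).1) fun c hc hlt =>
        lt_of_le_of_ne (key c hc).1 fun h => ?_, .of_right (σ := σ) (mem j (by omega))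
        (fun c hc => heq' ▸ (key c hc).1) fun c hc hlt =>
        lt_of_le_of_ne (heq' ▸ (key c hc).1) fun h => ?_, fun hij =>
        ⟨mem i (by omega), mem j (by omega), hij, σ, heq, key⟩⟩
      · linarith [((key c hc).2 h).1]
      · linarith [((key c hc).2 (h.trans heq'.symm)).2]
    · have e₁ : (Q hi).1 = (Q i).1 := by linarith
      have e₂ : (Q hi).1 = (Q j).1 := by linarith
      have hh := hle hi (by omega) le_rfl
      rw [eqp hhi e₁ (by omega) hh, eqp hhi e₂ (by omega) (heq ▸ hh)]
      exact ⟨hhi, hhi, fun h => absurd h (lt_irrefl _)⟩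
  · have e₁ : (Q lo).1 = (Q i).1 := by linarith
    have e₂ : (Q lo).1 = (Q j).1 := by linarith
    have hh := hle lo le_rfl (by omega)
    rw [eqp hlo e₁ (by omega) hh, eqp hlo e₂ (by omega) (heq ▸ hh)]
    exact ⟨hlo, hlo, fun h => absurd h (lt_irrefl _)⟩

end

/-- The list of edges is a path. -/
def IsPath : Pt → List (Pt × Pt) → Pt → Prop
  | u, [], v => u = v
  | u, e :: l, v => e.1 = u ∧ IsPath e.2 l v

theorem IsPath.append {l l' : List (Pt × Pt)} (h : IsPath u l v) (h' : IsPath v l' z) :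
    IsPath u (l ++ l') z := by
  induction l generalizing u with
  | nil => obtain rfl : u = v := h; exact h'
  | cons e l ih => exact ⟨h.1, ih h.2⟩

theorem IsPath.isChain {l : List (Pt × Pt)} (h : IsPath u l v) :
    l.IsChain fun e f => e.2 = f.1 := by
  induction l generalizing u with
  | nil => exact .nil
  | cons e l ih =>
    cases l with
    | nil => exact .singleton _
    | cons f l => exact .cons_cons h.2.1.symm (ih h.2)

theorem IsPath.map {l : List (Pt × Pt)} (h : IsPath u l v) (φ : Pt → Pt) :
    IsPath (φ u) (l.map (Prod.map φ φ)) (φ v) := by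
  induction l generalizing u with
  | nil => exact congrArg φ h
  | cons e l ih => exact ⟨congrArg φ h.1, ih h.2⟩

end ReadOnly

/-! ### The walk along the upper hull. -/

namespace ReadOnly

variable {n : ℕ} {P : Fin n → Pt} {s w : ℕ} {A : Access} {Q : ℕ → Pt} {φ : Pt → Pt} {q : ℕ}

/-- The left end of the edge on top of the stack. -/
abbrev topLeft : IExp := .load (.sub (var 29) (.const 2))

/-- The right end of the edge on top of the stack. -/
abbrev topRight : IExp := .load (.sub (var 29) (.const 1))

/-- Reports the edge on top of the stack, and goes on at its right end. -/
def popProg (A : Access) : Program :=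
  .cond (.rlt (A.x topLeft) (A.x topRight)) (.report (A.idx topLeft) (A.idx topRight)) .skip ;;
  set 30 topRight ;; set 29 (.sub (var 29) (.const 2))

/-- Finds the bridge between the current point and the left end of the edge on top of the stack,
and pushes it on the stack. -/
def splitProg (A : Access) : Program :=
  set 22 (var 30) ;; set 23 topLeft ;; bridgeProg A ;;
  .store (var 29) (var 27) ;; .store (var 29 ∔ .const 1) (var 28) ;;
  set 29 (var 29 ∔ .const 2)

/-- The right end of the hull has not been reached. -/
def unfinished (A : Access) : BExp :=
  .not (.and (.req (A.x (var 30)) (A.x topLeft)) (.ieq (var 29) (.const 42)))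

/-- A step along the hull. -/
def hullStep (A : Access) : Program :=
  .cond (.req (A.x (var 30)) (A.x topLeft)) (popProg A) (splitProg A)

/-- The input in `Q` is sorted, and the parameters suffice for it. -/
structure HullCtx (Q : ℕ → Pt) (n s w q : ℕ) : Prop where
  sorted : ∀ i j, i ≤ j → j < n → (Q i).1 ≤ (Q j).1
  q_pos : 1 ≤ q
  n_le : n ≤ (2 ^ q) ^ q
  s_lt : s < 2 ^ w
  w_ge : 8 * 2 ^ q * (n + 2) < 2 ^ w

/-- The points that are reported are the images of those of the sequence `Q` under `φ`. -/
def Access.Reports (A : Access) (P : Fin n → Pt) (Q : ℕ → Pt) (φ : Pt → Pt) : Prop :=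
  ∀ e m, e.eval n m < n → ∃ h : (A.idx e).eval n m < n, P ⟨_, h⟩ = φ (Q (e.eval n m))

theorem run_popProg (hA : A.Reads P Q) (hR : A.Reports P Q φ) {m : Mem} {fb i j : ℕ}
    (h29 : m 29 = fb) (hfb : 42 ≤ fb) (hi : m (fb - 2) = i) (hj : m (fb - 1) = j) (hin : i < n)
    (hjn : j < n) (hs : fb ≤ s) (hsw : s < 2 ^ w) (hnw : n < 2 ^ w)
    (hxy : ¬ (Q i).1 < (Q j).1 → Q i = Q j) :
    ∃ m' o, Run P s w (popProg A) m m' (o.map (Prod.map φ φ)) 4 ∧ m' 30 = j ∧ m' 29 = fb - 2 ∧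
      (∀ a, a ≠ 29 → a ≠ 30 → m' a = m a) ∧ IsPath (Q i) o (Q j) ∧
      ∀ e ∈ o, e = (Q i, Q j) ∧ (Q i).1 < (Q j).1 := by
  have ei : topLeft.eval n m = i := by simp only [IExp.eval, h29, hi]
  have ej : topRight.eval n m = j := by simp only [IExp.eval, h29, hj]
  have hrest : ∃ m', Run P s w (set 30 topRight ;; set 29 (.sub (var 29) (.const 2))) m m' [] 2 ∧
      m' 30 = j ∧ m' 29 = fb - 2 ∧ ∀ a, a ≠ 29 → a ≠ 30 → m' a = m a := by
    refine ⟨_, Run.seq (.store _ _ _ ?_ ?_) (.store _ _ _ ?_ ?_), ?_, ?_, ?_⟩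
    · simp only [IExp.eval]; omega
    · rw [ej]; omega
    · simp only [IExp.eval]; omega
    · simp only [IExp.eval]
      rw [Function.update_of_ne (by omega)]
      omega
    · simp only [IExp.eval, h29, hj]
      rw [Function.update_of_ne (by omega), Function.update_self]
    · simp only [IExp.eval]
      rw [Function.update_self, Function.update_of_ne (by omega), h29]
    · intro a h h'
      simp only [IExp.eval]
      rw [Function.update_of_ne h, Function.update_of_ne h']
  obtain ⟨m', hrun, h30, h29', hf⟩ := hrest
  have hcond : (BExp.rlt (A.x topLeft) (A.x topRight)).eval P m ↔ (Q i).1 < (Q j).1 := by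
    simp only [BExp.eval, hA.x, ei, ej]
  by_cases hlt : (Q i).1 < (Q j).1
  · obtain ⟨hi', ri⟩ := hR topLeft m (by rwa [ei])
    obtain ⟨hj', rj⟩ := hR topRight m (by rwa [ej])
    refine ⟨m', [(Q i, Q j)], ?_, h30, h29', hf, ⟨rfl, rfl⟩, fun e he => ?_⟩
    · have := Run.seq (Run.cond_true (q := .skip) (hcond.2 hlt) (Run.report _ _ _ hi' hj')) hrun
      rw [ri, rj, ei, ej] at this
      simpa [popProg] using this
    · exact ⟨by simpa using he, hlt⟩
  · refine ⟨m', [], ?_, h30, h29', hf, hxy hlt, fun e he => absurd he (by simp)⟩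
    simpa [popProg] using Run.seq (Run.cond_false (p := .report (A.idx topLeft) (A.idx topRight))
      (fun h => hlt (hcond.1 h)) (Run.skip m)) hrun

/-- The factor in the bound for the time to find a bridge. -/
def bridgeFactor (q : ℕ) : ℕ := 2000 * ((q * q + 1) ^ 2 * 64 ^ q)

/-- The bound is linear in the length, so it is superadditive over disjoint subranges; this is what
the recursion of the hull needs. -/
theorem bridgeTime_eq (q len : ℕ) : bridgeTime q len = bridgeFactor q * len := by
  have : (64 : ℕ) ^ q = 2 ^ q * 2 ^ q * 16 ^ q := by rw [← mul_pow, ← mul_pow]; norm_num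
  rw [bridgeTime, bridgeFactor, roundTime, this]
  ring

/-- Cell `29` is both the top of the stack of pending edges and the base of the stack frames of the
search. The search works above the pending edges, and the new bridge overwrites its frames. -/
theorem does_splitProg (hA : A.Reads P Q) (hc : HullCtx Q n s w q) {m : Mem} {fb v p : ℕ}
    (h30 : m 30 = v) (h25 : m 25 = 2 ^ q) (h29 : m 29 = fb) (hfb : 42 ≤ fb) (hp : m (fb - 2) = p)
    (hs : fb + 2 + 5 * (q + 1) + 10 ≤ s) (hpn : p < n)
    (hV : UpperVertex (Q '' Set.Iio n) (Q v)) (hW : UpperVertex (Q '' Set.Iio n) (Q p))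
    (hx : (Q v).1 < (Q p).1) {J : ℕ} (h₁ : v + 2 ^ J ≤ p) (h₂ : p < v + 2 * 2 ^ J) :
    Does P s w (splitProg A) m (bridgeFactor q * (p + 1 - v) + 5) fun m' =>
      ∃ i j, IsBridge Q v (v + 2 ^ J) p i j ∧ m' fb = i ∧ m' (fb + 1) = j ∧ m' 30 = v ∧
        m' 25 = 2 ^ q ∧ m' 29 = fb + 2 ∧ ∀ a, 32 ≤ a → a < fb → m' a = m a := by
  have hsw := hc.s_lt
  have hw := hc.w_ge
  have hq := hc.q_pos
  have h2q : 2 ^ 1 ≤ 2 ^ q := Nat.pow_le_pow_right (by omega) hq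
  have hb : 8 * 2 ^ q * (p + 2) ≤ 8 * 2 ^ q * (n + 2) := Nat.mul_le_mul_left _ (by omega)
  have hb' : 2 * (n + 2) ≤ 8 * 2 ^ q * (n + 2) := Nat.mul_le_mul_right _ (by omega)
  have hJ : 1 ≤ 2 ^ J := Nat.one_le_two_pow
  have hctx : RangeCtx Q s w v p J fb (2 ^ q) q :=
    ⟨h₁, h₂, fun i j _ h h' => hc.sorted i j h (by omega),
      fun t _ ht h => hV.top _ ⟨t, by simp; omega, rfl⟩ h,
      fun t _ ht h => hW.top _ ⟨t, by simp; omega, rfl⟩ h, hx, by omega, by omega,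
      le_trans (by omega) hc.n_le, by omega, hsw, by omega⟩
  refine Does.mono (k := 1 + (1 + (bridgeTime q (p + 1 - v) + (1 + (1 + 1))))) ?_
    (by rw [bridgeTime_eq]; omega) fun _ => id
  refine Does.put_seq (i := 22) (v := v) rfl (by simp only [IExp.eval, h30]) (by omega)
    (by omega) ?_
  refine Does.put_seq (i := 23) (v := p) rfl ?_ (by omega) (by omega) ?_
  · simp only [IExp.eval]
    have h29' : Function.update m 22 v 29 = fb := by rw [Function.update_of_ne (by omega), h29]
    rw [h29', Function.update_of_ne (by omega), hp]
  set m₁ := Function.update (Function.update m 22 v) 23 p with hm₁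
  have f₁ : ∀ a, a ≠ 22 → a ≠ 23 → m₁ a = m a := fun a h h' => by
    rw [hm₁, Function.update_of_ne h', Function.update_of_ne h]
  refine Does.seq ((does_bridgeProg hA hctx (m := m₁) (by simp [hm₁]) (by simp [hm₁])
    ((f₁ _ (by omega) (by omega)).trans h25) ((f₁ _ (by omega) (by omega)).trans h29)).mono le_rfl ?_)
  rintro m₂ ⟨hbr, k25, k29, hkeep⟩
  obtain ⟨b₁, b₂, b₃, b₄, -⟩ := id hbr
  refine Does.put_seq (i := fb) (v := m₂ 27) (by simp only [IExp.eval, k29]) rfl (by omega)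
    (by omega) ?_
  refine Does.put_seq (i := fb + 1) (v := m₂ 28) ?_ ?_ (by omega) (by omega) ?_
  · simp only [IExp.eval]
    rw [Function.update_of_ne (by omega), k29]
  · simp only [IExp.eval]
    rw [Function.update_of_ne (by omega)]
  refine Does.put (i := 29) (v := fb + 2) rfl ?_ (by omega) (by omega) ?_
  · simp only [IExp.eval]
    rw [Function.update_of_ne (by omega), Function.update_of_ne (by omega), k29]
  refine ⟨m₂ 27, m₂ 28, hbr, ?_, ?_, ?_, ?_, ?_, fun a h h' => ?_⟩
  · rw [Function.update_of_ne (by omega), Function.update_of_ne (by omega), Function.update_self]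
  · rw [Function.update_of_ne (by omega), Function.update_self]
  · repeat rw [Function.update_of_ne (by omega)]
    exact (hkeep 30 (by omega) (by omega)).trans ((f₁ _ (by omega) (by omega)).trans h30)
  · repeat rw [Function.update_of_ne (by omega)]
    exact k25
  · rw [Function.update_self]
  · repeat rw [Function.update_of_ne (by omega)]
    exact (hkeep a (by omega) (by omega)).trans (f₁ _ (by omega) (by omega))

/-- The edges of the hull from the current point to the left end of the edge on top of the stack
are reported. -/
theorem hull_reach (hA : A.Reads P Q) (hR : A.Reports P Q φ) (hc : HullCtx Q n s w q) (J : ℕ) :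
    ∀ (m : Mem) (fb v p : ℕ), m 30 = v → m 25 = 2 ^ q → m 29 = fb → 42 ≤ fb → m (fb - 2) = p →
      fb + 2 * J + 5 * (q + 1) + 10 ≤ s → v ≤ p → p < n → p + 1 - v ≤ 2 ^ J →
      UpperVertex (Q '' Set.Iio n) (Q v) → UpperVertex (Q '' Set.Iio n) (Q p) →
      ∃ m' o, Reach P s w (unfinished A) (hullStep A) m m' (o.map (Prod.map φ φ))
          (J * ((bridgeFactor q + 13) * (p + 1 - v))) ∧ m' 30 < n ∧ Q (m' 30) = Q p ∧
        m' 25 = 2 ^ q ∧ m' 29 = fb ∧ (∀ a, 32 ≤ a → a < fb → m' a = m a) ∧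
        IsPath (Q v) o (Q p) ∧ ∀ e ∈ o, UpperEdge (Q '' Set.Iio n) e.1 e.2 := by
  have hsw := hc.s_lt
  have hw := hc.w_ge
  have h2q := Nat.one_le_two_pow (n := q)
  have hb' : (n + 2) ≤ 8 * 2 ^ q * (n + 2) := Nat.le_mul_of_pos_left _ (by positivity)
  have guard : ∀ {m : Mem} {fb v p : ℕ}, m 30 = v → m 29 = fb → m (fb - 2) = p →
      ((BExp.req (A.x (var 30)) (A.x topLeft)).eval P m ↔ (Q v).1 = (Q p).1) := by
    intro m fb v p h30 h29 hp
    simp only [BExp.eval, hA.x, IExp.eval, h30, h29, hp]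
  induction J with
  | zero =>
    intro m fb v p h30 h25 h29 hfb hp hs hvp hpn hlen hV hW
    obtain rfl : p = v := by rw [pow_zero] at hlen; omega
    exact ⟨m, [], (Reach.refl m).mono (by omega), by omega, by rw [h30], h25, h29,
      fun _ _ _ => rfl, rfl, fun e he => absurd he (by simp)⟩
  | succ J ih =>
    intro m fb v p h30 h25 h29 hfb hp hs hvp hpn hlen hV hW
    by_cases hx : (Q v).1 = (Q p).1
    · have hQ := hV.eq_of_fst_eq hW hx
      exact ⟨m, [], (Reach.refl m).mono (by omega), by omega, by rw [h30, hQ], h25, h29,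
        fun _ _ _ => rfl, hQ, fun e he => absurd he (by simp)⟩
    have hlt : (Q v).1 < (Q p).1 := lt_of_le_of_ne (hc.sorted v p hvp hpn) hx
    have hne : v ≠ p := fun h => hx (by rw [h])
    -- Cutting after `2 ^ J₀` points leaves at most `2 ^ J₀ ≤ 2 ^ J` points on either side.
    set J₀ := Nat.log 2 (p - v) with hJ₀
    have l₁ : 2 ^ J₀ ≤ p - v := Nat.pow_log_le_self 2 (by omega)
    have l₂ : p - v < 2 ^ (J₀ + 1) := Nat.lt_pow_succ_log_self (by omega) _
    have l₃ : J₀ < J + 1 := (Nat.pow_lt_pow_iff_right (a := 2) (by omega)).1 (by omega)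
    have l₄ : 2 ^ J₀ ≤ 2 ^ J := Nat.pow_le_pow_right (by omega) (by omega)
    rw [pow_succ] at l₂
    have hd : Does P s w (hullStep A) m (1 + (bridgeFactor q * (p + 1 - v) + 5)) _ :=
      Does.cond (fun h => absurd ((guard h30 h29 hp).1 h) hx) fun _ =>
        does_splitProg hA hc h30 h25 h29 hfb hp (by omega) hpn hV hW hlt (J := J₀) (by omega)
          (by omega)
    obtain ⟨m₁, hreach₁, i, j, hbr, hi, hj, k30, k25, k29, f₁⟩ :=
      Reach.of_does (b := unfinished A) (fun h => hx ((guard h30 h29 hp).1 h.1)) hd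
    obtain ⟨b₁, b₂, b₃, b₄, -⟩ := id hbr
    obtain ⟨hVi, hVj, hE⟩ := hbr.upper hc.sorted hpn hV hW
    -- The bridge just pushed makes `i` the target of the walk through the left part.
    obtain ⟨m₂, o₂, hreach₂, g30, gQ, g25, g29, f₂, path₂, edges₂⟩ := ih m₁ (fb + 2) v i k30 k25
      k29 (by omega) hi (by omega) (by omega) (by omega) (by omega) hV hVi
    obtain ⟨m₃, o₃, hrun, r30, r29, f₃, path₃, edges₃⟩ := run_popProg (P := P) (s := s) (w := w) hA hR
      (m := m₂) (i := i) (j := j) g29 (by omega) ((f₂ fb (by omega) (by omega)).trans hi)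
      ((f₂ (fb + 1) (by omega) (by omega)).trans hj) (by omega) (by omega) (by omega) hsw (by omega)
      fun h => hVi.eq_of_fst_eq hVj (le_antisymm (hc.sorted i j (by omega) (by omega)) (not_lt.1 h))
    -- The walk may have arrived with an index other than `i`, but at the same point, so the test on
    -- abscissas leads to the pop.
    have hreach₃ : Reach P s w (unfinished A) (hullStep A) m₂ m₃ (o₃.map (Prod.map φ φ))
        (1 + 4 + 1) := by
      refine Reach.step ?_ (.cond_true ((guard rfl g29
        ((f₂ fb (by omega) (by omega)).trans hi)).2 (by rw [gQ])) hrun)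
      simp only [unfinished, BExp.eval, IExp.eval, g29]
      omega
    obtain ⟨m₄, o₄, hreach₄, q30, qQ, q25, q29, f₄, path₄, edges₄⟩ := ih m₃ fb j p r30
      ((f₃ _ (by omega) (by omega)).trans g25) (by rw [r29]; omega) hfb
      ((f₃ _ (by omega) (by omega)).trans ((f₂ _ (by omega) (by omega)).trans
        ((f₁ _ (by omega) (by omega)).trans hp))) (by omega) (by omega) hpn (by omega) hVj hW
    refine ⟨m₄, o₂ ++ (o₃ ++ o₄), ?_, q30, qQ, q25, q29, fun a h h' => ?_,
      path₂.append (path₃.append path₄), fun e he => ?_⟩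
    · have := (hreach₁.trans (hreach₂.trans (hreach₃.trans hreach₄)))
      rw [List.map_append, List.map_append]
      refine Reach.mono (by simpa using this) ?_
      set F := bridgeFactor q + 13 with hF
      -- The parts up to `i` and from `j` are disjoint. The summand 13 in `F` pays for the overhead
      -- of the split (7 steps) and for the pop (6 steps).
      have t₁ : F * (i + 1 - v) + F * (p + 1 - j) ≤ F * (p + 1 - v) := by
        rw [← mul_add]
        exact Nat.mul_le_mul_left _ (by omega)
      have t₂ := Nat.mul_le_mul_left J t₁
      rw [mul_add] at t₂
      have t₃ : F * (p + 1 - v) = bridgeFactor q * (p + 1 - v) + 13 * (p + 1 - v) := by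
        rw [hF, add_mul]
      have t₄ : (J + 1) * (F * (p + 1 - v)) = J * (F * (p + 1 - v)) + F * (p + 1 - v) := by ring
      omega
    · exact (f₄ a h h').trans ((f₃ a (by omega) (by omega)).trans ((f₂ a h (by omega)).trans
        (f₁ a h h')))
    · simp only [List.mem_append] at he
      rcases he with he | he | he
      · exact edges₂ e he
      · obtain ⟨rfl, h⟩ := edges₃ e he
        exact hE h
      · exact edges₄ e he

end ReadOnly

/-! ### Ends of the hull, the branching number, and the whole program. -/

namespace ReadOnly

/-- `u` is the highest among the leftmost points of `S`. -/
def IsFirst (S : Set Pt) (u : Pt) : Prop :=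
  u ∈ S ∧ ∀ p ∈ S, u.1 < p.1 ∨ u.1 = p.1 ∧ p.2 ≤ u.2

/-- `u` is the highest among the rightmost points of `S`. -/
def IsLast (S : Set Pt) (u : Pt) : Prop :=
  u ∈ S ∧ ∀ p ∈ S, p.1 < u.1 ∨ p.1 = u.1 ∧ p.2 ≤ u.2

theorem IsFirst.fst_le {S : Set Pt} {u p : Pt} (h : IsFirst S u) (hp : p ∈ S) : u.1 ≤ p.1 :=
  (h.2 p hp).elim le_of_lt fun h => h.1.le

theorem IsLast.fst_le {S : Set Pt} {u p : Pt} (h : IsLast S u) (hp : p ∈ S) : p.1 ≤ u.1 :=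
  (h.2 p hp).elim le_of_lt fun h => h.1.le

theorem IsFirst.upperVertex {S : Set Pt} {u : Pt} (h : IsFirst S u) : UpperVertex S u :=
  ⟨h.1, fun c hc hcu => (h.2 c hc).elim (fun h => absurd h (by rw [hcu]; exact lt_irrefl _))
    fun h => h.2, fun _ hc _ _ h₁ => absurd (h.fst_le hc) (not_le.2 h₁)⟩

theorem IsLast.upperVertex {S : Set Pt} {u : Pt} (h : IsLast S u) : UpperVertex S u :=
  ⟨h.1, fun c hc hcu => (h.2 c hc).elim (fun h => absurd h (by rw [hcu]; exact lt_irrefl _))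
    fun h => h.2, fun _ _ _ hz _ h₂ => absurd (h.fst_le hz) (not_le.2 h₂)⟩

variable {n : ℕ} {P : Fin n → Pt} {s w : ℕ} {A : Access} {Q : ℕ → Pt} {φ : Pt → Pt} {q : ℕ}

/-- The point in cell `0` comes before the one in cell `1` at the left end. -/
def leftTest (A : Access) : BExp :=
  .or (.rlt (A.x (var 0)) (A.x (var 1)))
    (.and (.req (A.x (var 1)) (A.x (var 0))) (.rlt (A.y (var 1)) (A.y (var 0))))

/-- The point in cell `0` comes after the one in cell `1` at the right end. -/
def rightTest (A : Access) : BExp :=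
  .or (.rlt (A.x (var 1)) (A.x (var 0)))
    (.and (.req (A.x (var 1)) (A.x (var 0))) (.rlt (A.y (var 1)) (A.y (var 0))))

/-- Finds the ends of the upper hull. -/
def initProg (A : Access) : Program :=
  set 0 (.const 0) ;; set 2 .len ;; scan (leftTest A) ;; set 30 (var 1) ;;
  set 0 (.const 0) ;; scan (rightTest A) ;; set 40 (var 1) ;; set 29 (.const 42)

/-- The ends are the lexicographic maxima of `(-x, y)` and `(x, y)`. Cell `40` is the one `topLeft`
reads when cell `29` holds `42`, so the right end is the sentinel of the empty stack of edges. -/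
theorem does_initProg (hA : A.Reads P Q) (hsort : ∀ i j, i ≤ j → j < n → (Q i).1 ≤ (Q j).1)
    (hn : 1 ≤ n) (hs : 42 ≤ s) (hsw : s < 2 ^ w) (hnw : n < 2 ^ w) (m : Mem) :
    Does P s w (initProg A) m (8 * n + 12) fun m' => m' 30 ≤ m' 40 ∧ m' 40 < n ∧
      IsFirst (Q '' Set.Iio n) (Q (m' 30)) ∧ IsLast (Q '' Set.Iio n) (Q (m' 40)) ∧ m' 29 = 42 ∧
      ∀ a, a = 25 ∨ (32 ≤ a ∧ a < 40) → m' a = m a := by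
  set κ : ℕ → ℝ ×ₗ ℝ := fun t => toLex (-(Q t).1, (Q t).2) with hκ
  set μ : ℕ → ℝ ×ₗ ℝ := fun t => toLex ((Q t).1, (Q t).2) with hμ
  obtain ⟨hv₁, hv₂⟩ := amax_strict κ (gt := fun i b => κ b < κ i) (fun _ _ => Iff.rfl) 0 (n - 1)
  obtain ⟨hp₁, -⟩ := amax_strict μ (gt := fun i b => μ b < μ i) (fun _ _ => Iff.rfl) 0 (n - 1)
  have bv := le_amax (fun i b => κ b < κ i) 0 (n - 1)
  have bp := le_amax (fun i b => μ b < μ i) 0 (n - 1)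
  set v := amax (fun i b => κ b < κ i) 0 (n - 1) with hv
  set p := amax (fun i b => μ b < μ i) 0 (n - 1) with hp
  -- Were `p` before `v`, then by sortedness they would share a column. There `v`, as a first
  -- maximum, would be strictly higher than `p`, which is itself highest.
  have hvp : v ≤ p := by
    by_contra! hcon
    have h₁ := hv₂ p (by omega) hcon
    have h₂ := hp₁ v (by omega) (by omega)
    have h₃ := hsort p v hcon.le (by omega)
    rw [hκ, Prod.Lex.toLex_lt_toLex] at h₁
    rw [hμ, Prod.Lex.toLex_le_toLex] at h₂
    dsimp only at h₁ h₂
    rcases h₁ with h₁ | ⟨h₁, h₁'⟩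
    · linarith
    · rcases h₂ with h₂ | ⟨h₂, h₂'⟩ <;> linarith
  have hfirst : IsFirst (Q '' Set.Iio n) (Q v) := by
    refine ⟨⟨v, by simp; omega, rfl⟩, ?_⟩
    rintro _ ⟨t, ht, rfl⟩
    have ht : t < n := ht
    have := hv₁ t (by omega) (by omega)
    rw [hκ, Prod.Lex.toLex_le_toLex] at this
    dsimp only at this
    rcases this with h | ⟨h, h'⟩
    · exact .inl (by linarith)
    · exact .inr ⟨by linarith, h'⟩
  have hlast : IsLast (Q '' Set.Iio n) (Q p) := by
    refine ⟨⟨p, by simp; omega, rfl⟩, ?_⟩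
    rintro _ ⟨t, ht, rfl⟩
    have ht : t < n := ht
    have := hp₁ t (by omega) (by omega)
    rwa [hμ, Prod.Lex.toLex_le_toLex] at this
  have el : ∀ m' : Mem, (leftTest A).eval P m' ↔ κ (m' 1) < κ (m' 0) := by
    intro m'
    rw [leftTest, BExp.or_eval, hκ, Prod.Lex.toLex_lt_toLex]
    simp only [BExp.eval, hA.x, hA.y, IExp.eval, neg_lt_neg_iff, neg_inj]
  have er : ∀ m' : Mem, (rightTest A).eval P m' ↔ μ (m' 1) < μ (m' 0) := by
    intro m'
    rw [rightTest, BExp.or_eval, hμ, Prod.Lex.toLex_lt_toLex]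
    simp only [BExp.eval, hA.x, hA.y, IExp.eval]
  refine Does.mono (k := 1 + (1 + ((4 * n + 3) + (1 + (1 + ((4 * n + 3) + (1 + 1))))))) ?_
    (by omega) fun _ => id
  refine Does.put_seq (i := 0) (v := 0) rfl rfl (by omega) (by omega) ?_
  refine Does.put_seq (i := 2) (v := n) rfl rfl (by omega) (by omega) ?_
  set m₁ := Function.update (Function.update m 0 0) 2 n with hm₁
  have e₀ : m₁ 0 = 0 := by simp [hm₁]
  have e₂ : m₁ 2 = n := by simp [hm₁]
  refine Does.seq ((does_scan (gt := fun i b => κ b < κ i) (by omega) (fun m' _ => el m')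
    (by omega) (by omega)).mono (by omega) ?_)
  rintro m₂ ⟨r₂, f₂⟩
  rw [e₀, e₂, Nat.sub_zero, ← hv] at r₂
  refine Does.put_seq (i := 30) (v := v) rfl (by simp only [IExp.eval, r₂]) (by omega) (by omega) ?_
  refine Does.put_seq (i := 0) (v := 0) rfl rfl (by omega) (by omega) ?_
  set m₃ := Function.update (Function.update m₂ 30 v) 0 0 with hm₃
  have e₀' : m₃ 0 = 0 := by simp [hm₃]
  have e₂' : m₃ 2 = n := by
    rw [hm₃, Function.update_of_ne (by omega), Function.update_of_ne (by omega), f₂ 2 le_rfl, e₂]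
  have e₃₀ : m₃ 30 = v := by simp [hm₃]
  refine Does.seq ((does_scan (gt := fun i b => μ b < μ i) (by omega) (fun m' _ => er m')
    (by omega) (by omega)).mono (by omega) ?_)
  rintro m₄ ⟨r₄, f₄⟩
  rw [e₀', e₂', Nat.sub_zero, ← hp] at r₄
  refine Does.put_seq (i := 40) (v := p) rfl (by simp only [IExp.eval, r₄]) (by omega) (by omega) ?_
  refine Does.put (i := 29) (v := 42) rfl rfl (by omega) (by omega) ?_
  have k30 : Function.update (Function.update m₄ 40 p) 29 42 30 = v := by
    rw [Function.update_of_ne (by omega), Function.update_of_ne (by omega), f₄ _ (by omega), e₃₀]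
  have k40 : Function.update (Function.update m₄ 40 p) 29 42 40 = p := by
    rw [Function.update_of_ne (by omega), Function.update_self]
  refine ⟨by rw [k30, k40]; exact hvp, by rw [k40]; omega, by rwa [k30], by rwa [k40], by simp,
    fun a ha => ?_⟩
  rw [Function.update_of_ne (by omega), Function.update_of_ne (by omega), f₄ _ (by omega), hm₃,
    Function.update_of_ne (by omega), Function.update_of_ne (by omega), f₂ _ (by omega), hm₁,
    Function.update_of_ne (by omega), Function.update_of_ne (by omega)]

/-- Reports the upper hull. -/
def walkProg (A : Access) : Program := .loop (unfinished A) (hullStep A)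

theorem run_walkProg (hA : A.Reads P Q) (hR : A.Reports P Q φ) (hc : HullCtx Q n s w q) {m : Mem}
    (h25 : m 25 = 2 ^ q) (h29 : m 29 = 42) (hvp : m 30 ≤ m 40) (hpn : m 40 < n)
    (hs : 42 + 2 * (q * q) + 5 * (q + 1) + 10 ≤ s) (hV : UpperVertex (Q '' Set.Iio n) (Q (m 30)))
    (hW : UpperVertex (Q '' Set.Iio n) (Q (m 40))) :
    ∃ m' o k, Run P s w (walkProg A) m m' (o.map (Prod.map φ φ)) k ∧
      k ≤ q * q * ((bridgeFactor q + 13) * n) + 1 ∧ m' 30 < n ∧ Q (m' 30) = Q (m 40) ∧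
      m' 25 = 2 ^ q ∧ (∀ a, 32 ≤ a → a < 40 → m' a = m a) ∧ IsPath (Q (m 30)) o (Q (m 40)) ∧
      ∀ e ∈ o, UpperEdge (Q '' Set.Iio n) e.1 e.2 := by
  have hn := hc.n_le
  rw [← pow_mul] at hn
  obtain ⟨m', o, hreach, h30, hQ, h25', h29', hf, hpath, hedge⟩ := hull_reach hA hR hc (q * q) m 42
    (m 30) (m 40) rfl h25 h29 le_rfl rfl hs hvp hpn (by omega) hV hW
  obtain ⟨k, hk, hrun⟩ := hreach.run (by
    simp only [unfinished, BExp.eval, IExp.eval, hA.x, h29', not_not]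
    rw [hQ, hf 40 (by omega) (by omega)]
    trivial)
  refine ⟨m', o, k, hrun, hk.trans ?_, h30, hQ, h25', fun a h h' => hf a h (by omega), hpath, hedge⟩
  have : (bridgeFactor q + 13) * (m 40 + 1 - m 30) ≤ (bridgeFactor q + 13) * n :=
    Nat.mul_le_mul_left _ (by omega)
  have := Nat.mul_le_mul_left (q * q) this
  omega

/-- Computes the branching number of the search. -/
def baseProg : Program :=
  set 25 (.const 2) ;; set 36 (.const 2) ;;
  .loop (.ilt (var 36) .len)
    (set 36 (var 36 ⨰ (.const 2 ⨰ (var 25 ⨰ var 25))) ;; set 25 (.const 2 ⨰ var 25))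

/-- Cell `36` runs through `2 ^ (i * i)` while cell `25` holds `2 ^ i`, by `(i + 1) ^ 2 = i ^ 2 + 2
i + 1`. So the least `q` with `2 ^ (q * q) ≥ n` is found without logarithms or roots. -/
theorem does_baseProg (hs : 40 ≤ s) (hq : 1 ≤ q) (hn : n ≤ 2 ^ (q * q))
    (hmin : ∀ i, 1 ≤ i → i < q → 2 ^ (i * i) < n) (hw : q * q < w) (m : Mem) :
    Does P s w baseProg m (3 * q) fun m' => m' 25 = 2 ^ q := by
  have hpow : ∀ {i}, i ≤ q * q → 2 ^ i < 2 ^ w := fun h =>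
    Nat.pow_lt_pow_right (by omega) (by omega)
  have hqq : q ≤ q * q := Nat.le_mul_of_pos_left _ (by omega)
  refine Does.mono (k := 1 + (1 + ((q - 1) * (1 + 1 + 1) + 1))) ?_ (by omega) fun _ => id
  have h2 := hpow (i := 1) (by omega)
  refine Does.put_seq (i := 25) (v := 2) rfl rfl (by omega) (by omega) ?_
  refine Does.put_seq (i := 36) (v := 2) rfl rfl (by omega) (by omega) ?_
  refine (Does.loop (k := 1 + 1) (fun r m' => ∃ i, i + r = q ∧ 1 ≤ i ∧ m' 25 = 2 ^ i ∧
    m' 36 = 2 ^ (i * i)) ?_ ?_ (q - 1) _ ?_).mono le_rfl ?_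
  · rintro r m' ⟨i, hi, hi', h25, h36⟩
    refine ⟨by simpa only [BExp.eval, IExp.eval, h36] using hmin i hi' (by omega), ?_⟩
    refine Does.put_seq (i := 36) (v := 2 ^ ((i + 1) * (i + 1))) rfl ?_ (by omega) ?_ ?_
    · simp only [IExp.eval, h36, h25]
      rw [show (i + 1) * (i + 1) = i * i + (1 + (i + i)) by ring, pow_add, pow_add, pow_add, pow_one]
    · exact hpow (Nat.mul_le_mul (by omega) (by omega))
    refine Does.put (i := 25) (v := 2 ^ (i + 1)) rfl ?_ (by omega) (hpow (by omega)) ?_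
    · simp only [IExp.eval]
      rw [Function.update_of_ne (by omega), h25, pow_succ, mul_comm]
    · exact ⟨i + 1, by omega, by omega, by simp, by
        rw [Function.update_of_ne (by omega), Function.update_self]⟩
  · rintro m' ⟨i, hi, -, -, h36⟩
    obtain rfl : i = q := by omega
    simp only [BExp.eval, IExp.eval, h36]
    omega
  · exact ⟨1, by omega, le_rfl, by rw [Function.update_of_ne (by omega), Function.update_self]; rfl,
      by simp⟩
  · rintro m' ⟨i, hi, -, h25, -⟩
    obtain rfl : i = q := by omega
    exact h25

open Classical in
/-- The edge between two points with the same abscissa, if they are different. -/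
noncomputable def verticalEdge (u v : Pt) : List (Pt × Pt) := if u.2 = v.2 then [] else [(u, v)]

/-- Reports the edge between two points with the same abscissa, if they are different. -/
def verticalProg (a b : IExp) : Program :=
  .cond (.req (.ycoord a) (.ycoord b)) .skip (.report a b)

theorem run_verticalProg {a b : IExp} {m : Mem} {u v : Pt}
    (ha : ∃ h : a.eval n m < n, P ⟨_, h⟩ = u) (hb : ∃ h : b.eval n m < n, P ⟨_, h⟩ = v) :
    Run P s w (verticalProg a b) m m (verticalEdge u v) 2 := by
  obtain ⟨ha, rfl⟩ := ha
  obtain ⟨hb, rfl⟩ := hb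
  have hev : (BExp.req (.ycoord a) (.ycoord b)).eval P m ↔ (P ⟨_, ha⟩).2 = (P ⟨_, hb⟩).2 := by
    simp only [BExp.eval, RExp.eval, fetch, ha, hb, dif_pos]
  by_cases h : (P ⟨_, ha⟩).2 = (P ⟨_, hb⟩).2
  · rw [verticalEdge, if_pos h]
    exact .cond_true (hev.2 h) (.skip m)
  · rw [verticalEdge, if_neg h]
    exact .cond_false (fun h' => h (hev.1 h')) (.report _ _ _ ha hb)

/-- The input array, read from left to right. -/
def forward : Access := ⟨.xcoord, .ycoord, id⟩

/-- The reflection of the input array in the origin, read from right to left. -/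
def backward : Access where
  x e := .sub (.const 0) (.xcoord (.sub (.sub .len (.const 1)) e))
  y e := .sub (.const 0) (.ycoord (.sub (.sub .len (.const 1)) e))
  idx e := .sub (.sub .len (.const 1)) e

theorem forward_reads : forward.Reads P (fetch P) := ⟨fun _ _ => rfl, fun _ _ => rfl⟩

theorem forward_reports : forward.Reports P (fetch P) id := fun e m h =>
  ⟨h, by simp only [fetch, h, dif_pos, id]; rfl⟩

/-- Negation reverses the order of the abscissas and reading backwards restores it. The upper hull
of the reflected set is the lower hull, traversed from right to left as the clockwise order demands.
-/
theorem backward_reads : backward.Reads P fun i => -fetch P (n - 1 - i) :=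
  ⟨fun _ _ => by simp [backward, RExp.eval, IExp.eval],
    fun _ _ => by simp [backward, RExp.eval, IExp.eval]⟩

theorem backward_reports : backward.Reports P (fun i => -fetch P (n - 1 - i)) Neg.neg :=
  fun e m h => by
    have h' : (backward.idx e).eval n m < n := by simp only [backward, IExp.eval]; omega
    refine ⟨h', ?_⟩
    rw [neg_neg, fetch, dif_pos (by omega)]
    rfl

theorem image_fetch : fetch P '' Set.Iio n = Set.range P := by
  ext p
  constructor
  · rintro ⟨t, ht, rfl⟩
    have ht : t < n := ht
    exact ⟨⟨t, ht⟩, by rw [fetch, dif_pos ht]⟩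
  · rintro ⟨t, rfl⟩
    exact ⟨t, t.2, by rw [fetch, dif_pos t.2]⟩

theorem image_neg_fetch :
    (fun i => -fetch P (n - 1 - i)) '' Set.Iio n = Neg.neg '' Set.range P := by
  ext p
  constructor
  · rintro ⟨t, ht, rfl⟩
    have ht : t < n := ht
    refine ⟨_, ⟨⟨n - 1 - t, by omega⟩, rfl⟩, ?_⟩
    change _ = -fetch P (n - 1 - t)
    rw [fetch, dif_pos (by omega)]
  · rintro ⟨_, ⟨t, rfl⟩, rfl⟩
    have ht := t.2
    refine ⟨n - 1 - t, by simp; omega, ?_⟩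
    change -fetch P (n - 1 - (n - 1 - t)) = _
    rw [show n - 1 - (n - 1 - (t : ℕ)) = t by omega, fetch, dif_pos t.2]

/-- The algorithm for the convex hull. -/
def hullProgram : Program :=
  .cond (.ilt (.const 0) .len)
    (baseProg ;; initProg forward ;; set 34 (var 30) ;; walkProg forward ;; set 35 (var 30) ;;
      initProg backward ;; verticalProg (var 35) (backward.idx (var 30)) ;; walkProg backward ;;
      verticalProg (backward.idx (var 30)) (var 34))
    .skip

/-- The output consists of the upper hull, the right side down to `-a`, the lower hull, and the left
side up from `-b`. Here `-a` is the lowest of the rightmost points and `-b` the lowest of the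
leftmost ones. -/
theorem run_hullProgram (hP : Monotone fun i => (P i).1) (hn : 1 ≤ n) (hq : 1 ≤ q)
    (hnq : n ≤ 2 ^ (q * q)) (hmin : ∀ i, 1 ≤ i → i < q → 2 ^ (i * i) < n)
    (hs : 42 + 2 * (q * q) + 5 * (q + 1) + 10 ≤ s) (hsw : s < 2 ^ w) (hqw : q * q < w)
    (hw : 8 * 2 ^ q * (n + 2) < 2 ^ w) :
    ∃ m' k u v a b o₁ o₂, Run P s w hullProgram (fun _ => 0) m'
        (o₁ ++ (verticalEdge v (-a) ++ (o₂.map (Prod.map Neg.neg Neg.neg) ++ verticalEdge (-b) u)))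
        k ∧
      k ≤ 2 * (q * q * ((bridgeFactor q + 13) * n)) + 3 * q + 16 * n + 33 ∧
      IsFirst (Set.range P) u ∧ IsLast (Set.range P) v ∧ IsFirst (Neg.neg '' Set.range P) a ∧
      IsLast (Neg.neg '' Set.range P) b ∧ IsPath u o₁ v ∧ IsPath a o₂ b ∧
      (∀ e ∈ o₁, UpperEdge (Set.range P) e.1 e.2) ∧
      ∀ e ∈ o₂, UpperEdge (Neg.neg '' Set.range P) e.1 e.2 := by
  have hb : (n + 2) ≤ 8 * 2 ^ q * (n + 2) := Nat.le_mul_of_pos_left _ (by positivity)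
  have hnq' : n ≤ (2 ^ q) ^ q := by rwa [← pow_mul]
  have sort₁ : ∀ i j, i ≤ j → j < n → (fetch P i).1 ≤ (fetch P j).1 := by
    intro i j hij hj
    rw [fetch, fetch, dif_pos hj, dif_pos (by omega)]
    exact hP (show (⟨i, by omega⟩ : Fin n) ≤ ⟨j, hj⟩ from hij)
  have sort₂ : ∀ i j, i ≤ j → j < n → (-fetch P (n - 1 - i)).1 ≤ (-fetch P (n - 1 - j)).1 := by
    intro i j hij hj
    simpa using sort₁ (n - 1 - j) (n - 1 - i) (by omega) (by omega)
  have hc₁ : HullCtx (fetch P) n s w q := ⟨sort₁, hq, hnq', hsw, hw⟩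
  have hc₂ : HullCtx (fun i => -fetch P (n - 1 - i)) n s w q := ⟨sort₂, hq, hnq', hsw, hw⟩
  obtain ⟨m₁, k₁, R₁, t₁, h25₁⟩ := does_baseProg (P := P) (s := s) (by omega) hq hnq hmin hqw
    (fun _ => 0)
  obtain ⟨m₂, k₂, R₂, t₂, hvp₂, hpn₂, hfirst₂, hlast₂, h29₂, f₂⟩ := does_initProg (w := w)
    forward_reads sort₁ hn (by omega) hsw (by omega) m₁
  set m₃ := Function.update m₂ 34 (m₂ 30) with hm₃
  have R₃ : Run P s w (set 34 (var 30)) m₂ m₃ [] 1 := .store _ _ _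
    (by simp only [IExp.eval]; omega) (by simp only [IExp.eval]; omega)
  have f₃ : ∀ a, a ≠ 34 → m₃ a = m₂ a := fun a ha => Function.update_of_ne ha _ _
  have e30₃ := f₃ 30 (by omega)
  have e40₃ := f₃ 40 (by omega)
  have e34₃ : m₃ 34 = m₂ 30 := by simp [hm₃]
  obtain ⟨m₄, o₁, k₄, R₄, t₄, h30₄, hQ₄, h25₄, f₄, path₁, edge₁⟩ := run_walkProg forward_reads
    forward_reports hc₁ ((f₃ _ (by omega)).trans ((f₂ _ (by omega)).trans h25₁))
    ((f₃ _ (by omega)).trans h29₂) (by rw [e30₃, e40₃]; exact hvp₂) (by rw [e40₃]; exact hpn₂) hs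
    (by rw [e30₃]; exact hfirst₂.upperVertex) (by rw [e40₃]; exact hlast₂.upperVertex)
  rw [e30₃, e40₃] at path₁
  rw [e40₃] at hQ₄
  set m₅ := Function.update m₄ 35 (m₄ 30) with hm₅
  have R₅ : Run P s w (set 35 (var 30)) m₄ m₅ [] 1 := .store _ _ _
    (by simp only [IExp.eval]; omega) (by simp only [IExp.eval]; omega)
  have f₅ : ∀ a, a ≠ 35 → m₅ a = m₄ a := fun a ha => Function.update_of_ne ha _ _
  have e35₅ : m₅ 35 = m₄ 30 := by simp [hm₅]
  obtain ⟨m₆, k₆, R₆, t₆, hvp₆, hpn₆, hfirst₆, hlast₆, h29₆, f₆⟩ := does_initProg (w := w)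
    backward_reads sort₂ hn (by omega) hsw (by omega) m₅
  have e35₆ : m₆ 35 = m₄ 30 := (f₆ _ (by omega)).trans e35₅
  obtain ⟨m₈, o₂, k₈, R₈, t₈, h30₈, hQ₈, h25₈, f₈, path₂, edge₂⟩ := run_walkProg backward_reads
    backward_reports hc₂ ((f₆ _ (by omega)).trans ((f₅ _ (by omega)).trans h25₄))
    h29₆ hvp₆ hpn₆ hs hfirst₆.upperVertex hlast₆.upperVertex
  have e34₈ : m₈ 34 = m₂ 30 := (f₈ _ (by omega) (by omega)).trans ((f₆ _ (by omega)).trans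
    ((f₅ _ (by omega)).trans ((f₄ _ (by omega) (by omega)).trans e34₃)))
  have R₇ : Run P s w (verticalProg (var 35) (backward.idx (var 30))) m₆ m₆
      (verticalEdge (fetch P (m₂ 40)) (-(-fetch P (n - 1 - m₆ 30)))) 2 := by
    refine run_verticalProg ?_ ?_
    · obtain ⟨h, h'⟩ := forward_reports (P := P) (var 35) m₆
        (by simp only [IExp.eval, e35₆]; exact h30₄)
      exact ⟨h, h'.trans (by simp only [IExp.eval, e35₆, id, hQ₄])⟩
    · exact backward_reports (P := P) (var 30) m₆ (by simp only [IExp.eval]; omega)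
  have R₉ : Run P s w (verticalProg (backward.idx (var 30)) (var 34)) m₈ m₈
      (verticalEdge (-(-fetch P (n - 1 - m₆ 40))) (fetch P (m₂ 30))) 2 := by
    refine run_verticalProg ?_ ?_
    · obtain ⟨h, h'⟩ := backward_reports (P := P) (var 30) m₈ (by simp only [IExp.eval]; exact h30₈)
      exact ⟨h, h'.trans (by simp only [IExp.eval]; rw [hQ₈])⟩
    · obtain ⟨h, h'⟩ := forward_reports (P := P) (var 34) m₈
        (by simp only [IExp.eval, e34₈]; omega)
      exact ⟨h, h'.trans (by simp only [IExp.eval, e34₈, id])⟩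
  rw [image_fetch] at hfirst₂ hlast₂ edge₁
  rw [image_neg_fetch] at hfirst₆ hlast₆ edge₂
  refine ⟨m₈, 1 + (k₁ + (k₂ + (1 + (k₄ + (1 + (k₆ + (2 + (k₈ + 2)))))))), _, _, _, _, o₁, o₂,
    .cond_true (by simp only [BExp.eval, IExp.eval]; omega) ?_, ?_,
    hfirst₂, hlast₂, hfirst₆, hlast₆, path₁, path₂, edge₁, edge₂⟩
  · have := R₁.seq (R₂.seq (R₃.seq (R₄.seq (R₅.seq (R₆.seq (R₇.seq (R₈.seq R₉)))))))
    simpa using this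
  · omega

end ReadOnly

/-! ### From edges of upper hulls to edges of the convex hull. -/

namespace ReadOnly

variable {S : Set Pt} {u v a b c d p : Pt}

/-- A point that is lexicographically maximal with respect to two linear functions is extreme. -/
theorem mem_extremePoints_of_lex (f g : Pt →ₗ[ℝ] ℝ)
    (hinj : ∀ p r, f p = f r → g p = g r → p = r) (hu : u ∈ S)
    (h : ∀ p ∈ S, f p < f u ∨ f p = f u ∧ g p ≤ g u) :
    u ∈ (convexHull ℝ S).extremePoints ℝ := by
  -- The points lexicographically at most `u` form a convex set, which therefore contains the hull.
  -- On a segment through `u` inside this set, first `f` and then `g` must be constant.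
  have hconv : Convex ℝ {p | f p < f u ∨ f p = f u ∧ g p ≤ g u} := by
    rw [convex_iff_forall_pos]
    intro x hx y hy s t hs ht hst
    simp only [Set.mem_ofPred_eq, map_add, map_smul, smul_eq_mul] at *
    obtain rfl : s = 1 - t := by linarith
    rcases hx with hx | ⟨hx, hx'⟩ <;> rcases hy with hy | ⟨hy, hy'⟩
    · exact .inl (by nlinarith [mul_lt_mul_of_pos_left hx hs, mul_lt_mul_of_pos_left hy ht])
    · exact .inl (by rw [hy]; nlinarith [mul_lt_mul_of_pos_left hx hs])
    · exact .inl (by rw [hx]; nlinarith [mul_lt_mul_of_pos_left hy ht])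
    · refine .inr ⟨by rw [hx, hy]; ring, ?_⟩
      nlinarith [mul_le_mul_of_nonneg_left hx' hs.le, mul_le_mul_of_nonneg_left hy' ht.le]
  have hsub := convexHull_min h hconv
  refine mem_extremePoints.2 ⟨subset_convexHull ℝ S hu, ?_⟩
  rintro x hx y hy ⟨s, t, hs, ht, hst, hxy⟩
  obtain rfl : s = 1 - t := by linarith
  have hx : f x < f u ∨ f x = f u ∧ g x ≤ g u := hsub hx
  have hy : f y < f u ∨ f y = f u ∧ g y ≤ g u := hsub hy
  have hf : (1 - t) * f x + t * f y = f u := by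
    rw [← hxy, map_add, map_smul, map_smul, smul_eq_mul, smul_eq_mul]
  have hg : (1 - t) * g x + t * g y = g u := by
    rw [← hxy, map_add, map_smul, map_smul, smul_eq_mul, smul_eq_mul]
  have fx : f x ≤ f u := hx.elim le_of_lt fun h => h.1.le
  have fy : f y ≤ f u := hy.elim le_of_lt fun h => h.1.le
  have fx' : f x = f u := by
    refine fx.antisymm ?_
    by_contra! hlt
    nlinarith [mul_lt_mul_of_pos_left hlt hs, mul_le_mul_of_nonneg_left fy ht.le]
  have fy' : f y = f u := by
    refine fy.antisymm ?_
    by_contra! hlt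
    nlinarith [mul_lt_mul_of_pos_left hlt ht, mul_le_mul_of_nonneg_left fx hs.le]
  have gx : g x ≤ g u := hx.elim (fun h => absurd fx' h.ne) And.right
  have gy : g y ≤ g u := hy.elim (fun h => absurd fy' h.ne) And.right
  have gx' : g x = g u := by
    refine gx.antisymm ?_
    by_contra! hlt
    nlinarith [mul_lt_mul_of_pos_left hlt hs, mul_le_mul_of_nonneg_left gy ht.le]
  have gy' : g y = g u := by
    refine gy.antisymm ?_
    by_contra! hlt
    nlinarith [mul_lt_mul_of_pos_left hlt ht, mul_le_mul_of_nonneg_left gx hs.le]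
  exact ⟨hinj _ _ fx' gx', hinj _ _ fy' gy'⟩

theorem mem_openSegment_of_fst {σ : ℝ} (h₁ : p.1 < c.1) (h₂ : c.1 < d.1)
    (hp : p.2 - σ * p.1 = c.2 - σ * c.1) (hd : d.2 - σ * d.1 = c.2 - σ * c.1) :
    c ∈ openSegment ℝ p d := by
  have hpos : 0 < d.1 - p.1 := by linarith
  refine ⟨(d.1 - c.1) / (d.1 - p.1), (c.1 - p.1) / (d.1 - p.1), div_pos (by linarith) hpos,
    div_pos (by linarith) hpos, by field_simp; ring, ?_⟩
  have e₁ : p.2 = c.2 - σ * c.1 + σ * p.1 := by linarith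
  have e₂ : d.2 = c.2 - σ * c.1 + σ * d.1 := by linarith
  ext
  · simp only [Prod.fst_add, Prod.smul_fst, smul_eq_mul]
    field_simp
    ring
  · simp only [Prod.snd_add, Prod.smul_snd, smul_eq_mul, e₁, e₂]
    field_simp
    ring

theorem mem_openSegment_of_snd (h₁ : p.1 = c.1) (h₂ : d.1 = c.1) (h₃ : p.2 < c.2)
    (h₄ : c.2 < d.2) : c ∈ openSegment ℝ p d := by
  have hpos : 0 < d.2 - p.2 := by linarith
  refine ⟨(d.2 - c.2) / (d.2 - p.2), (c.2 - p.2) / (d.2 - p.2), div_pos (by linarith) hpos,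
    div_pos (by linarith) hpos, by field_simp; ring, ?_⟩
  ext
  · simp only [Prod.fst_add, Prod.smul_fst, smul_eq_mul, h₁, h₂]
    field_simp
    ring
  · simp only [Prod.snd_add, Prod.smul_snd, smul_eq_mul]
    field_simp
    ring

theorem not_mem_openSegment (hc : c ∈ (convexHull ℝ S).extremePoints ℝ) (hp : p ∈ S) (hd : d ∈ S)
    (hpc : p ≠ c) : c ∉ openSegment ℝ p d := fun h =>
  hpc ((mem_extremePoints.1 hc).2 p (subset_convexHull ℝ S hp) d (subset_convexHull ℝ S hd) h).1

/-- On the support line the left end maximizes `-x` and the right end `x`. So both ends are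
lexicographic maxima, with the intercept as first function. -/
theorem UpperEdge.isHullEdge (h : UpperEdge S c d) : IsHullEdge S c d := by
  obtain ⟨hc, hd, hlt, σ, heq, hσ⟩ := h
  set f : Pt →ₗ[ℝ] ℝ := LinearMap.snd ℝ ℝ ℝ - σ • LinearMap.fst ℝ ℝ ℝ with hf
  have ef : ∀ p, f p = p.2 - σ * p.1 := fun p => by simp [hf]
  refine ⟨mem_extremePoints_of_lex f (-LinearMap.fst ℝ ℝ ℝ) (fun p r h₁ h₂ => ?_) hc fun p hp => ?_,
    mem_extremePoints_of_lex f (LinearMap.fst ℝ ℝ ℝ) (fun p r h₁ h₂ => ?_) hd fun p hp => ?_,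
    fun h => hlt.ne (by rw [h]), fun p hp => ?_⟩
  · simp only [ef, LinearMap.neg_apply, LinearMap.fst_apply, neg_inj] at h₁ h₂
    exact Prod.ext h₂ (by rw [h₂] at h₁; linarith)
  · rw [ef, ef]
    rcases (hσ p hp).1.lt_or_eq with h | h
    · exact .inl h
    · exact .inr ⟨h, by simpa using ((hσ p hp).2 h).1⟩
  · simp only [ef, LinearMap.fst_apply] at h₁ h₂
    exact Prod.ext h₂ (by rw [h₂] at h₁; linarith)
  · rw [ef, ef, ← heq]
    rcases (hσ p hp).1.lt_or_eq with h | h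
    · exact .inl h
    · exact .inr ⟨h, by simpa using ((hσ p hp).2 h).2⟩
  · have e : d.2 - c.2 = σ * (d.1 - c.1) := by linarith
    rw [e]
    nlinarith [mul_le_mul_of_nonneg_left (hσ p hp).1 (sub_nonneg.2 hlt.le)]

/-- The line through `c` and `d` supports the set by assumption. A point on it beyond `c` or `d`
would put that end inside a segment, against extremality. -/
theorem IsHullEdge.upperEdge (h : IsHullEdge S c d) (hlt : c.1 < d.1) : UpperEdge S c d := by
  obtain ⟨hc, hd, -, hle⟩ := h
  have hcS := extremePoints_convexHull_subset hc
  have hdS := extremePoints_convexHull_subset hd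
  have hpos : 0 < d.1 - c.1 := sub_pos.2 hlt
  set σ := (d.2 - c.2) / (d.1 - c.1) with hσ
  have e : d.2 - c.2 = σ * (d.1 - c.1) := by rw [hσ]; field_simp
  have heq : c.2 - σ * c.1 = d.2 - σ * d.1 := by linarith
  refine ⟨hcS, hdS, hlt, σ, heq, fun p hp => ⟨?_, fun hpe => ⟨?_, ?_⟩⟩⟩
  · have := hle p hp
    rw [e] at this
    have : (d.1 - c.1) * ((p.2 - c.2) - σ * (p.1 - c.1)) ≤ 0 := by linarith
    have := nonpos_of_mul_nonpos_right this hpos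
    linarith
  · by_contra! hpc
    exact not_mem_openSegment hc hp hdS (fun h => hpc.ne (by rw [h]))
      (mem_openSegment_of_fst hpc hlt hpe heq.symm)
  · by_contra! hpd
    refine not_mem_openSegment hd hcS hp (fun h => hlt.ne (by rw [h]))
      (mem_openSegment_of_fst hlt hpd heq (hpe.trans heq))

/-- Two support lines that touch the set over a common stretch of abscissas are the same line, and
an edge is determined by its line as the outermost points on it. -/
theorem UpperEdge.eq_of_overlap (h : UpperEdge S u v) (h' : UpperEdge S c d) (h₁ : c.1 ≤ u.1)
    (h₂ : u.1 < d.1) : c = u ∧ d = v := by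
  obtain ⟨hu, hv, huv, τ, eτ, hτ⟩ := h
  obtain ⟨hc, hd, hcd, σ, eσ, hσ⟩ := h'
  -- If `σ > τ`, comparing `u` and `d` for both slopes gives a contradiction. If `σ < τ`, comparing
  -- `c` and `u` puts them in the same column, and then `v` gives the contradiction.
  have hστ : σ = τ := by
    have d₁ := (hτ d hd).1
    have d₂ := (hσ u hu).1
    have c₁ := (hτ c hc).1
    have v₂ := (hσ v hv).1
    rcases lt_trichotomy σ τ with hlt | h | hlt
    · have hcu : c.1 = u.1 := by
        by_contra hne
        have := lt_of_le_of_ne h₁ hne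
        nlinarith [mul_pos (sub_pos.2 hlt) (sub_pos.2 this)]
      rw [hcu] at d₂ c₁ v₂
      nlinarith [mul_pos (sub_pos.2 hlt) (sub_pos.2 huv)]
    · exact h
    · nlinarith [mul_pos (sub_pos.2 hlt) (sub_pos.2 h₂)]
  subst hστ
  have e : c.2 - σ * c.1 = u.2 - σ * u.1 := le_antisymm (hτ c hc).1 (hσ u hu).1
  have b₁ := (hτ c hc).2 e
  have b₂ := (hτ d hd).2 (eσ.symm.trans e)
  have b₃ := (hσ v hv).2 (eτ.symm.trans e.symm)
  have hcu : c.1 = u.1 := le_antisymm h₁ b₁.1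
  have hdv : d.1 = v.1 := le_antisymm b₂.2 b₃.2
  rw [hcu] at e
  rw [hcu, hdv] at eσ
  exact ⟨Prod.ext hcu (by linarith), Prod.ext hdv (by linarith)⟩

/-- Completeness comes from connectedness: a path from `a` to `b` must cross the abscissa of `u`
with one of its edges, and that edge overlaps `(u, v)`. -/
theorem IsPath.mem_of_upperEdge {l : List (Pt × Pt)} (hl : IsPath a l b)
    (hE : ∀ e ∈ l, UpperEdge S e.1 e.2) (h : UpperEdge S u v) (h₁ : a.1 ≤ u.1) (h₂ : u.1 < b.1) :
    (u, v) ∈ l := by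
  induction l generalizing a with
  | nil =>
    obtain rfl : a = b := hl
    linarith
  | cons e l ih =>
    obtain ⟨rfl, hl⟩ := hl
    rcases lt_or_ge u.1 e.2.1 with h₃ | h₃
    · obtain ⟨h₄, h₅⟩ := h.eq_of_overlap (hE e (by simp)) h₁ h₃
      rw [← h₄, ← h₅]
      simp
    · exact List.mem_cons_of_mem _ (ih hl (fun e he => hE e (by simp [he])) h₃)

/-- The starting abscissas increase strictly along the path. -/
theorem IsPath.nodup {l : List (Pt × Pt)} (hl : IsPath a l b) (hE : ∀ e ∈ l, e.1.1 < e.2.1) :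
    l.Nodup ∧ ∀ e ∈ l, a.1 ≤ e.1.1 := by
  induction l generalizing a with
  | nil => simp
  | cons e l ih =>
    obtain ⟨rfl, hl⟩ := hl
    obtain ⟨h₁, h₂⟩ := ih hl fun e he => hE e (by simp [he])
    have he := hE e (by simp)
    refine ⟨List.nodup_cons.2 ⟨fun h => ?_, h₁⟩, fun f hf => ?_⟩
    · linarith [h₂ e h]
    · rcases List.mem_cons.1 hf with rfl | hf
      · exact le_rfl
      · linarith [h₂ f hf]

theorem neg_image_neg_image (S : Set Pt) : Neg.neg '' (Neg.neg '' S) = S := by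
  simp

/-- A half turn is linear and preserves orientation, so extreme points go to extreme points and the
left side of an edge stays its left side. -/
theorem IsHullEdge.neg (h : IsHullEdge S c d) : IsHullEdge (Neg.neg '' S) (-c) (-d) := by
  have hex : (convexHull ℝ (Neg.neg '' S)).extremePoints ℝ =
      Neg.neg '' (convexHull ℝ S).extremePoints ℝ := by
    have h₁ := (LinearEquiv.neg ℝ (M := Pt)).toLinearMap.image_convexHull S
    have h₂ := image_extremePoints (𝕜 := ℝ) (LinearEquiv.neg ℝ (M := Pt)) (convexHull ℝ S)
    have e : ∀ T : Set Pt, (LinearEquiv.neg ℝ (M := Pt)) '' T = Neg.neg '' T := fun T => rfl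
    rw [e, e] at h₂
    rw [h₂]
    congr 1
    exact h₁.symm
  obtain ⟨hc, hd, hne, hle⟩ := h
  refine ⟨hex ▸ ⟨c, hc, rfl⟩, hex ▸ ⟨d, hd, rfl⟩, fun h => hne (neg_injective h), ?_⟩
  rintro _ ⟨p, hp, rfl⟩
  have := hle p hp
  simp only [Prod.fst_neg, Prod.snd_neg]
  linarith

theorem isHullEdge_neg : IsHullEdge (Neg.neg '' S) (-c) (-d) ↔ IsHullEdge S c d :=
  ⟨fun h => by simpa [neg_image_neg_image] using h.neg, fun h => h.neg⟩

theorem mem_verticalEdge {e : Pt × Pt} : e ∈ verticalEdge u v ↔ u.2 ≠ v.2 ∧ e = (u, v) := by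
  rw [verticalEdge]
  split_ifs with h <;> simp [h]

theorem nodup_verticalEdge : (verticalEdge u v).Nodup := by
  rw [verticalEdge]
  split_ifs <;> simp

theorem isPath_verticalEdge (h : u.1 = v.1) : IsPath u (verticalEdge u v) v := by
  rw [verticalEdge]
  split_ifs with h'
  · exact Prod.ext h h'
  · exact ⟨rfl, rfl⟩

theorem IsLast.neg_le (hb : IsLast (Neg.neg '' S) b) (hp : p ∈ S) :
    (-b).1 < p.1 ∨ (-b).1 = p.1 ∧ (-b).2 ≤ p.2 := by
  rcases hb.2 (-p) ⟨p, hp, rfl⟩ with h | ⟨h, h'⟩ <;>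
    simp only [Prod.fst_neg, Prod.snd_neg] at *
  · exact .inl (by linarith)
  · exact .inr ⟨by linarith, by linarith⟩

theorem IsLast.neg_mem (hb : IsLast (Neg.neg '' S) b) : -b ∈ S := by
  obtain ⟨p, hp, rfl⟩ := hb.1
  rwa [neg_neg]

theorem IsFirst.fst_eq_neg (hu : IsFirst S u) (hb : IsLast (Neg.neg '' S) b) : (-b).1 = u.1 :=
  le_antisymm ((hb.neg_le hu.1).elim le_of_lt fun h => h.1.le) (hu.fst_le hb.neg_mem)

theorem IsFirst.snd_neg_le (hu : IsFirst S u) (hb : IsLast (Neg.neg '' S) b) : (-b).2 ≤ u.2 :=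
  (hb.neg_le hu.1).elim (fun h => absurd (hu.fst_eq_neg hb) h.ne) And.right

/-- The vertical edge at the left end of the hull. -/
theorem isHullEdge_left_iff (hu : IsFirst S u) (hb : IsLast (Neg.neg '' S) b) :
    IsHullEdge S c d ∧ c.1 = d.1 ∧ c.2 < d.2 ↔ (c, d) ∈ verticalEdge (-b) u := by
  have e₁ := hu.fst_eq_neg hb
  have e₂ := hu.snd_neg_le hb
  rw [mem_verticalEdge, Prod.mk.injEq]
  constructor
  · rintro ⟨⟨hc, hd, -, hle⟩, hcd, hlt⟩
    have hcS := extremePoints_convexHull_subset hc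
    have hdS := extremePoints_convexHull_subset hd
    have hleft : c.1 ≤ u.1 := by
      have := hle u hu.1
      rw [hcd, sub_self, zero_mul, zero_sub, neg_nonpos] at this
      have := nonneg_of_mul_nonneg_right this (sub_pos.2 hlt)
      linarith
    have hcu : c.1 = u.1 := le_antisymm hleft (hu.fst_le hcS)
    -- Otherwise `d` would lie strictly between `c` and `u` in the leftmost column and would not be
    -- extreme. The argument for `c` and `-b` is the same.
    have hdu : d = u := by
      by_contra hne
      have h₁ : d.2 ≤ u.2 := (hu.2 d hdS).elim (fun h => absurd h (by linarith)) And.right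
      have h₂ : d.2 ≠ u.2 := fun h => hne (Prod.ext (hcd ▸ hcu) h)
      exact not_mem_openSegment hd hcS hu.1 (fun h => hlt.ne (by rw [h]))
        (mem_openSegment_of_snd hcd (hcu.symm.trans hcd) hlt (lt_of_le_of_ne h₁ h₂))
    have hcb : c = -b := by
      by_contra hne
      have h₁ : (-b).2 ≤ c.2 := (hb.neg_le hcS).elim (fun h => absurd h (by linarith)) And.right
      have h₂ : (-b).2 ≠ c.2 := fun h => hne (Prod.ext (hcu.trans e₁.symm) h.symm)
      exact not_mem_openSegment hc hb.neg_mem hdS (Ne.symm hne)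
        (mem_openSegment_of_snd (e₁.trans hcu.symm) hcd.symm (lt_of_le_of_ne h₁ h₂) hlt)
    exact ⟨by rw [← hdu, ← hcb]; exact hlt.ne, hcb, hdu⟩
  · rintro ⟨hne, rfl, rfl⟩
    have hlt := lt_of_le_of_ne e₂ hne
    refine ⟨⟨mem_extremePoints_of_lex (-LinearMap.fst ℝ ℝ ℝ) (-LinearMap.snd ℝ ℝ ℝ)
      (fun p r h₁ h₂ => ?_) hb.neg_mem fun p hp => ?_,
      mem_extremePoints_of_lex (-LinearMap.fst ℝ ℝ ℝ) (LinearMap.snd ℝ ℝ ℝ)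
      (fun p r h₁ h₂ => ?_) hu.1 fun p hp => ?_, fun h => hne (by rw [h]), fun p hp => ?_⟩, e₁, hlt⟩
    · simp only [LinearMap.neg_apply, LinearMap.fst_apply, LinearMap.snd_apply, neg_inj] at h₁ h₂
      exact Prod.ext h₁ h₂
    · simp only [LinearMap.neg_apply, LinearMap.fst_apply, LinearMap.snd_apply, neg_lt_neg_iff,
        neg_inj, neg_le_neg_iff]
      exact (hb.neg_le hp).imp id fun h => ⟨h.1.symm, h.2⟩
    · simp only [LinearMap.neg_apply, LinearMap.fst_apply, LinearMap.snd_apply, neg_inj] at h₁ h₂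
      exact Prod.ext h₁ h₂
    · simp only [LinearMap.neg_apply, LinearMap.fst_apply, LinearMap.snd_apply, neg_lt_neg_iff,
        neg_inj]
      exact (hu.2 p hp).imp id fun h => ⟨h.1.symm, h.2⟩
    · have := hu.fst_le hp
      rw [e₁, sub_self, zero_mul, zero_sub, neg_nonpos]
      exact mul_nonneg (by linarith) (by linarith)

/-- The vertical edge at the right end of the hull. -/
theorem isHullEdge_right_iff (hv : IsLast S v) (ha : IsFirst (Neg.neg '' S) a) :
    IsHullEdge S c d ∧ c.1 = d.1 ∧ d.2 < c.2 ↔ (c, d) ∈ verticalEdge v (-a) := by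
  have h := isHullEdge_left_iff (c := -c) (d := -d) ha (by rwa [neg_image_neg_image])
  rw [isHullEdge_neg, mem_verticalEdge, Prod.mk.injEq] at h
  rw [mem_verticalEdge, Prod.mk.injEq]
  simp only [Prod.fst_neg, Prod.snd_neg, neg_inj, neg_lt_neg_iff] at h ⊢
  rw [h, neg_eq_iff_eq_neg (a := d)]
  exact and_congr_left fun _ => not_congr (by constructor <;> intro <;> linarith)

/-- The upper hull, the right side, the lower hull and the left side make up the hull. -/
theorem listsHullInOrder {o₁ o₂ : List (Pt × Pt)} (hu : IsFirst S u) (hv : IsLast S v)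
    (ha : IsFirst (Neg.neg '' S) a) (hb : IsLast (Neg.neg '' S) b) (h₁ : IsPath u o₁ v)
    (h₂ : IsPath a o₂ b) (hE₁ : ∀ e ∈ o₁, UpperEdge S e.1 e.2)
    (hE₂ : ∀ e ∈ o₂, UpperEdge (Neg.neg '' S) e.1 e.2) :
    ListsHullInOrder S (o₁ ++ (verticalEdge v (-a) ++
      (o₂.map (Prod.map Neg.neg Neg.neg) ++ verticalEdge (-b) u))) := by
  set ν : Pt × Pt → Pt × Pt := Prod.map Neg.neg Neg.neg with hν
  -- The four lists are exactly the hull edges that run to the right, downwards, to the left and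
  -- upwards. This gives completeness by trichotomy and also disjointness.
  have up : ∀ e, e ∈ o₁ ↔ IsHullEdge S e.1 e.2 ∧ e.1.1 < e.2.1 := fun e =>
    ⟨fun he => ⟨(hE₁ e he).isHullEdge, (hE₁ e he).lt⟩, fun ⟨he, hlt⟩ =>
      h₁.mem_of_upperEdge hE₁ (he.upperEdge hlt) (hu.fst_le (he.upperEdge hlt).left_mem)
        (hlt.trans_le (hv.fst_le (he.upperEdge hlt).right_mem))⟩
  have low' : ∀ e, e ∈ o₂ ↔ IsHullEdge (Neg.neg '' S) e.1 e.2 ∧ e.1.1 < e.2.1 := fun e =>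
    ⟨fun he => ⟨(hE₂ e he).isHullEdge, (hE₂ e he).lt⟩, fun ⟨he, hlt⟩ =>
      h₂.mem_of_upperEdge hE₂ (he.upperEdge hlt) (ha.fst_le (he.upperEdge hlt).left_mem)
        (hlt.trans_le (hb.fst_le (he.upperEdge hlt).right_mem))⟩
  have hνν : ∀ e, ν (ν e) = e := fun e => Prod.ext (neg_neg _) (neg_neg _)
  have low : ∀ e, e ∈ o₂.map ν ↔ IsHullEdge S e.1 e.2 ∧ e.2.1 < e.1.1 := by
    intro e
    have : e ∈ o₂.map ν ↔ ν e ∈ o₂ := by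
      rw [List.mem_map]
      exact ⟨fun ⟨f, hf, h⟩ => by rw [← h, hνν]; exact hf, fun h => ⟨ν e, h, hνν e⟩⟩
    rw [this, low', hν]
    simp only [Prod.map_fst, Prod.map_snd, isHullEdge_neg, Prod.fst_neg, neg_lt_neg_iff]
  have left : ∀ e, e ∈ verticalEdge (-b) u ↔ IsHullEdge S e.1 e.2 ∧ e.1.1 = e.2.1 ∧ e.1.2 < e.2.2 :=
    fun e => (isHullEdge_left_iff hu hb).symm
  have right : ∀ e, e ∈ verticalEdge v (-a) ↔
      IsHullEdge S e.1 e.2 ∧ e.1.1 = e.2.1 ∧ e.2.2 < e.1.2 :=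
    fun e => (isHullEdge_right_iff hv ha).symm
  refine ⟨fun e => ?_, ?_, ?_⟩
  · simp only [List.mem_append, up, low, left, right]
    refine ⟨by tauto, fun he => ?_⟩
    rcases lt_trichotomy e.1.1 e.2.1 with h | h | h
    · exact .inl ⟨he, h⟩
    · rcases lt_trichotomy e.1.2 e.2.2 with h' | h' | h'
      · exact .inr (.inr (.inr ⟨he, h, h'⟩))
      · exact absurd (Prod.ext h h') he.2.2.1
      · exact .inr (.inl ⟨he, h, h'⟩)
    · exact .inr (.inr (.inl ⟨he, h⟩))
  · have n₁ := (h₁.nodup fun e he => (hE₁ e he).lt).1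
    have n₂ := ((h₂.nodup fun e he => (hE₂ e he).lt).1).map
      (f := ν) (Function.LeftInverse.injective hνν)
    rw [List.nodup_append', List.nodup_append', List.nodup_append']
    refine ⟨n₁, ⟨nodup_verticalEdge, ⟨n₂, nodup_verticalEdge, ?_⟩, ?_⟩, ?_⟩
    · intro e he he'
      rw [low] at he
      rw [left] at he'
      linarith [he.2, he'.2.1]
    · intro e he he'
      rw [right] at he
      rw [List.mem_append, low, left] at he'
      rcases he' with he' | he'
      · linarith [he'.2, he.2.1]
      · linarith [he'.2.2, he.2.2]
    · intro e he he'
      rw [up] at he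
      rw [List.mem_append, List.mem_append, low, left, right] at he'
      rcases he' with he' | he' | he'
      · linarith [he'.2.1, he.2]
      · linarith [he'.2, he.2]
      · linarith [he'.2.1, he.2]
  · have e₁ : v.1 = (-a).1 := by
      have := ha.fst_eq_neg (b := v) (by rwa [neg_image_neg_image])
      simp only [Prod.fst_neg] at this ⊢
      linarith
    exact (h₁.append ((isPath_verticalEdge e₁).append ((h₂.map Neg.neg).append
      (isPath_verticalEdge (hu.fst_eq_neg hb))))).isChain

end ReadOnly

/-! ### Numerical bounds and conclusion. -/

namespace ReadOnly

/-- The number of steps of the algorithm. -/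
theorem steps_le {n q : ℕ} (hn : 1 ≤ n) :
    2 * (q * q * ((bridgeFactor q + 13) * n)) + 3 * q + 16 * n + 33 ≤ 33000 * (512 ^ q * n) := by
  have ht : q * q + 1 ≤ 2 * 2 ^ q := by
    induction q with
    | zero => norm_num
    | succ q ih =>
      rw [pow_succ]
      rcases Nat.lt_or_ge q 3 with h | h
      · interval_cases q <;> norm_num
      · nlinarith
  -- The time contains three factors `q * q + 1`: two from the bridge and one from the depth of the
  -- recursion. Each is absorbed by `2 * 2 ^ q`, and `8 * 64 = 512`.
  have h512 : (512 : ℕ) ^ q = 2 ^ q * 2 ^ q * 2 ^ q * 64 ^ q := by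
    rw [← mul_pow, ← mul_pow, ← mul_pow]; norm_num
  have hqp : q + 1 ≤ 512 ^ q := Nat.lt_pow_self (by omega)
  set t := q * q + 1 with htdef
  have hF : bridgeFactor q + 13 ≤ 2013 * (t ^ 2 * 64 ^ q) := by
    have : 1 ≤ t ^ 2 * 64 ^ q := Nat.one_le_iff_ne_zero.2 (by positivity)
    rw [bridgeFactor, ← htdef]
    omega
  have h₁ : q * q * ((bridgeFactor q + 13) * n) ≤ 16104 * (512 ^ q * n) :=
    calc q * q * ((bridgeFactor q + 13) * n) ≤ t * ((2013 * (t ^ 2 * 64 ^ q)) * n) := by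
          gcongr; omega
      _ = 2013 * ((t * t * t) * 64 ^ q * n) := by ring
      _ ≤ 2013 * (((2 * 2 ^ q) * (2 * 2 ^ q) * (2 * 2 ^ q)) * 64 ^ q * n) := by gcongr
      _ = 16104 * ((2 ^ q * 2 ^ q * 2 ^ q * 64 ^ q) * n) := by ring
      _ = 16104 * (512 ^ q * n) := by rw [h512]
  have h₂ : q + 1 ≤ 512 ^ q * n := hqp.trans (Nat.le_mul_of_pos_right _ hn)
  have h₃ : n ≤ 512 ^ q * n := Nat.le_mul_of_pos_left _ (by positivity)
  omega

section

variable {n q : ℕ}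

/-- By minimality of `q`, the exponent `q - 1` is too small for `n`; the case `q = 1` is trivial. -/
theorem sq_le_logb (hn : 2 ≤ n) (hq : 1 ≤ q) (hmin : ∀ i, 1 ≤ i → i < q → 2 ^ (i * i) < n) :
    ((q : ℝ) - 1) ^ 2 ≤ Real.logb 2 n := by
  have hn0 : (0 : ℝ) < n := by positivity
  obtain ⟨i, rfl⟩ : ∃ i, q = i + 1 := ⟨q - 1, by omega⟩
  rw [Real.le_logb_iff_rpow_le (by norm_num) hn0]
  have : (((i + 1 : ℕ) : ℝ) - 1) ^ 2 = ((i * i : ℕ) : ℝ) := by push_cast; ring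
  rw [this, Real.rpow_natCast]
  rcases Nat.eq_zero_or_pos i with rfl | hi
  · have : (2 : ℝ) ≤ n := by exact_mod_cast hn
    norm_num
    linarith
  · exact_mod_cast (hmin i hi (by omega)).le

theorem one_le_logb (hn : 2 ≤ n) : 1 ≤ Real.logb 2 n := by
  have : (2 : ℝ) ≤ n := by exact_mod_cast hn
  rw [Real.le_logb_iff_rpow_le (by norm_num) (by linarith), Real.rpow_one]
  exact this

theorem sq_le_four_mul_logb (hn : 2 ≤ n) (hq : 1 ≤ q)
    (hmin : ∀ i, 1 ≤ i → i < q → 2 ^ (i * i) < n) : (q : ℝ) ^ 2 ≤ 4 * Real.logb 2 n := by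
  have h₁ := sq_le_logb hn hq hmin
  have h₂ := one_le_logb hn
  rcases hq.eq_or_lt with rfl | hq'
  · norm_num; linarith
  · have : (2 : ℝ) ≤ q := by exact_mod_cast hq'
    nlinarith

/-- For `L ≥ 1`, the square root of `L` is at most `L ε` up to a constant factor and summand. -/
theorem nine_mul_sqrt_le {L ε : ℝ} (hL : 1 ≤ L) (hε : √(Real.logb 2 L / L) < ε) :
    9 * √L ≤ L * ε + 9 * √(2 ^ 81) := by
  have hL0 : 0 < L := by linarith
  have hε0 : 0 ≤ ε := (Real.sqrt_nonneg _).trans hε.le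
  have hc : 0 ≤ √(2 ^ 81 : ℝ) := Real.sqrt_nonneg _
  -- For bounded `L` the constant summand suffices. Beyond `2 ^ 81` the assumption on `ε` gives `ε ≥
  -- 9 / √L`, since `81 = 9 ^ 2`.
  rcases le_or_gt L (2 ^ 81) with h | h
  · have := Real.sqrt_le_sqrt h
    have := mul_nonneg hL0.le hε0
    linarith
  · have h81 : 81 ≤ Real.logb 2 L := by
      rw [Real.le_logb_iff_rpow_le (by norm_num) hL0]
      refine le_trans (le_of_eq ?_) h.le
      rw [← Real.rpow_natCast]
      norm_num
    have h₁ : √(81 / L) ≤ ε := (Real.sqrt_le_sqrt (by gcongr)).trans hε.le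
    have h₂ : √(81 / L) = 9 / √L := by
      rw [Real.sqrt_div (by norm_num), show (81 : ℝ) = 9 ^ 2 by norm_num,
        Real.sqrt_sq (by norm_num)]
    rw [h₂, div_le_iff₀ (Real.sqrt_pos.2 hL0)] at h₁
    have h₃ := mul_le_mul_of_nonneg_right h₁ (Real.sqrt_nonneg L)
    rw [mul_assoc, Real.mul_self_sqrt hL0.le] at h₃
    linarith

/-- `512 = 2 ^ 9`, so `512 ^ (q - 1) ≤ 2 ^ (9 √L)` with `L = log n`, while `n ^ ε = 2 ^ (L ε)`. The
exponents are compared by `nine_mul_sqrt_le`. -/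
theorem pow_mul_le_rpow (hn : 2 ≤ n) (hq : 1 ≤ q)
    (hmin : ∀ i, 1 ≤ i → i < q → 2 ^ (i * i) < n) {ε : ℝ}
    (hε : √(Real.logb 2 (Real.logb 2 n) / Real.logb 2 n) < ε) :
    (512 : ℝ) ^ q * n ≤ 512 * (2 : ℝ) ^ (9 * √(2 ^ 81)) * (n : ℝ) ^ (1 + ε) := by
  have hn0 : (0 : ℝ) < n := by positivity
  set L := Real.logb 2 (n : ℝ) with hL
  have hnL : (n : ℝ) = 2 ^ L := by
    rw [hL, Real.rpow_logb (by norm_num) (by norm_num) hn0]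
  have h₁ : (q : ℝ) - 1 ≤ √L := by
    rw [← Real.sqrt_sq (show (0 : ℝ) ≤ (q : ℝ) - 1 by
      have : (1 : ℝ) ≤ q := by exact_mod_cast hq
      linarith)]
    exact Real.sqrt_le_sqrt (sq_le_logb hn hq hmin)
  have h₂ := nine_mul_sqrt_le (one_le_logb hn) hε
  have h512 : (512 : ℝ) ^ q = 512 * 2 ^ (9 * ((q : ℝ) - 1)) := by
    obtain ⟨i, rfl⟩ : ∃ i, q = i + 1 := ⟨q - 1, by omega⟩
    have : (9 * (((i + 1 : ℕ) : ℝ) - 1)) = ((9 * i : ℕ) : ℝ) := by push_cast; ring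
    rw [this, Real.rpow_natCast, pow_mul, pow_succ]
    norm_num [mul_comm]
  have h₃ : (2 : ℝ) ^ (9 * ((q : ℝ) - 1)) ≤ 2 ^ (L * ε + 9 * √(2 ^ 81)) :=
    Real.rpow_le_rpow_of_exponent_le (by norm_num) (by linarith)
  have h₄ : (n : ℝ) ^ (1 + ε) = n * 2 ^ (L * ε) := by
    rw [Real.rpow_add hn0, Real.rpow_one]
    nth_rewrite 2 [hnL]
    rw [← Real.rpow_mul (by norm_num)]
  rw [h512, h₄]
  rw [Real.rpow_add (by norm_num)] at h₃
  calc 512 * (2 : ℝ) ^ (9 * ((q : ℝ) - 1)) * n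
      ≤ 512 * ((2 : ℝ) ^ (L * ε) * 2 ^ (9 * √(2 ^ 81))) * n := by gcongr
    _ = 512 * (2 : ℝ) ^ (9 * √(2 ^ 81)) * (n * 2 ^ (L * ε)) := by ring

end

theorem listsHullInOrder_empty : ListsHullInOrder ∅ [] := by
  refine ⟨fun e => ⟨fun h => absurd h (by simp), fun h => ?_⟩, List.nodup_nil, .nil⟩
  exact absurd (extremePoints_convexHull_subset h.1) (Set.notMem_empty _)

/-- The algorithm lists the hull in order, within the stated bounds for space and time. -/
theorem hullProgram_spec :
    ∃ C : ℝ, ∀ (n : ℕ) (P : Fin n → Pt), Monotone (fun i => (P i).1) →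
      ∃ (s w t : ℕ) (out : List (Pt × Pt)),
        Computes hullProgram P s w t out ∧ ListsHullInOrder (Set.range P) out ∧
        (2 ≤ n →
          (s : ℝ) ≤ C * Real.logb 2 n ∧
          (w : ℝ) ≤ C * Real.logb 2 n ∧
          ∀ ε : ℝ, √(Real.logb 2 (Real.logb 2 n) / Real.logb 2 n) < ε → ε < 1 →
            (t : ℝ) ≤ C * (n : ℝ) ^ (1 + ε)) := by
  set c : ℝ := hullProgram.unitCost * (33000 * (512 * (2 : ℝ) ^ (9 * √(2 ^ 81)))) with hc
  have hc0 : 0 ≤ c := by positivity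
  -- The summand `c` is for the time and 256 for the space: `2 q ^ 2 + 5 q + 57` cells of `q ^ 2 + q
  -- + 7` bits, where `q ^ 2 ≤ 4 log n` and `log n ≥ 1`.
  refine ⟨256 + c, fun n P hP => ?_⟩
  rcases Nat.eq_zero_or_pos n with rfl | hn
  · refine ⟨0, 0, _, [], ⟨_, .cond_false ?_ (.skip _)⟩, ?_, fun h => by omega⟩
    · simp [BExp.eval, IExp.eval]
    · rw [Set.range_eq_empty]
      exact listsHullInOrder_empty
  have hex : ∃ q, 1 ≤ q ∧ n ≤ 2 ^ (q * q) :=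
    ⟨n, hn, Nat.lt_two_pow_self.le.trans (Nat.pow_le_pow_right (by omega)
      (Nat.le_mul_of_pos_left _ hn))⟩
  classical
  set q := Nat.find hex with hqdef
  obtain ⟨hq, hnq⟩ : 1 ≤ q ∧ n ≤ 2 ^ (q * q) := Nat.find_spec hex
  have hmin : ∀ i, 1 ≤ i → i < q → 2 ^ (i * i) < n := fun i hi hiq => by
    have := Nat.find_min hex hiq
    by_contra! h
    exact this ⟨hi, h⟩
  clear_value q
  -- The largest numbers are of the order of `2 ^ q * n ≤ 2 ^ q * 2 ^ (q * q)`; the seven extra bits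
  -- cover the constants.
  have hw : 2 ^ (q * q + q + 7) = 128 * (2 ^ (q * q) * 2 ^ q) := by
    rw [pow_add, pow_add]; ring
  have hsw : 42 + 2 * (q * q) + 5 * (q + 1) + 10 < 2 ^ (q * q + q + 7) := by
    have h : q * q + q + 1 ≤ 2 ^ (q * q + q) := Nat.lt_two_pow_self
    rw [pow_add] at h
    omega
  have hbw : 8 * 2 ^ q * (n + 2) < 2 ^ (q * q + q + 7) := by
    have h1 : 1 ≤ 2 ^ (q * q) := Nat.one_le_two_pow
    have h2 : 0 < 2 ^ q := by positivity
    have h3 : 2 ^ q * (n + 2) ≤ 2 ^ q * (3 * 2 ^ (q * q)) := Nat.mul_le_mul_left _ (by omega)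
    have h4 : 0 < 2 ^ (q * q) * 2 ^ q := by positivity
    rw [hw]
    nlinarith
  obtain ⟨m', k, u, v, a, b, o₁, o₂, hrun, hk, hu, hv, ha, hb, h₁, h₂, hE₁, hE₂⟩ :=
    run_hullProgram (w := q * q + q + 7) hP hn hq hnq hmin le_rfl hsw (by omega) hbw
  obtain ⟨t, hexec, ht⟩ := hrun.exists_exec
  refine ⟨_, _, t, _, ⟨m', hexec⟩, listsHullInOrder hu hv ha hb h₁ h₂ hE₁ hE₂, fun hn2 => ?_⟩
  have hL := one_le_logb hn2
  have hq4 := sq_le_four_mul_logb hn2 hq hmin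
  have hq1 : (1 : ℝ) ≤ q := by exact_mod_cast hq
  have hcL : 0 ≤ c * Real.logb 2 n := by positivity
  refine ⟨?_, ?_, fun ε hε _ => ?_⟩
  · push_cast
    nlinarith
  · push_cast
    nlinarith
  · have h₃ : t ≤ hullProgram.unitCost * (33000 * (512 ^ q * n)) :=
      ht.trans (Nat.mul_le_mul_left _ (hk.trans (steps_le hn)))
    have h₄ : (t : ℝ) ≤ hullProgram.unitCost * (33000 * ((512 : ℝ) ^ q * n)) := by
      exact_mod_cast h₃
    have h₅ := pow_mul_le_rpow hn2 hq hmin hε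
    have hnε : 0 ≤ (n : ℝ) ^ (1 + ε) := by positivity
    calc (t : ℝ) ≤ hullProgram.unitCost * (33000 * ((512 : ℝ) ^ q * n)) := h₄
      _ ≤ hullProgram.unitCost *
          (33000 * (512 * (2 : ℝ) ^ (9 * √(2 ^ 81)) * (n : ℝ) ^ (1 + ε))) := by gcongr
      _ = c * (n : ℝ) ^ (1 + ε) := by rw [hc]; ring
      _ ≤ (256 + c) * (n : ℝ) ^ (1 + ε) := by gcongr; linarith

end ReadOnly

theorem theorem2 :
    ∃ (p : ReadOnly.Program) (C : ℝ), ∀ (n : ℕ) (P : Fin n → ℝ × ℝ),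
      Monotone (fun i => (P i).1) →
      ∃ (s w t : ℕ) (out : List ((ℝ × ℝ) × (ℝ × ℝ))),
        ReadOnly.Computes p P s w t out ∧
        ReadOnly.ListsHullInOrder (Set.range P) out ∧
        (2 ≤ n →
          (s : ℝ) ≤ C * Real.logb 2 n ∧
          (w : ℝ) ≤ C * Real.logb 2 n ∧
          ∀ ε : ℝ, √(Real.logb 2 (Real.logb 2 n) / Real.logb 2 n) < ε → ε < 1 →
            (t : ℝ) ≤ C * (n : ℝ) ^ (1 + ε)) :=
  ⟨ReadOnly.hullProgram, ReadOnly.hullProgram_spec⟩
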